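/- **Model.** Fix $d,M\in\mathbb N=\{1,2,\dots\}$, $a,\alpha\in(0,1/2)$, $b,\beta>0$ and a random variable $m$ with values in $\{1,\dots,M\}$. Start from any finite directed multigraph $G_0$ with $n_0>M$ vertices, each having a location in the torus $[0,1]$ (independent of all the randomness below). Given $G_n$, take $m_n$ distributed as $m$, and add a vertex $v_{n+1}$ with location $X_{n+1}$ uniform on $[0,1]$; write $\deg^- v$ for the in-degree of $v$ in $G_n$ (so $\deg^- v_{n+1}=0$). *Vertex step:* draw an edge from $v_{n+1}$ to every vertex $v$ of $G_n$ whose torus distance to $X_{n+1}$ is less than $\frac{\frac a2\deg^- v+\frac b2}{n}$. *Edge step:* choose $u_n$ uniformly among all $n_0+n+1$ vertices. Form $d$ independent samples of vertices other than $u_n$: each vertex $v\ne u_n$ belongs to a given sample, independently, with probability $\min\{1,\frac{\alpha\deg^- v+\beta}{n}\}$; a sample with fewer than $m_n$ vertices is completed to $m_n$ vertices by vertices chosen uniformly, without replacement, among the remaining vertices other than $u_n$. From each sample keep the $m_n$ vertices of highest in-degree; then draw edges from $u_n$ to the $m_n$ distinct vertices of highest in-degree among all the vertices kept (ties are broken at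 random). All random choices are independent; for $n=0$ the radius is read as infinite and the probability as $1$. Let $M_k(n)$ be the $k$-th highest in-degree in $G_n$. **Notation.** Let $h(x)=1-(1-\alpha x)^d$, let $Q_{i,r}(x_1,\dots,x_{i-1})$ be the probability that at most $r-1$ of $i-1$ independent events with probabilities $h(x_1),\dots,h(x_{i-1})$ occur, that is $$Q_{i,r}(x_1,\dots,x_{i-1})=\sum_{S\subseteq\{1,\dots,i-1\},\,|S|<r}\ \prod_{j\in S}h(x_j)\prod_{j\notin S}(1-h(x_j)),$$ and put $Q_i=\mathbb E\,Q_{i,m}$, $f_i(x_1,\dots,x_i)=a x_i+h(x_i)Q_i(x_1,\dots,x_{i-1})-x_i$ and $F_K=(f_1,\dots,f_K)$. A positive solution of $F_K=0$ means a solution with $0<x_i\le 2$ for $i=1,\dots,K$. **Theorem.** 1. If $a+d\alpha<1$, then for every $\epsilon>0$, $$\Pr\left(\forall n>N:\ n^{a+d\alpha-\epsilon}<M_1(n)<n^{a+d\alpha+\epsilon}\right)\to1\quad\text{as }N\to\infty.$$ 2. If $a+d\alpha=1$, then almost surely $$\lim_{n\to\infty}\frac{M_1(n)\ln n}{n}=\frac{2}{d(d-1)\alpha^2}.$$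 3. If $a+d\alpha>1$, then $F_1=0$ has a positive solution, and for every $K$ for which $F_K=0$ has a positive solution $x^*=(x_1^*,\dots,x_K^*)$ and every $k\le K$, almost surely $$\lim_{n\to\infty}\frac{M_k(n)}{n}=x_k^*.$$ -/

import Mathlib

open MeasureTheory ProbabilityTheory Filter Topology

noncomputable section

namespace SpatialPA

/-- Parameters of the model. Vertices are natural numbers: `0, …, n₀ - 1` are the vertices of the
initial graph, and `n₀ + n` is the vertex added when the graph at time `n + 1` is built from the
graph at time `n`. A directed multigraph is given by its multiset of edges `(source, target)`. -/
structure Model where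
  /-- slope and intercept of the influence region in the vertex step -/
  a : ℝ
  b : ℝ
  /-- slope and intercept of the sampling probability in the edge step -/
  α : ℝ
  β : ℝ
  /-- number of samples in the edge step -/
  d : ℕ
  /-- largest possible value of the number of edges drawn in the edge step -/
  M : ℕ
  /-- distribution of the number of edges drawn in the edge step -/
  law : PMF ℕ
  /-- number of vertices of the initial graph -/
  n₀ : ℕ
  /-- edges of the initial graph -/
  E₀ : Multiset (ℕ × ℕ)
  a_pos : 0 < a
  a_lt : a < 1 / 2
  b_pos : 0 < b
  α_pos : 0 < α
  α_lt : α < 1 / 2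
  β_pos : 0 < β
  d_pos : 1 ≤ d
  law_supp : ∀ r, law r ≠ 0 → 1 ≤ r ∧ r ≤ M
  M_lt : M < n₀
  E₀_lt : ∀ e ∈ E₀, e.1 < n₀ ∧ e.2 < n₀

/-- One realization of all the randomness that drives the model. -/
structure Noise where
  /-- `X v` is the location of the vertex `v` (a real number, read modulo 1) -/
  X : ℕ → ℝ
  /-- `m n` is the number of edges drawn in the edge step from time `n` to time `n + 1` -/
  m : ℕ → ℕ
  /-- `u n` is the source of the edges drawn in that edge step -/
  u : ℕ → ℕ
  /-- `U n i v` decides whether the vertex `v` belongs to the `i`-th sample of that step -/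
  U : ℕ → ℕ → ℕ → ℝ
  /-- `T n i` orders the vertices at random; it is used to complete an `i`-th sample that
  is too small -/
  T : ℕ → ℕ → ℕ → ℝ
  /-- `W n` orders the vertices at random; it is used to break ties between in-degrees -/
  W : ℕ → ℕ → ℝ

/-- Names of the individual random variables of the noise. -/
inductive Source where
  | X (v : ℕ)
  | m (n : ℕ)
  | u (n : ℕ)
  | U (n i v : ℕ)
  | T (n i v : ℕ)
  | W (n v : ℕ)

/-- The individual random variables of the noise, all as real numbers. -/
def Noise.coord (ξ : Noise) : Source → ℝ
  | .X v => ξ.X v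
  | .m n => (ξ.m n : ℝ)
  | .u n => (ξ.u n : ℝ)
  | .U n i v => ξ.U n i v
  | .T n i v => ξ.T n i v
  | .W n v => ξ.W n v

/-- The uniform distribution on `[0, 1]`. -/
def unif : Measure ℝ := volume.restrict (Set.Icc 0 1)

/-- `ξ` has the law required by the model: all its variables are independent, the locations of the
added vertices are uniform on `[0, 1]` (those of the initial vertices may have any law, in
particular they may be deterministic or uniform), each `m n` has the law `mdl.law`, `u n` is uniform
on the `n₀ + n + 1` vertices present, and all auxiliary variables are uniform on `[0, 1]`. -/
structure IsNoise {Ω : Type*} [MeasurableSpace Ω] (mdl : Model) (P : Measure Ω)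
    (ξ : Ω → Noise) : Prop where
  measurable : ∀ s : Source, Measurable fun ω => (ξ ω).coord s
  indep : iIndepFun (fun (s : Source) (ω : Ω) => (ξ ω).coord s) P
  law_X : ∀ v, mdl.n₀ ≤ v → P.map (fun ω => (ξ ω).X v) = unif
  law_m : ∀ n r, P {ω | (ξ ω).m n = r} = mdl.law r
  law_u : ∀ n v, v < mdl.n₀ + n + 1 →
    P {ω | (ξ ω).u n = v} = ((mdl.n₀ + n + 1 : ℕ) : ENNReal)⁻¹
  law_U : ∀ n i v, P.map (fun ω => (ξ ω).U n i v) = unif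
  law_T : ∀ n i v, P.map (fun ω => (ξ ω).T n i v) = unif
  law_W : ∀ n v, P.map (fun ω => (ξ ω).W n v) = unif

/-- In-degree of `v`, with multiplicity. -/
def inDeg (E : Multiset (ℕ × ℕ)) (v : ℕ) : ℕ := E.countP fun e => e.2 = v

/-- The `r` elements of `S` with the largest values of `κ` (all of `S` if it has fewer than `r`
elements), for a function `κ` that is injective on `S`. -/
def top {γ : Type*} [LinearOrder γ] (κ : ℕ → γ) (r : ℕ) (S : Finset ℕ) : Finset ℕ :=
  S.filter fun v => (S.filter fun w => κ v < κ w).card < r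

/-- The `k`-th largest value of `f` on `S`, for `1 ≤ k ≤ S.card`: the largest `t` such that
at least `k` elements of `S` have a value `≥ t`. -/
def kthLargest (S : Finset ℕ) (f : ℕ → ℕ) (k : ℕ) : ℕ :=
  sSup {t : ℕ | k ≤ (S.filter fun v => t ≤ f v).card}

variable (mdl : Model) (ξ : Noise)

namespace Model

/-- Vertices of the graph at time `n`. -/
def verts (n : ℕ) : Finset ℕ := Finset.range (mdl.n₀ + n)

/-- Vertex step: the new vertex `n₀ + n` is joined to every `v` of the graph at time `n` whose
distance to it on the torus is less than `(a / 2 * deg v + b / 2) / n`. (Written without division;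
at time `n = 0` the radius is read as infinite.) -/
def vertexTargets (E : Multiset (ℕ × ℕ)) (n : ℕ) : Finset ℕ :=
  (mdl.verts n).filter fun v =>
    (n : ℝ) * ‖((ξ.X (mdl.n₀ + n) - ξ.X v : ℝ) : UnitAddCircle)‖
      < mdl.a / 2 * inDeg E v + mdl.b / 2

/-- Vertices that can be sampled in the edge step: all those present, including the new one,
except `u n`. -/
def pool (n : ℕ) : Finset ℕ := (mdl.verts (n + 1)).erase (ξ.u n)

/-- The `i`-th sample: each vertex `v` of the pool belongs to it, independently, with probability
`(α * deg v + β) / n` (with probability 1 if this exceeds 1 or if `n = 0`). -/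
def sample (E : Multiset (ℕ × ℕ)) (n i : ℕ) : Finset ℕ :=
  (mdl.pool ξ n).filter fun v => (n : ℝ) * ξ.U n i v < mdl.α * inDeg E v + mdl.β

/-- If the `i`-th sample has fewer than `m n` elements, the missing ones are
chosen uniformly without replacement among the other vertices of the pool. (Truncated subtraction
is intended: nothing is added to a sample that is large enough.) -/
def filledSample (E : Multiset (ℕ × ℕ)) (n i : ℕ) : Finset ℕ :=
  mdl.sample ξ E n i ∪
    top (fun v => toLex (ξ.T n i v, v)) (ξ.m n - (mdl.sample ξ E n i).card)
      (mdl.pool ξ n \ mdl.sample ξ E n i)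

/-- Vertices ordered by in-degree, ties being broken at random. -/
def degKey (E : Multiset (ℕ × ℕ)) (n v : ℕ) : ℕ ×ₗ (ℝ ×ₗ ℕ) :=
  toLex (inDeg E v, toLex (ξ.W n v, v))

/-- Secondary sample: the `m n` vertices of highest in-degree of each of the `d` samples. -/
def secondary (E : Multiset (ℕ × ℕ)) (n : ℕ) : Finset ℕ :=
  (Finset.range mdl.d).biUnion fun i => top (degKey ξ E n) (ξ.m n) (mdl.filledSample ξ E n i)

/-- Edge step: `u n` is joined to the `m n` distinct vertices of highest in-degree of the
secondary sample. -/
def edgeTargets (E : Multiset (ℕ × ℕ)) (n : ℕ) : Finset ℕ :=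
  top (degKey ξ E n) (ξ.m n) (mdl.secondary ξ E n)

/-- Edges of the graph at time `n`. -/
def graph : ℕ → Multiset (ℕ × ℕ)
  | 0 => mdl.E₀
  | n + 1 =>
    let E := graph n
    E + (mdl.vertexTargets ξ E n).val.map (fun v => (mdl.n₀ + n, v))
      + (mdl.edgeTargets ξ E n).val.map (fun v => (ξ.u n, v))

/-- `maxDeg k n` is the `k`-th highest in-degree of the graph at time `n` (`k ≥ 1`). -/
def maxDeg (k n : ℕ) : ℕ := kthLargest (mdl.verts n) (inDeg (mdl.graph ξ n)) k

/-- `h x = 1 - (1 - α x) ^ d`. -/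
def h (x : ℝ) : ℝ := 1 - (1 - mdl.α * x) ^ mdl.d

/-- The polynomial `Q_{i,r}(x_1, …, x_{i-1})`: the probability that at most `r - 1` of `i - 1`
independent events with probabilities `h x_1, …, h x_{i-1}` occur. -/
def Qr (i r : ℕ) (x : ℕ → ℝ) : ℝ :=
  ∑ S ∈ (Finset.Ico 1 i).powerset with S.card < r,
    (∏ j ∈ S, mdl.h (x j)) * ∏ j ∈ Finset.Ico 1 i \ S, (1 - mdl.h (x j))

/-- `Q_i = 𝔼 Q_{i,m}`. -/
def Q (i : ℕ) (x : ℕ → ℝ) : ℝ := ∑ r ∈ Finset.Icc 1 mdl.M, (mdl.law r).toReal * mdl.Qr i r x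

/-- `f_i(x_1, …, x_i) = a x_i + h(x_i) Q_i(x_1, …, x_{i-1}) - x_i`. -/
def f (i : ℕ) (x : ℕ → ℝ) : ℝ := mdl.a * x i + mdl.h (x i) * mdl.Q i x - x i

/-- `(x_1, …, x_K)` is a positive solution of `F_K = (f_1, …, f_K) = 0`, in the range
`0 < x_i ≤ 2` of the possible limits of normalized in-degrees (a vertex receives at most two edges
per unit of time). -/
def IsPosSol (K : ℕ) (x : ℕ → ℝ) : Prop :=
  ∀ i ∈ Finset.Icc 1 K, 0 < x i ∧ x i ≤ 2 ∧ mdl.f i x = 0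

end Model

end SpatialPA

end

/-!
In logarithmic time `log n`, the ratio `x = maxDeg k n / n` nearly follows the dynamics
`x' = x * rate q x`; here `q` is the probability that fewer than `m` of the `k - 1` better vertices
are sampled, `f k x = x k * rate (Q k x) (x k)` (lemma `f_eq`), and `rate q` is strictly decreasing
for `d ≥ 2`. Each coordinate of a positive solution is thus determined by the previous ones, and
attracting for the dynamics.

*Drifts.* Given the past, a fixed vertex is sampled with probability `hitProb`, independently for
different vertices, and is used to complete a sample with probability `O(1 / n)` only, by
exchangeability. Among a set `V` of `k` vertices at most `m` receive an edge in the edge step, so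
that the expected increment of the sum of their degrees is at most the quantity `driftUp` for the
`k` highest degrees (`condLE_driftUp`). Conversely the `k`-th vertex gets an edge whenever it is
sampled and fewer than `m` better ones are sampled, up to `O(1 / n)`, which bounds the increment of
`maxDeg k` from below by `driftLow` (`condLE_driftLow`) as long as `maxDeg k` stays away from
`maxDeg (k - 1)`. The upper bound is for sums because vertices of nearly equal degree change ranks,
which can make `maxDeg k` grow faster than each of them.

*Concentration.* Increments are bounded, so an exponential moment bound, the union bound over the
polynomially many `V` and the Borel-Cantelli lemma show that almost surely both bounds hold for the
degrees themselves, over all intervals in `[1, n]` and up to errors `n ^ (2/3)`, for all large `n`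
(`ae_topSum_le`, `ae_le_maxDeg`). The rest is mostly deterministic.

*Start.* Errors of order `n ^ (2/3)` are useless while degrees are small. Every degree tends to
infinity because of the vertex step (`ae_tendsto_deg`), and if the relative drift of `M` is at least
`γ < 1` whenever `M / n` is small, then `𝔼 (n ^ γ / M n)` stays bounded (on the event that this
holds from a fixed time on), which yields `M n ≥ n ^ γ'` for every `γ' < γ`
(`ae_eventually_rpow_le`). For `M = maxDeg 1` the relative drift near `0` is `a + d α`, whence the
lower bound of the subcritical regime. The upper bound comes from the moments of a single degree,
whose relative drift is at most `a + d α` (`ae_eventually_maxDeg_lt`).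

*Comparison.* If `M n / n` drifts down above a level, it ends up below every higher level, and
likewise from below (`eventually_div_le`, `eventually_le_div`). The proofs look at times at which
`M n / n`, corrected by a small multiple of `log n`, has a record, and contradict the drift on a
window before such a time. In the supercritical regime, induction on `k` applies this to `maxDeg k`:
by induction the first `k - 1` coordinates converge, so the bound for the sum becomes one for
`maxDeg k` (`IsPosSol.tendsto_maxDeg_div`). The separation needed for `driftLow` is available
because `maxDeg k n / n` has to be pushed up only while it is below `x k ≤ x (k - 1)`.

*The critical regime.* Now `rate 1 y = -c y + O(y ^ 2)` with `c = d (d - 1) α ^ 2 / 2`, so that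
`y = maxDeg 1 n / n` tends to `0` and behaves like a solution of `y' = -c y ^ 2`; that is, `1 / y`
grows like `c log n` (`eventually_mul_harm_le`, `eventually_le_mul_harm`).
-/

namespace SpatialPA

/-! ### Top vertices and ranks -/

section Ranking

variable {γ : Type*} [LinearOrder γ]

lemma mem_top {κ : ℕ → γ} {r : ℕ} {S : Finset ℕ} {v : ℕ} :
    v ∈ top κ r S ↔ v ∈ S ∧ (S.filter fun w => κ v < κ w).card < r := by
  simp [top]

lemma top_subset (κ : ℕ → γ) (r : ℕ) (S : Finset ℕ) : top κ r S ⊆ S :=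
  Finset.filter_subset _ _

lemma rank_lt_rank {κ : ℕ → γ} {S : Finset ℕ} {v w : ℕ} (hw : w ∈ S) (h : κ v < κ w) :
    (S.filter fun x => κ w < κ x).card < (S.filter fun x => κ v < κ x).card := by
  apply Finset.card_lt_card
  refine Finset.ssubset_iff_subset_ne.2 ⟨fun x hx => ?_, fun he => ?_⟩
  · simp only [Finset.mem_filter] at hx ⊢
    exact ⟨hx.1, h.trans hx.2⟩
  · have : w ∈ S.filter fun x => κ w < κ x := by
      rw [he]; simp [hw, h]
    simp at this

lemma rank_injOn {κ : ℕ → γ} (hκ : Function.Injective κ) (S : Finset ℕ) :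
    Set.InjOn (fun v => (S.filter fun x => κ v < κ x).card) (S : Set ℕ) := by
  intro v hv w hw h
  rcases lt_trichotomy (κ v) (κ w) with h1 | h1 | h1
  · exact absurd h (rank_lt_rank hw h1).ne'
  · exact hκ h1
  · exact absurd h (rank_lt_rank hv h1).ne

lemma card_top_le {κ : ℕ → γ} (hκ : Function.Injective κ) (r : ℕ) (S : Finset ℕ) :
    (top κ r S).card ≤ r := by
  calc (top κ r S).card ≤ (Finset.range r).card := by
        apply Finset.card_le_card_of_injOn (fun v => (S.filter fun x => κ v < κ x).card)
        · intro v hv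
          simpa using (mem_top.1 hv).2
        · exact (rank_injOn hκ S).mono (by exact_mod_cast top_subset κ r S)
    _ = r := Finset.card_range r

/-- Every rank below the cardinality of `S` is attained. -/
lemma exists_rank_eq {κ : ℕ → γ} (hκ : Function.Injective κ) (S : Finset ℕ) {i : ℕ}
    (hi : i < S.card) : ∃ v ∈ S, (S.filter fun x => κ v < κ x).card = i := by
  have h := Finset.surj_on_of_inj_on_of_card_le (s := S) (t := Finset.range S.card)
    (fun v _ => (S.filter fun x => κ v < κ x).card) (fun v hv => ?_)
    (fun v w hv hw h => rank_injOn hκ S hv hw h) (by simp) i (by simpa using hi)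
  · obtain ⟨v, hv, h⟩ := h
    exact ⟨v, hv, h.symm⟩
  · rw [Finset.mem_range]
    apply Finset.card_lt_card
    exact Finset.ssubset_iff_subset_ne.2 ⟨Finset.filter_subset _ _, fun he => by
      have := he ▸ hv
      simp at this⟩

lemma card_filter_le_rank {κ : ℕ → γ} (hκ : Function.Injective κ) {S : Finset ℕ} {v : ℕ}
    (hv : v ∈ S) : (S.filter fun x => κ v ≤ κ x).card = (S.filter fun x => κ v < κ x).card + 1 := by
  have : (S.filter fun x => κ v ≤ κ x) = insert v (S.filter fun x => κ v < κ x) := by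
    ext x
    simp only [Finset.mem_filter, Finset.mem_insert, le_iff_lt_or_eq]
    constructor
    · rintro ⟨h1, h2 | h2⟩
      · exact Or.inr ⟨h1, h2⟩
      · exact Or.inl (hκ h2).symm
    · rintro (rfl | h)
      · exact ⟨hv, Or.inr rfl⟩
      · exact ⟨h.1, Or.inl h.2⟩
  rw [this, Finset.card_insert_of_notMem (by simp)]

/-- The elements of a set of size `k`, listed by decreasing key. -/
lemma exists_enumeration {κ : ℕ → γ} (hκ : Function.Injective κ) (S : Finset ℕ) {k : ℕ}
    (hk : k ≤ S.card) : ∃ e : ℕ → ℕ, Set.InjOn e (Finset.Icc 1 k : Set ℕ) ∧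
      ∀ i ∈ Finset.Icc 1 k, e i ∈ S ∧ (S.filter fun x => κ (e i) < κ x).card = i - 1 := by
  have : ∀ i, ∃ v, i ∈ Finset.Icc 1 k →
      v ∈ S ∧ (S.filter fun x => κ v < κ x).card = i - 1 := by
    intro i
    by_cases hi : i ∈ Finset.Icc 1 k
    · have := Finset.mem_Icc.1 hi
      obtain ⟨v, hv, h⟩ := exists_rank_eq hκ S (i := i - 1) (by omega)
      exact ⟨v, fun _ => ⟨hv, h⟩⟩
    · exact ⟨0, fun h => absurd h hi⟩
  choose e he using this
  refine ⟨e, fun i hi j hj h => ?_, he⟩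
  have h1 := (he i hi).2
  have h2 := (he j hj).2
  rw [h, h2] at h1
  simp at hi hj
  omega

end Ranking

/-! ### The k-th largest value -/

section KthLargest

variable {S : Finset ℕ} {f : ℕ → ℕ} {k t : ℕ}

lemma kthLargest_bddAbove (hk : 1 ≤ k) :
    BddAbove {t : ℕ | k ≤ (S.filter fun v => t ≤ f v).card} := by
  refine ⟨S.sup f, fun t ht => ?_⟩
  have : (S.filter fun v => t ≤ f v).Nonempty := Finset.card_pos.1 (hk.trans ht)
  obtain ⟨v, hv⟩ := this
  rw [Finset.mem_filter] at hv
  exact hv.2.trans (Finset.le_sup hv.1)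

lemma le_kthLargest (hk : 1 ≤ k) (h : k ≤ (S.filter fun v => t ≤ f v).card) :
    t ≤ kthLargest S f k := le_csSup (kthLargest_bddAbove hk) h

lemma le_kthLargest_iff (hk : 1 ≤ k) (ht : 1 ≤ t) :
    t ≤ kthLargest S f k ↔ k ≤ (S.filter fun v => t ≤ f v).card := by
  refine ⟨fun h => ?_, le_kthLargest hk⟩
  have hne : {t : ℕ | k ≤ (S.filter fun v => t ≤ f v).card}.Nonempty := by
    by_contra hne
    rw [Set.not_nonempty_iff_eq_empty] at hne
    rw [kthLargest, hne] at h
    simp at h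
    omega
  have := Nat.sSup_mem hne (kthLargest_bddAbove hk)
  refine le_trans this (Finset.card_le_card fun v hv => ?_)
  rw [Finset.mem_filter] at hv ⊢
  exact ⟨hv.1, h.trans hv.2⟩

lemma kthLargest_le_iff (hk : 1 ≤ k) :
    kthLargest S f k ≤ t ↔ (S.filter fun v => t < f v).card < k := by
  have := le_kthLargest_iff (S := S) (f := f) hk (t := t + 1) (by omega)
  simp only [Nat.succ_le_iff] at this
  rw [← not_lt, this]
  omega

end KthLargest

/-! ### In-degrees -/

section Degrees

variable (mdl : Model) (ξ : Noise)

namespace Model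

/-- In-degree of the vertex `v` in the graph at time `n` (`0` if `v` is not yet present). -/
noncomputable def deg (n v : ℕ) : ℕ := inDeg (mdl.graph ξ n) v

lemma inDeg_add (E F : Multiset (ℕ × ℕ)) (v : ℕ) : inDeg (E + F) v = inDeg E v + inDeg F v := by
  simp [inDeg]

lemma inDeg_map (S : Finset ℕ) (u v : ℕ) :
    inDeg (S.val.map fun w => (u, w)) v = if v ∈ S then 1 else 0 := by
  classical
  unfold inDeg
  rw [Multiset.countP_map, ← Multiset.countP_eq_card_filter]
  have : (Multiset.countP (fun w => w = v) S.val) = S.val.count v := by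
    rw [Multiset.count]
    exact Multiset.countP_congr rfl (fun _ _ => by simp [eq_comm])
  rw [this, Multiset.count_eq_of_nodup S.nodup]
  rfl

lemma deg_succ (n v : ℕ) : mdl.deg ξ (n + 1) v = mdl.deg ξ n v
    + (if v ∈ mdl.vertexTargets ξ (mdl.graph ξ n) n then 1 else 0)
    + (if v ∈ mdl.edgeTargets ξ (mdl.graph ξ n) n then 1 else 0) := by
  rw [deg, deg, graph, inDeg_add, inDeg_add, inDeg_map, inDeg_map]

lemma deg_mono (v : ℕ) : Monotone fun n => mdl.deg ξ n v :=
  monotone_nat_of_le_succ fun n => by rw [deg_succ]; omega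

lemma deg_succ_le (n v : ℕ) : mdl.deg ξ (n + 1) v ≤ mdl.deg ξ n v + 2 := by
  rw [deg_succ]; split_ifs <;> omega

lemma deg_le (n v : ℕ) : mdl.deg ξ n v ≤ mdl.E₀.card + 2 * n := by
  induction n with
  | zero => exact Multiset.countP_le_card (fun e : ℕ × ℕ => e.2 = v) mdl.E₀
  | succ n ih => have := mdl.deg_succ_le ξ n v; omega

lemma mem_verts {n v : ℕ} : v ∈ mdl.verts n ↔ v < mdl.n₀ + n := Finset.mem_range

lemma mem_vertexTargets {E : Multiset (ℕ × ℕ)} {n v : ℕ} : v ∈ mdl.vertexTargets ξ E n ↔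
    v < mdl.n₀ + n ∧ (n : ℝ) * ‖((ξ.X (mdl.n₀ + n) - ξ.X v : ℝ) : UnitAddCircle)‖
      < mdl.a / 2 * inDeg E v + mdl.b / 2 := by
  rw [vertexTargets, Finset.mem_filter, mem_verts]

lemma pool_subset (n : ℕ) : mdl.pool ξ n ⊆ mdl.verts (n + 1) := Finset.erase_subset _ _

lemma filledSample_subset_pool (E : Multiset (ℕ × ℕ)) (n i : ℕ) :
    mdl.filledSample ξ E n i ⊆ mdl.pool ξ n :=
  Finset.union_subset (Finset.filter_subset _ _)
    ((top_subset _ _ _).trans Finset.sdiff_subset)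

lemma mem_secondary {E : Multiset (ℕ × ℕ)} {n v : ℕ} : v ∈ mdl.secondary ξ E n ↔
    ∃ i < mdl.d, v ∈ top (degKey ξ E n) (ξ.m n) (mdl.filledSample ξ E n i) := by
  simp [secondary]

lemma exists_mem_filledSample {E : Multiset (ℕ × ℕ)} {n v : ℕ} (h : v ∈ mdl.edgeTargets ξ E n) :
    ∃ i < mdl.d, v ∈ mdl.filledSample ξ E n i := by
  obtain ⟨i, hi, h⟩ := (mdl.mem_secondary ξ).1 (top_subset _ _ _ h)
  exact ⟨i, hi, top_subset _ _ _ h⟩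

lemma edgeTargets_subset (E : Multiset (ℕ × ℕ)) (n : ℕ) :
    mdl.edgeTargets ξ E n ⊆ mdl.verts (n + 1) := fun _ h => by
  obtain ⟨i, -, h⟩ := mdl.exists_mem_filledSample ξ h
  exact mdl.pool_subset ξ n (mdl.filledSample_subset_pool ξ E n i h)

lemma degKey_injective (E : Multiset (ℕ × ℕ)) (n : ℕ) : Function.Injective (degKey ξ E n) := by
  intro v w h
  simp only [degKey, EmbeddingLike.apply_eq_iff_eq, Prod.mk.injEq] at h
  exact h.2.2

lemma card_edgeTargets_le (E : Multiset (ℕ × ℕ)) (n : ℕ) :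
    (mdl.edgeTargets ξ E n).card ≤ ξ.m n := card_top_le (degKey_injective ξ E n) _ _

/-- An unborn vertex has in-degree `0`. -/
lemma deg_eq_zero {n v : ℕ} (hv : mdl.n₀ + n ≤ v) : mdl.deg ξ n v = 0 := by
  induction n with
  | zero =>
    simp only [deg, graph, inDeg, Multiset.countP_eq_zero]
    intro e he h
    have := (mdl.E₀_lt e he).2
    omega
  | succ n ih =>
    rw [deg_succ, ih (by omega), if_neg, if_neg]
    · intro h
      have := mdl.edgeTargets_subset ξ _ n h
      simp [verts] at this
      omega
    · intro h
      have := Finset.filter_subset _ _ h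
      simp [verts] at this
      omega

/-- `v` is sampled in one of the `d` samples, disregarding the exclusion of `u n`. -/
def Hit (E : Multiset (ℕ × ℕ)) (n v : ℕ) : Prop :=
  ∃ i < mdl.d, (n : ℝ) * ξ.U n i v < mdl.α * inDeg E v + mdl.β

/-- In the random order that is used to complete the `i`-th sample, `v` is among the first `m n + 1`
of all vertices present. -/
def Early (n i v : ℕ) : Prop :=
  v ∈ mdl.verts (n + 1) ∧ ((mdl.verts (n + 1)).filter fun w => ξ.T n i v < ξ.T n i w).card ≤ ξ.m n

lemma early_of_mem_filledSample {E : Multiset (ℕ × ℕ)} {n i v : ℕ}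
    (h : v ∈ mdl.filledSample ξ E n i) (hs : v ∉ mdl.sample ξ E n i) : mdl.Early ξ n i v := by
  have hv := mdl.pool_subset ξ n (mdl.filledSample_subset_pool ξ E n i h)
  rw [filledSample, Finset.mem_union, or_iff_right hs, mem_top] at h
  refine ⟨hv, ?_⟩
  set κ : ℕ → ℝ ×ₗ ℕ := fun v => toLex (ξ.T n i v, v)
  have : ((mdl.verts (n + 1)).filter fun w => ξ.T n i v < ξ.T n i w) ⊆
      insert (ξ.u n) (mdl.sample ξ E n i ∪
        ((mdl.pool ξ n \ mdl.sample ξ E n i).filter fun w => κ v < κ w)) := by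
    intro w hw
    rw [Finset.mem_filter] at hw
    simp only [Finset.mem_insert, Finset.mem_union, Finset.mem_filter, Finset.mem_sdiff]
    by_cases h1 : w = ξ.u n
    · exact Or.inl h1
    by_cases h2 : w ∈ mdl.sample ξ E n i
    · exact Or.inr (Or.inl h2)
    · refine Or.inr (Or.inr ⟨⟨Finset.mem_erase.2 ⟨h1, hw.1⟩, h2⟩, ?_⟩)
      exact Prod.Lex.toLex_lt_toLex.2 (Or.inl hw.2)
  have h3 := Finset.card_le_card this
  have h4 := Finset.card_insert_le (ξ.u n) (mdl.sample ξ E n i ∪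
        ((mdl.pool ξ n \ mdl.sample ξ E n i).filter fun w => κ v < κ w))
  have h5 := Finset.card_union_le (mdl.sample ξ E n i)
        ((mdl.pool ξ n \ mdl.sample ξ E n i).filter fun w => κ v < κ w)
  have h6 : ((mdl.pool ξ n \ mdl.sample ξ E n i).filter fun w => κ v < κ w).card <
    ξ.m n - (mdl.sample ξ E n i).card := h.2
  omega

lemma hit_or_early {E : Multiset (ℕ × ℕ)} {n v : ℕ} (h : v ∈ mdl.edgeTargets ξ E n) :
    mdl.Hit ξ E n v ∨ ∃ i < mdl.d, mdl.Early ξ n i v := by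
  obtain ⟨i, hi, h⟩ := mdl.exists_mem_filledSample ξ h
  by_cases hs : v ∈ mdl.sample ξ E n i
  · exact Or.inl ⟨i, hi, (Finset.mem_filter.1 hs).2⟩
  · exact Or.inr ⟨i, hi, mdl.early_of_mem_filledSample ξ h hs⟩

open Classical in
/-- At most `m n` vertices of a given set receive an edge, and, but for completions of samples, they
are all sampled. -/
lemma card_inter_edgeTargets_le (E : Multiset (ℕ × ℕ)) (n : ℕ) (V : Finset ℕ) :
    (V ∩ mdl.edgeTargets ξ E n).card ≤ min (ξ.m n) (V.filter fun v => mdl.Hit ξ E n v).card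
      + ∑ v ∈ V, ∑ i ∈ Finset.range mdl.d, if mdl.Early ξ n i v then 1 else 0 := by
  have h1 : (V ∩ mdl.edgeTargets ξ E n).card ≤ ξ.m n :=
    (Finset.card_le_card Finset.inter_subset_right).trans (mdl.card_edgeTargets_le ξ E n)
  have h2 : (V ∩ mdl.edgeTargets ξ E n).card ≤ (V.filter fun v => mdl.Hit ξ E n v).card
      + (V.filter fun v => ∃ i < mdl.d, mdl.Early ξ n i v).card := by
    refine le_trans (Finset.card_le_card ?_) (Finset.card_union_le _ _)
    intro v hv
    rw [Finset.mem_inter] at hv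
    rw [Finset.mem_union, Finset.mem_filter, Finset.mem_filter]
    rcases mdl.hit_or_early ξ hv.2 with h | h
    · exact Or.inl ⟨hv.1, h⟩
    · exact Or.inr ⟨hv.1, h⟩
  have h3 : (V.filter fun v => ∃ i < mdl.d, mdl.Early ξ n i v).card ≤
      ∑ v ∈ V, ∑ i ∈ Finset.range mdl.d, if mdl.Early ξ n i v then 1 else 0 := by
    rw [Finset.card_filter]
    refine Finset.sum_le_sum fun v _ => ?_
    split_ifs with h
    · obtain ⟨i, hi, h⟩ := h
      calc 1 = if mdl.Early ξ n i v then 1 else 0 := by rw [if_pos h]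
        _ ≤ _ := Finset.single_le_sum (f := fun i => if mdl.Early ξ n i v then 1 else 0)
          (fun _ _ => Nat.zero_le _) (Finset.mem_range.2 hi)
    · exact Nat.zero_le _
  omega

open Classical in
/-- A vertex that is sampled receives an edge unless `m n` better vertices are sampled as well, or
a better vertex is used to complete a sample. -/
lemma mem_edgeTargets_of_hit {E : Multiset (ℕ × ℕ)} {n v : ℕ} {S : Finset ℕ}
    (hS : ∀ w ∈ mdl.verts (n + 1), degKey ξ E n v < degKey ξ E n w → w ∈ S)
    (hv : v ∈ mdl.verts (n + 1)) (hu : ξ.u n ≠ v) (hH : mdl.Hit ξ E n v)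
    (hc : (S.filter fun w => mdl.Hit ξ E n w).card < ξ.m n)
    (he : ∀ w ∈ S, ∀ i < mdl.d, ¬ mdl.Early ξ n i w) : v ∈ mdl.edgeTargets ξ E n := by
  have key : ∀ w i, i < mdl.d → w ∈ mdl.filledSample ξ E n i →
      degKey ξ E n v < degKey ξ E n w → w ∈ S.filter fun w => mdl.Hit ξ E n w := by
    intro w i hi hw hlt
    have hwS := hS w (mdl.pool_subset ξ n (mdl.filledSample_subset_pool ξ E n i hw)) hlt
    rw [Finset.mem_filter]
    refine ⟨hwS, ?_⟩
    by_contra hH'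
    refine he w hwS i hi (mdl.early_of_mem_filledSample ξ hw fun hs => hH' ?_)
    exact ⟨i, hi, (Finset.mem_filter.1 hs).2⟩
  obtain ⟨i, hi, hiv⟩ := hH
  have hvs : v ∈ mdl.filledSample ξ E n i :=
    Finset.mem_union_left _ (Finset.mem_filter.2 ⟨Finset.mem_erase.2 ⟨hu.symm, hv⟩, hiv⟩)
  rw [edgeTargets, mem_top]
  constructor
  · rw [mem_secondary]
    refine ⟨i, hi, mem_top.2 ⟨hvs, lt_of_le_of_lt (Finset.card_le_card ?_) hc⟩⟩
    intro w hw
    rw [Finset.mem_filter] at hw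
    exact key w i hi hw.1 hw.2
  · refine lt_of_le_of_lt (Finset.card_le_card ?_) hc
    intro w hw
    rw [Finset.mem_filter, mem_secondary] at hw
    obtain ⟨⟨j, hj, hw1⟩, hw2⟩ := hw
    exact key w j hj (top_subset _ _ _ hw1) hw2

lemma maxDeg_def (k n : ℕ) : mdl.maxDeg ξ k n = kthLargest (mdl.verts n) (mdl.deg ξ n) k := rfl

variable {k : ℕ}

lemma maxDeg_mono (hk : 1 ≤ k) : Monotone fun n => mdl.maxDeg ξ k n := by
  refine monotone_nat_of_le_succ fun n => ?_
  rcases Nat.eq_zero_or_pos (mdl.maxDeg ξ k n) with h0 | h0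
  · simp [h0]
  have h := (le_kthLargest_iff (k := k) hk h0).1 le_rfl
  refine le_kthLargest hk (h.trans (Finset.card_le_card fun v hv => ?_))
  rw [Finset.mem_filter] at hv ⊢
  refine ⟨?_, hv.2.trans (mdl.deg_mono ξ v (Nat.le_succ n))⟩
  have := hv.1
  simp [verts] at this ⊢
  omega

lemma maxDeg_succ_le (hk : 1 ≤ k) (n : ℕ) : mdl.maxDeg ξ k (n + 1) ≤ mdl.maxDeg ξ k n + 2 := by
  by_contra hc
  push Not at hc
  have h := (le_kthLargest_iff (k := k) (t := mdl.maxDeg ξ k n + 3) hk (by omega)).1 hc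
  have : mdl.maxDeg ξ k n + 1 ≤ mdl.maxDeg ξ k n := by
    refine le_kthLargest (t := mdl.maxDeg ξ k n + 1) hk
      (h.trans (Finset.card_le_card fun v hv => ?_))
    rw [Finset.mem_filter] at hv ⊢
    have h1 := mdl.deg_succ_le ξ n v
    have h2 : mdl.maxDeg ξ k n + 3 ≤ mdl.deg ξ (n + 1) v := hv.2
    have h3 : mdl.maxDeg ξ k n + 1 ≤ mdl.deg ξ n v := by omega
    refine ⟨?_, h3⟩
    by_contra hv'
    have := mdl.deg_eq_zero ξ (n := n) (v := v) (by simpa [verts] using hv')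
    omega
  omega

lemma maxDeg_le (hk : 1 ≤ k) (n : ℕ) : mdl.maxDeg ξ k n ≤ mdl.E₀.card + 2 * n := by
  rw [maxDeg_def, kthLargest_le_iff hk]
  rw [Finset.filter_false_of_mem (fun v _ => not_lt.2 (mdl.deg_le ξ n v))]
  exact hk

lemma deg_le_maxDeg_one (n v : ℕ) : mdl.deg ξ n v ≤ mdl.maxDeg ξ 1 n := by
  by_cases hv : v ∈ mdl.verts n
  · refine le_kthLargest le_rfl (Finset.card_pos.2 ⟨v, Finset.mem_filter.2 ⟨hv, le_rfl⟩⟩)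
  · rw [mdl.deg_eq_zero ξ (by simpa [verts] using hv)]
    exact Nat.zero_le _

/-- If a set `V` is listed by decreasing degree, its `i`-th element is dominated by the `i`-th
highest degree of the graph. -/
lemma exists_enumeration_le_maxDeg (n : ℕ) (V : Finset ℕ) : ∃ e : ℕ → ℕ,
    Set.InjOn e (Finset.Icc 1 V.card : Set ℕ) ∧ (Finset.Icc 1 V.card).image e = V ∧
      ∀ i ∈ Finset.Icc 1 V.card, mdl.deg ξ n (e i) ≤ mdl.maxDeg ξ i n := by
  have hκ : Function.Injective fun v => toLex (mdl.deg ξ n v, v) := fun v w h => by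
    simp only [EmbeddingLike.apply_eq_iff_eq, Prod.mk.injEq] at h
    exact h.2
  obtain ⟨e, he, h⟩ := exists_enumeration hκ V le_rfl
  refine ⟨e, he, ?_, fun i hi => ?_⟩
  · apply Finset.eq_of_subset_of_card_le
    · intro v hv
      obtain ⟨i, hi, rfl⟩ := Finset.mem_image.1 hv
      exact (h i hi).1
    · rw [Finset.card_image_of_injOn he, Nat.card_Icc]
      omega
  · rcases Nat.eq_zero_or_pos (mdl.deg ξ n (e i)) with h0 | h0
    · simp [h0]
    have hi1 := (Finset.mem_Icc.1 hi).1
    have h2 := card_filter_le_rank hκ (h i hi).1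
    rw [(h i hi).2, Nat.sub_add_cancel hi1] at h2
    refine le_kthLargest hi1 (h2.ge.trans (Finset.card_le_card fun v hv => ?_))
    rw [Finset.mem_filter, Prod.Lex.toLex_le_toLex] at hv
    have h3 : mdl.deg ξ n (e i) ≤ mdl.deg ξ n v := by
      rcases hv.2 with h | h
      · exact h.le
      · exact h.1.le
    rw [Finset.mem_filter]
    refine ⟨?_, h3⟩
    by_contra hv'
    have := mdl.deg_eq_zero ξ (n := n) (v := v) (by simpa [verts] using hv')
    omega

/-- The `i`-th vertex in a linear order that refines the order by degree has the `i`-th highest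
degree. -/
lemma deg_eq_maxDeg_of_rank (n : ℕ) {i v : ℕ} (hi : 1 ≤ i) (hv : v ∈ mdl.verts n)
    (hr : ((mdl.verts n).filter fun w =>
      degKey ξ (mdl.graph ξ n) n v < degKey ξ (mdl.graph ξ n) n w).card = i - 1) :
    mdl.deg ξ n v = mdl.maxDeg ξ i n := by
  have hκ := degKey_injective ξ (mdl.graph ξ n) n
  apply le_antisymm
  · have h2 := card_filter_le_rank hκ hv
    rw [hr, Nat.sub_add_cancel hi] at h2
    refine le_kthLargest hi (h2.ge.trans (Finset.card_le_card fun w hw => ?_))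
    rw [Finset.mem_filter, degKey, degKey, Prod.Lex.toLex_le_toLex] at hw
    rw [Finset.mem_filter]
    refine ⟨hw.1, ?_⟩
    rcases hw.2 with h | h
    · exact h.le
    · exact h.1.le
  · rw [maxDeg_def, kthLargest_le_iff hi]
    refine lt_of_le_of_lt (Finset.card_le_card fun w hw => ?_)
      (show ((mdl.verts n).filter fun w => degKey ξ (mdl.graph ξ n) n v <
        degKey ξ (mdl.graph ξ n) n w).card < i by rw [hr]; omega)
    rw [Finset.mem_filter] at hw ⊢
    exact ⟨hw.1, Prod.Lex.toLex_lt_toLex.2 (Or.inl hw.2)⟩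

/-- Sum of the `k` highest degrees. -/
noncomputable def topSum (k n : ℕ) : ℕ := ∑ i ∈ Finset.Icc 1 k, mdl.maxDeg ξ i n

lemma sum_deg_le_topSum (n : ℕ) (V : Finset ℕ) :
    ∑ v ∈ V, mdl.deg ξ n v ≤ mdl.topSum ξ V.card n := by
  obtain ⟨e, he, hV, h⟩ := mdl.exists_enumeration_le_maxDeg ξ n V
  calc ∑ v ∈ V, mdl.deg ξ n v = ∑ i ∈ Finset.Icc 1 V.card, mdl.deg ξ n (e i) := by
        conv_lhs => rw [← hV]
        exact Finset.sum_image he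
    _ ≤ _ := Finset.sum_le_sum h

lemma exists_sum_deg_eq_topSum (n : ℕ) (hk : k ≤ mdl.n₀ + n) :
    ∃ V ⊆ mdl.verts n, V.card = k ∧ ∑ v ∈ V, mdl.deg ξ n v = mdl.topSum ξ k n := by
  obtain ⟨e, he, h⟩ := exists_enumeration (degKey_injective ξ (mdl.graph ξ n) n) (mdl.verts n)
    (k := k) (by simpa [verts] using hk)
  refine ⟨(Finset.Icc 1 k).image e, ?_, ?_, ?_⟩
  · intro v hv
    obtain ⟨i, hi, rfl⟩ := Finset.mem_image.1 hv
    exact (h i hi).1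
  · rw [Finset.card_image_of_injOn he, Nat.card_Icc]
    omega
  · rw [Finset.sum_image he]
    refine Finset.sum_congr rfl fun i hi => ?_
    exact mdl.deg_eq_maxDeg_of_rank ξ n (Finset.mem_Icc.1 hi).1 (h i hi).1 (h i hi).2

/-- The `k`-th highest degree gains at least what the `k`-th vertex gains, if the `(k-1)`-st highest
degree exceeds it by at least `2`. -/
lemma deg_succ_le_maxDeg_succ (n : ℕ) {v : ℕ} (hk : 1 ≤ k) (hv : v ∈ mdl.verts n)
    (hr : ((mdl.verts n).filter fun w =>
      degKey ξ (mdl.graph ξ n) n v < degKey ξ (mdl.graph ξ n) n w).card = k - 1)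
    (hg : k = 1 ∨ mdl.maxDeg ξ k n + 2 ≤ mdl.maxDeg ξ (k - 1) n) :
    mdl.deg ξ (n + 1) v ≤ mdl.maxDeg ξ k (n + 1) := by
  rcases hg with rfl | hg
  · exact mdl.deg_le_maxDeg_one ξ (n + 1) v
  by_cases hk1 : k = 1
  · subst hk1
    exact mdl.deg_le_maxDeg_one ξ (n + 1) v
  have hdv := mdl.deg_eq_maxDeg_of_rank ξ n hk hv hr
  have h1 := (le_kthLargest_iff (S := mdl.verts n) (f := mdl.deg ξ n) (k := k - 1)
    (t := mdl.maxDeg ξ k n + 2) (by omega) (by omega)).1 hg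
  have hnot : v ∉ (mdl.verts n).filter fun w => mdl.maxDeg ξ k n + 2 ≤ mdl.deg ξ n w := by
    rw [Finset.mem_filter, hdv]
    omega
  have h2 := Finset.card_insert_of_notMem hnot
  refine le_kthLargest hk (le_trans ?_ (Finset.card_le_card (s := insert v
    ((mdl.verts n).filter fun w => mdl.maxDeg ξ k n + 2 ≤ mdl.deg ξ n w)) fun w hw => ?_))
  · omega
  · have hsub : mdl.verts n ⊆ mdl.verts (n + 1) := by
      intro x; simp [verts]; omega
    rw [Finset.mem_insert] at hw
    rw [Finset.mem_filter]
    rcases hw with rfl | hw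
    · exact ⟨hsub hv, le_rfl⟩
    · rw [Finset.mem_filter] at hw
      refine ⟨hsub hw.1, ?_⟩
      have h3 := mdl.deg_succ_le ξ n v
      have h4 : mdl.deg ξ n w ≤ mdl.deg ξ (n + 1) w := mdl.deg_mono ξ w (Nat.le_succ n)
      have h5 := hw.2
      change _ ≤ mdl.deg ξ (n + 1) w
      omega

end Model

end Degrees

/-! ### Random subsets with independent membership -/

section BernE

variable {ι : Type*} [DecidableEq ι]

/-- Expectation of `φ S` for a random subset `S` of `s` that contains each `j ∈ s`, independently,
with probability `t j`. -/
noncomputable def bernE (s : Finset ι) (t : ι → ℝ) (φ : Finset ι → ℝ) : ℝ :=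
  ∑ S ∈ s.powerset, (∏ j ∈ S, t j) * (∏ j ∈ s \ S, (1 - t j)) * φ S

lemma bernE_empty (t : ι → ℝ) (φ : Finset ι → ℝ) : bernE ∅ t φ = φ ∅ := by
  simp [bernE]

lemma bernE_insert {s : Finset ι} {a : ι} (ha : a ∉ s) (t : ι → ℝ) (φ : Finset ι → ℝ) :
    bernE (insert a s) t φ = t a * bernE s t (fun S => φ (insert a S)) +
      (1 - t a) * bernE s t φ := by
  unfold bernE
  rw [Finset.sum_powerset_insert ha, Finset.mul_sum, Finset.mul_sum, add_comm]
  congr 1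
  · refine Finset.sum_congr rfl fun S hS => ?_
    have hS' := Finset.mem_powerset.1 hS
    have haS : a ∉ S := fun h => ha (hS' h)
    rw [Finset.prod_insert haS, Finset.insert_sdiff_insert, Finset.sdiff_insert_of_notMem ha]
    ring
  · refine Finset.sum_congr rfl fun S hS => ?_
    have hS' := Finset.mem_powerset.1 hS
    have haS : a ∉ S := fun h => ha (hS' h)
    rw [Finset.insert_sdiff_of_notMem _ haS, Finset.prod_insert (by simp [ha])]
    ring

lemma bernE_const (s : Finset ι) (t : ι → ℝ) (c : ℝ) : bernE s t (fun _ => c) = c := by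
  induction s using Finset.induction_on with
  | empty => exact bernE_empty _ _
  | insert a s ha ih => rw [bernE_insert ha, ih]; ring

lemma bernE_add (s : Finset ι) (t : ι → ℝ) (φ ψ : Finset ι → ℝ) :
    bernE s t (fun S => φ S + ψ S) = bernE s t φ + bernE s t ψ := by
  simp only [bernE, mul_add, Finset.sum_add_distrib]

lemma bernE_mono_fun {s : Finset ι} {t : ι → ℝ} {φ ψ : Finset ι → ℝ}
    (ht : ∀ j ∈ s, 0 ≤ t j ∧ t j ≤ 1) (h : ∀ S ⊆ s, φ S ≤ ψ S) : bernE s t φ ≤ bernE s t ψ := by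
  refine Finset.sum_le_sum fun S hS => ?_
  have hS' := Finset.mem_powerset.1 hS
  refine mul_le_mul_of_nonneg_left (h S hS') (mul_nonneg ?_ ?_)
  · exact Finset.prod_nonneg fun j hj => (ht j (hS' hj)).1
  · exact Finset.prod_nonneg fun j hj => by
      have := (ht j (Finset.sdiff_subset hj)).2
      linarith

lemma bernE_congr {s : Finset ι} {t t' : ι → ℝ} {φ ψ : Finset ι → ℝ}
    (ht : ∀ j ∈ s, t j = t' j) (h : ∀ S ⊆ s, φ S = ψ S) : bernE s t φ = bernE s t' ψ := by
  refine Finset.sum_congr rfl fun S hS => ?_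
  have hS' := Finset.mem_powerset.1 hS
  have h1 : ∏ j ∈ S, t j = ∏ j ∈ S, t' j := Finset.prod_congr rfl fun j hj => ht j (hS' hj)
  have h2 : ∏ j ∈ s \ S, (1 - t j) = ∏ j ∈ s \ S, (1 - t' j) :=
    Finset.prod_congr rfl fun j hj => by rw [ht j (Finset.sdiff_subset hj)]
  rw [h S hS', h1, h2]

/-- Coupling: the random set grows with the probabilities, so the expectation of a monotone `φ` does
as well. -/
lemma bernE_mono {s : Finset ι} {t t' : ι → ℝ} (ht : ∀ j ∈ s, 0 ≤ t j) (htt : ∀ j ∈ s, t j ≤ t' j)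
    (ht' : ∀ j ∈ s, t' j ≤ 1) {φ : Finset ι → ℝ} (hφ : Monotone φ) :
    bernE s t φ ≤ bernE s t' φ := by
  induction s using Finset.induction_on generalizing φ with
  | empty => simp [bernE_empty]
  | insert a s ha ih =>
    have h0 : ∀ j ∈ s, 0 ≤ t j := fun j hj => ht j (Finset.mem_insert_of_mem hj)
    have h1 : ∀ j ∈ s, t j ≤ t' j := fun j hj => htt j (Finset.mem_insert_of_mem hj)
    have h2 : ∀ j ∈ s, t' j ≤ 1 := fun j hj => ht' j (Finset.mem_insert_of_mem hj)
    have ha0 := ht a (Finset.mem_insert_self a s)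
    have ha1 := htt a (Finset.mem_insert_self a s)
    have ha2 := ht' a (Finset.mem_insert_self a s)
    have hins : Monotone fun S => φ (insert a S) := fun S T h =>
      hφ (Finset.insert_subset_insert a h)
    have h3 := ih h0 h1 h2 hφ
    have h4 := ih h0 h1 h2 hins
    have h5 : bernE s t' φ ≤ bernE s t' (fun S => φ (insert a S)) :=
      bernE_mono_fun (fun j hj => ⟨(h0 j hj).trans (h1 j hj), h2 j hj⟩)
        fun S _ => hφ (Finset.subset_insert a S)
    rw [bernE_insert ha, bernE_insert ha]
    nlinarith [mul_le_mul_of_nonneg_left h4 ha0, mul_le_mul_of_nonneg_left h3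
      (show 0 ≤ 1 - t a by linarith), mul_nonneg (sub_nonneg.2 ha1) (sub_nonneg.2 h5)]

lemma bernE_image {κ : Type*} [DecidableEq κ] {s : Finset κ} {e : κ → ι}
    (he : Set.InjOn e (s : Set κ)) (t : ι → ℝ) (φ : Finset ι → ℝ) :
    bernE (s.image e) t φ = bernE s (t ∘ e) (fun S => φ (S.image e)) := by
  induction s using Finset.induction_on generalizing φ with
  | empty => simp [bernE_empty]
  | insert a s ha ih =>
    have hs : Set.InjOn e (s : Set κ) := he.mono (by simp)
    have ha' : e a ∉ s.image e := by
      intro h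
      obtain ⟨b, hb, hab⟩ := Finset.mem_image.1 h
      have := he (by simp [hb]) (by simp) hab
      exact ha (this ▸ hb)
    rw [Finset.image_insert, bernE_insert ha', bernE_insert ha, ih hs, ih hs]
    simp only [Finset.image_insert, Function.comp]

lemma bernE_card_image {κ : Type*} [DecidableEq κ] {s : Finset κ} {e : κ → ι}
    (he : Set.InjOn e (s : Set κ)) (t : ι → ℝ) (g : ℕ → ℝ) :
    bernE (s.image e) t (fun S => g S.card) = bernE s (t ∘ e) (fun S => g S.card) := by
  rw [bernE_image he]
  refine bernE_congr (fun _ _ => rfl) fun S hS => ?_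
  rw [Finset.card_image_of_injOn (he.mono (by exact_mod_cast hS))]

lemma tendsto_bernE {α : Type*} {l : Filter α} {s : Finset ι} {u : α → ι → ℝ} {t : ι → ℝ}
    (h : ∀ j ∈ s, Tendsto (fun x => u x j) l (𝓝 (t j))) (φ : Finset ι → ℝ) :
    Tendsto (fun x => bernE s (u x) φ) l (𝓝 (bernE s t φ)) := by
  refine tendsto_finsetSum _ fun S hS => ?_
  have hS' := Finset.mem_powerset.1 hS
  refine Tendsto.mul_const _ (Tendsto.mul ?_ ?_)
  · exact tendsto_finsetProd _ fun j hj => h j (hS' hj)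
  · exact tendsto_finsetProd _ fun j hj => (h j (Finset.sdiff_subset hj)).const_sub 1

/-- If `N` of the events `1, …, k` occur, then `min r N` is the number of those among them before
which fewer than `r` have occurred. -/
lemma bernE_min_card (k r : ℕ) (t : ℕ → ℝ) :
    bernE (Finset.Icc 1 k) t (fun S => (min r S.card : ℕ)) =
      ∑ i ∈ Finset.Icc 1 k,
        t i * bernE (Finset.Ico 1 i) t (fun S => if S.card < r then 1 else 0) := by
  induction k with
  | zero => simp [bernE_empty]
  | succ k ih =>
    have h1 : Finset.Icc 1 (k + 1) = insert (k + 1) (Finset.Icc 1 k) := by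
      ext; simp only [Finset.mem_Icc, Finset.mem_insert]; omega
    have h2 : Finset.Ico 1 (k + 1) = Finset.Icc 1 k := by
      ext; simp only [Finset.mem_Icc, Finset.mem_Ico]; omega
    have hn : k + 1 ∉ Finset.Icc 1 k := by simp
    rw [h1, bernE_insert hn, Finset.sum_insert hn, ← ih, h2]
    have h3 : bernE (Finset.Icc 1 k) t (fun S => ((min r (insert (k + 1) S).card : ℕ) : ℝ)) =
        bernE (Finset.Icc 1 k) t (fun S => (min r S.card : ℕ))
        + bernE (Finset.Icc 1 k) t (fun S => if S.card < r then 1 else 0) := by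
      rw [← bernE_add]
      refine bernE_congr (fun _ _ => rfl) fun S hS => ?_
      rw [Finset.card_insert_of_notMem (fun h => hn (hS h))]
      split_ifs with h
      · rw [min_eq_right h, min_eq_right h.le]; push_cast; ring
      · rw [min_eq_left (by omega), min_eq_left (by omega)]; ring
    rw [h3]
    ring

end BernE

namespace Model

variable (mdl : Model)

/-! ### The probability that fewer than `m` events occur -/

section Law

lemma law_ne_top (r : ℕ) : mdl.law r ≠ ⊤ := mdl.law.apply_ne_top r

lemma sum_law : ∑ r ∈ Finset.Icc 1 mdl.M, (mdl.law r).toReal = 1 := by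
  have h := mdl.law.tsum_coe
  rw [tsum_eq_sum (s := Finset.Icc 1 mdl.M)] at h
  · rw [← ENNReal.toReal_sum fun r _ => mdl.law_ne_top r, h, ENNReal.toReal_one]
  · intro r hr
    by_contra h0
    exact hr (Finset.mem_Icc.2 (mdl.law_supp r h0))

/-- Probability that fewer than `m` of `i - 1` independent events with probabilities `t j`
occur. -/
noncomputable def Qt (i : ℕ) (t : ℕ → ℝ) : ℝ := ∑ r ∈ Finset.Icc 1 mdl.M,
  (mdl.law r).toReal * bernE (Finset.Ico 1 i) t (fun S => if S.card < r then 1 else 0)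

lemma Q_eq_Qt (i : ℕ) (x : ℕ → ℝ) : mdl.Q i x = mdl.Qt i (fun j => mdl.h (x j)) := by
  unfold Q Qt
  refine Finset.sum_congr rfl fun r _ => ?_
  rw [Qr, bernE, Finset.sum_filter]
  congr 1
  refine Finset.sum_congr rfl fun S _ => ?_
  split_ifs <;> simp

lemma Qt_one (t : ℕ → ℝ) : mdl.Qt 1 t = 1 := by
  rw [← mdl.sum_law]
  refine Finset.sum_congr rfl fun r hr => ?_
  have := (Finset.mem_Icc.1 hr).1
  rw [Finset.Ico_self, bernE_empty, Finset.card_empty, if_pos (by omega), mul_one]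

lemma Qt_nonneg {i : ℕ} {t : ℕ → ℝ} (ht : ∀ j ∈ Finset.Ico 1 i, 0 ≤ t j ∧ t j ≤ 1) :
    0 ≤ mdl.Qt i t := by
  refine Finset.sum_nonneg fun r _ => mul_nonneg ENNReal.toReal_nonneg ?_
  refine (bernE_const (Finset.Ico 1 i) t 0).ge.trans ?_
  exact bernE_mono_fun ht fun S _ => by split_ifs <;> norm_num

lemma Qt_le_one {i : ℕ} {t : ℕ → ℝ} (ht : ∀ j ∈ Finset.Ico 1 i, 0 ≤ t j ∧ t j ≤ 1) :
    mdl.Qt i t ≤ 1 := by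
  rw [← mdl.sum_law]
  refine Finset.sum_le_sum fun r _ => ?_
  refine mul_le_of_le_one_right ENNReal.toReal_nonneg ?_
  refine le_trans ?_ (bernE_const (Finset.Ico 1 i) t 1).le
  exact bernE_mono_fun ht fun S _ => by split_ifs <;> norm_num

lemma Qt_succ_le {i : ℕ} (hi : 1 ≤ i) {t : ℕ → ℝ}
    (ht : ∀ j ∈ Finset.Ico 1 (i + 1), 0 ≤ t j ∧ t j ≤ 1) : mdl.Qt (i + 1) t ≤ mdl.Qt i t := by
  refine Finset.sum_le_sum fun r _ => mul_le_mul_of_nonneg_left ?_ ENNReal.toReal_nonneg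
  have h1 : Finset.Ico 1 (i + 1) = insert i (Finset.Ico 1 i) := by
    ext; simp; omega
  rw [h1] at ht ⊢
  have hi' := ht i (Finset.mem_insert_self _ _)
  rw [bernE_insert (by simp)]
  have h2 : bernE (Finset.Ico 1 i) t (fun S => if (insert i S).card < r then (1 : ℝ) else 0) ≤
      bernE (Finset.Ico 1 i) t (fun S => if S.card < r then 1 else 0) := by
    refine bernE_mono_fun (fun j hj => ht j (Finset.mem_insert_of_mem hj)) fun S _ => ?_
    have := Finset.card_le_card (Finset.subset_insert i S)
    split_ifs <;> first | omega | norm_num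
  nlinarith [mul_le_mul_of_nonneg_left h2 hi'.1]

lemma tendsto_Qt {α : Type*} {l : Filter α} {i : ℕ} {u : α → ℕ → ℝ} {t : ℕ → ℝ}
    (h : ∀ j ∈ Finset.Ico 1 i, Tendsto (fun x => u x j) l (𝓝 (t j))) :
    Tendsto (fun x => mdl.Qt i (u x)) l (𝓝 (mdl.Qt i t)) :=
  tendsto_finsetSum _ fun _ _ => (tendsto_bernE h _).const_mul _

/-- `𝔼 min m N`, if `N` counts independent events with probabilities `t 1, …, t k`. -/
lemma sum_law_bernE_min (k : ℕ) (t : ℕ → ℝ) :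
    ∑ r ∈ Finset.Icc 1 mdl.M, (mdl.law r).toReal *
      bernE (Finset.Icc 1 k) t (fun S => (min r S.card : ℕ)) =
    ∑ i ∈ Finset.Icc 1 k, t i * mdl.Qt i t := by
  simp only [bernE_min_card, Finset.mul_sum, Qt]
  rw [Finset.sum_comm]
  exact Finset.sum_congr rfl fun i _ => Finset.sum_congr rfl fun r _ => by ring

end Law

/-! ### The functions `h` and `rate` -/

section HFun

/-- The factor `∑_{i < d} (1 - α x) ^ i` of `h x = α x ∑_{i < d} (1 - α x) ^ i`. -/
noncomputable def hgeom (x : ℝ) : ℝ := ∑ i ∈ Finset.range mdl.d, (1 - mdl.α * x) ^ i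

lemma h_eq (x : ℝ) : mdl.h x = mdl.α * x * mdl.hgeom x := by
  have := mul_neg_geom_sum (1 - mdl.α * x) mdl.d
  rw [h, hgeom, ← this]
  ring

lemma hgeom_zero : mdl.hgeom 0 = mdl.d := by simp [hgeom]

lemma continuous_hgeom : Continuous mdl.hgeom := by unfold hgeom; fun_prop

lemma continuous_h : Continuous mdl.h := by unfold h; fun_prop

lemma hgeom_anti {x y : ℝ} (hxy : x ≤ y) (hy : mdl.α * y ≤ 1) :
    mdl.hgeom y ≤ mdl.hgeom x := by
  refine Finset.sum_le_sum fun i _ => pow_le_pow_left₀ (by linarith) ?_ i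
  have := mul_le_mul_of_nonneg_left hxy mdl.α_pos.le
  linarith

lemma hgeom_strictAnti (hd : 2 ≤ mdl.d) {x y : ℝ} (hxy : x < y) (hy : mdl.α * y ≤ 1) :
    mdl.hgeom y < mdl.hgeom x := by
  have h1 := mul_lt_mul_of_pos_left hxy mdl.α_pos
  refine Finset.sum_lt_sum (fun i _ => pow_le_pow_left₀ (by linarith) (by linarith) i)
    ⟨1, Finset.mem_range.2 hd, by simpa using h1⟩

lemma one_le_hgeom {x : ℝ} (hx : mdl.α * x ≤ 1) : 1 ≤ mdl.hgeom x := by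
  have hd := mdl.d_pos
  calc (1 : ℝ) = (1 - mdl.α * x) ^ 0 := by simp
    _ ≤ mdl.hgeom x := Finset.single_le_sum (f := fun i => (1 - mdl.α * x) ^ i)
      (fun i _ => pow_nonneg (by linarith) i) (Finset.mem_range.2 (by omega))

lemma hgeom_le {x : ℝ} (hx0 : 0 ≤ x) (hx : mdl.α * x ≤ 1) : mdl.hgeom x ≤ mdl.d := by
  rw [← hgeom_zero]
  exact mdl.hgeom_anti hx0 hx

lemma h_nonneg {x : ℝ} (hx0 : 0 ≤ x) (hx : mdl.α * x ≤ 1) : 0 ≤ mdl.h x := by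
  rw [h_eq]
  have := mdl.one_le_hgeom hx
  have := mdl.α_pos
  positivity

lemma h_le_one {x : ℝ} (hx : mdl.α * x ≤ 1) : mdl.h x ≤ 1 := by
  have : 0 ≤ (1 - mdl.α * x) ^ mdl.d := pow_nonneg (by linarith) _
  rw [h]; linarith

lemma h_mono {x y : ℝ} (hxy : x ≤ y) (hy : mdl.α * y ≤ 1) : mdl.h x ≤ mdl.h y := by
  have h1 := mul_le_mul_of_nonneg_left hxy mdl.α_pos.le
  have := pow_le_pow_left₀ (show 0 ≤ 1 - mdl.α * y by linarith)
    (show 1 - mdl.α * y ≤ 1 - mdl.α * x by linarith) mdl.d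
  rw [h, h]; linarith

/-- The relative growth rate of `x_i` under the limiting dynamics, if the probability that fewer
than `m` better vertices are sampled is `q`. -/
noncomputable def rate (q x : ℝ) : ℝ := mdl.α * q * mdl.hgeom x - (1 - mdl.a)

lemma f_eq (i : ℕ) (x : ℕ → ℝ) : mdl.f i x = x i * mdl.rate (mdl.Q i x) (x i) := by
  rw [f, h_eq, rate]; ring

lemma continuous_rate (q : ℝ) : Continuous (mdl.rate q) := by
  unfold rate
  have := mdl.continuous_hgeom
  fun_prop

lemma rate_anti {q x y : ℝ} (hq : 0 ≤ q) (hxy : x ≤ y) (hy : mdl.α * y ≤ 1) :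
    mdl.rate q y ≤ mdl.rate q x := by
  have := mul_le_mul_of_nonneg_left (mdl.hgeom_anti hxy hy) (mul_nonneg mdl.α_pos.le hq)
  rw [rate, rate]; linarith

lemma rate_strictAnti {q x y : ℝ} (hd : 2 ≤ mdl.d) (hq : 0 < q) (hxy : x < y)
    (hy : mdl.α * y ≤ 1) : mdl.rate q y < mdl.rate q x := by
  have := mul_lt_mul_of_pos_left (mdl.hgeom_strictAnti hd hxy hy) (mul_pos mdl.α_pos hq)
  rw [rate, rate]; linarith

/-- Probability that a vertex of in-degree `D` is sampled in one of the `d` samples at time `n`. -/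
noncomputable def hitProb (n D : ℕ) : ℝ := 1 - (1 - min 1 ((mdl.α * D + mdl.β) / n)) ^ mdl.d

lemma sampleProb_mem (n D : ℕ) : 0 ≤ min 1 ((mdl.α * D + mdl.β) / n) ∧
    min 1 ((mdl.α * D + mdl.β) / n) ≤ 1 := by
  have := mdl.α_pos
  have := mdl.β_pos
  exact ⟨le_min zero_le_one (by positivity), min_le_left _ _⟩

lemma hitProb_mem (n D : ℕ) : 0 ≤ mdl.hitProb n D ∧ mdl.hitProb n D ≤ 1 := by
  have h := mdl.sampleProb_mem n D
  have h1 := pow_nonneg (sub_nonneg.2 h.2) mdl.d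
  have h2 := pow_le_one₀ (n := mdl.d) (sub_nonneg.2 h.2) (by linarith)
  constructor <;> rw [hitProb] <;> linarith

lemma hitProb_mono (n : ℕ) {D D' : ℕ} (hD : D ≤ D') : mdl.hitProb n D ≤ mdl.hitProb n D' := by
  have h := mdl.sampleProb_mem n D'
  have h1 : min 1 ((mdl.α * D + mdl.β) / n) ≤ min 1 ((mdl.α * D' + mdl.β) / n) := by
    refine min_le_min_left _ (div_le_div_of_nonneg_right ?_ (Nat.cast_nonneg n))
    have : (D : ℝ) ≤ D' := by exact_mod_cast hD
    have := mul_le_mul_of_nonneg_left this mdl.α_pos.le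
    linarith
  have := pow_le_pow_left₀ (sub_nonneg.2 h.2) (sub_le_sub_left h1 1) mdl.d
  rw [hitProb, hitProb]; linarith

lemma hitProb_le (n D : ℕ) : mdl.hitProb n D ≤ mdl.d * ((mdl.α * D + mdl.β) / n) := by
  have h := mdl.sampleProb_mem n D
  have h1 := one_add_mul_le_pow (a := -min 1 ((mdl.α * D + mdl.β) / n)) (by linarith) mdl.d
  have h2 : (mdl.d : ℝ) * min 1 ((mdl.α * D + mdl.β) / n) ≤ mdl.d * ((mdl.α * D + mdl.β) / n) :=
    mul_le_mul_of_nonneg_left (min_le_right _ _) (Nat.cast_nonneg _)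
  rw [hitProb, sub_eq_add_neg 1 (min _ _)]
  linarith

lemma hitProb_eq {n D : ℕ} (hn : 1 ≤ n) (hD : mdl.α * D + mdl.β ≤ n) :
    mdl.hitProb n D = mdl.h ((D : ℝ) / n + mdl.β / (mdl.α * n)) := by
  have hn' : (0 : ℝ) < n := by exact_mod_cast hn
  have := mdl.α_pos
  rw [hitProb, h, min_eq_right ((div_le_one hn').2 hD)]
  congr 3
  field_simp

lemma h_le_hitProb {n D : ℕ} (hn : 1 ≤ n) (hD : mdl.α * D + mdl.β ≤ n) :
    mdl.h ((D : ℝ) / n) ≤ mdl.hitProb n D := by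
  have hn' : (0 : ℝ) < n := by exact_mod_cast hn
  have := mdl.α_pos
  have := mdl.β_pos
  rw [mdl.hitProb_eq hn hD]
  refine mdl.h_mono (by simp; positivity) ?_
  rw [mul_add, mul_div_assoc', mul_div_assoc', mul_div_mul_left _ _ mdl.α_pos.ne', ← add_div]
  exact (div_le_one hn').2 hD

lemma hitProb_le_h {n D : ℕ} (hn : 1 ≤ n) (hD : mdl.α * D + mdl.β ≤ n) :
    mdl.hitProb n D ≤ mdl.h ((D : ℝ) / n) + mdl.d * mdl.β / n := by
  have hn' : (0 : ℝ) < n := by exact_mod_cast hn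
  have h0 := mdl.α_pos
  have h1 := mdl.β_pos
  have h2 : mdl.α * ((D : ℝ) / n + mdl.β / (mdl.α * n)) ≤ 1 := by
    rw [mul_add, mul_div_assoc', mul_div_assoc', mul_div_mul_left _ _ mdl.α_pos.ne', ← add_div]
    exact (div_le_one hn').2 hD
  have h3 : (D : ℝ) / n ≤ (D : ℝ) / n + mdl.β / (mdl.α * n) := by simp; positivity
  have h4 := mdl.hgeom_anti h3 h2
  have h5 := mdl.hgeom_le (x := (D : ℝ) / n + mdl.β / (mdl.α * n)) (by positivity) h2
  rw [mdl.hitProb_eq hn hD, h_eq, h_eq]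
  have h6 : mdl.α * ((D : ℝ) / n + mdl.β / (mdl.α * n)) = mdl.α * (D / n) + mdl.β / n := by
    field_simp
  rw [h6, add_mul]
  have h7 : mdl.α * ((D : ℝ) / n) * mdl.hgeom ((D : ℝ) / n + mdl.β / (mdl.α * n)) ≤
      mdl.α * ((D : ℝ) / n) * mdl.hgeom ((D : ℝ) / n) :=
    mul_le_mul_of_nonneg_left h4 (by positivity)
  have h8 : mdl.β / n * mdl.hgeom ((D : ℝ) / n + mdl.β / (mdl.α * n)) ≤ mdl.β / n * mdl.d :=
    mul_le_mul_of_nonneg_left h5 (by positivity)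
  have h9 : mdl.d * mdl.β / n = mdl.β / n * mdl.d := by ring
  linarith

end HFun

end Model

/-! ### Measurability of maps into countable types -/

section DMeas

variable {Ω β γ : Type*} {F : MeasurableSpace Ω}

/-- Measurability of a map into a countable type that carries the discrete `σ`-algebra. -/
def DMeas (F : MeasurableSpace Ω) (Z : Ω → β) : Prop := ∀ z, MeasurableSet[F] {ω | Z ω = z}

lemma DMeas.measurableSet_bind [Countable β] {Z : Ω → β} (hZ : DMeas F Z) {p : β → Ω → Prop}
    (hp : ∀ z, MeasurableSet[F] {ω | p z ω}) : MeasurableSet[F] {ω | p (Z ω) ω} := by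
  have : {ω | p (Z ω) ω} = ⋃ z, ({ω | Z ω = z} ∩ {ω | p z ω}) := by
    ext ω; simp
  rw [this]
  exact MeasurableSet.iUnion fun z => (hZ z).inter (hp z)

lemma DMeas.measurableSet [Countable β] {Z : Ω → β} (hZ : DMeas F Z) (p : β → Prop) :
    MeasurableSet[F] {ω | p (Z ω)} :=
  hZ.measurableSet_bind (p := fun z _ => p z) fun z => MeasurableSet.const (p z)

lemma DMeas.bind [Countable β] {Z : Ω → β} (hZ : DMeas F Z) {g : β → Ω → γ}
    (hg : ∀ z, DMeas F (g z)) : DMeas F fun ω => g (Z ω) ω :=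
  fun y => hZ.measurableSet_bind (p := fun z ω => g z ω = y) fun z => hg z y

lemma DMeas.const (c : β) : DMeas F fun _ : Ω => c := fun z => MeasurableSet.const (c = z)

lemma DMeas.comp [Countable β] {Z : Ω → β} (hZ : DMeas F Z) (g : β → γ) :
    DMeas F fun ω => g (Z ω) := hZ.bind fun z => DMeas.const (g z)

lemma DMeas.measurable [Countable β] [MeasurableSpace γ] {Z : Ω → β} (hZ : DMeas F Z) (g : β → γ) :
    Measurable[F] fun ω => g (Z ω) :=
  fun s _ => hZ.measurableSet fun z => g z ∈ s

lemma dmeas_finset {Z : Ω → Finset ℕ} (h : ∀ v, MeasurableSet[F] {ω | v ∈ Z ω}) : DMeas F Z := by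
  intro S
  have : {ω | Z ω = S} = ⋂ v, {ω | v ∈ Z ω ↔ v ∈ S} := by
    ext ω; simp [Finset.ext_iff]
  rw [this]
  refine MeasurableSet.iInter fun v => ?_
  by_cases hv : v ∈ S
  · simpa [hv] using h v
  · simpa [hv, Set.compl_def] using (h v).compl

lemma DMeas.prod {Z : Ω → β} {Y : Ω → γ} (hZ : DMeas F Z) (hY : DMeas F Y) :
    DMeas F fun ω => (Z ω, Y ω) := by
  rintro ⟨z, y⟩
  have : {ω | (Z ω, Y ω) = (z, y)} = {ω | Z ω = z} ∩ {ω | Y ω = y} := by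
    ext; simp
  rw [this]
  exact (hZ z).inter (hY y)

open Classical in
lemma dmeas_filter (S : Finset ℕ) {p : ℕ → Ω → Prop} (hp : ∀ v, MeasurableSet[F] {ω | p v ω}) :
    DMeas F fun ω => S.filter fun v => p v ω := by
  refine dmeas_finset fun v => ?_
  by_cases hv : v ∈ S
  · simpa [hv] using hp v
  · simp [hv]

lemma DMeas.top {δ : Type*} [LinearOrder δ] {κ : Ω → ℕ → δ}
    (hκ : ∀ v w, MeasurableSet[F] {ω | κ ω v < κ ω w}) {r : Ω → ℕ} (hr : DMeas F r)
    {S : Ω → Finset ℕ} (hS : DMeas F S) : DMeas F fun ω => top (κ ω) (r ω) (S ω) := by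
  refine hS.bind (g := fun S ω => SpatialPA.top (κ ω) (r ω) S) fun S => ?_
  refine hr.bind (g := fun r ω => SpatialPA.top (κ ω) r S) fun r => ?_
  refine dmeas_finset fun v => ?_
  have := (dmeas_filter S (p := fun w ω => κ ω v < κ ω w) (hκ v)).measurableSet
    (fun R => R.card < r)
  simp only [mem_top]
  by_cases hv : v ∈ S
  · convert this using 3
    simp only [hv, true_and]
    congr!
  · simp [hv]

end DMeas

/-! ### Measurability of the graph -/

section GraphMeasurable

variable {Ω : Type*} {F : MeasurableSpace Ω} (mdl : Model) (ξ : Ω → Noise)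

namespace Model

/-- The variables that determine the graph at time `n` and the tie-breaking order in the next
step. -/
def past (n : ℕ) : Set Source := {s | match s with
  | .X v => v < mdl.n₀ + n
  | .m j => j < n
  | .u j => j < n
  | .U j _ _ => j < n
  | .T j _ _ => j < n
  | .W j _ => j ≤ n}

lemma past_mono : Monotone mdl.past := by
  intro n k h s hs
  cases s <;> simp only [past, Set.mem_ofPred_eq] at hs ⊢ <;> omega

lemma dmeas_of_coord {f : Ω → ℕ} (hf : Measurable[F] fun ω => (f ω : ℝ)) : DMeas F f := by
  intro r
  have : {ω | f ω = r} = (fun ω => (f ω : ℝ)) ⁻¹' {(r : ℝ)} := by ext; simp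
  rw [this]
  exact hf (measurableSet_singleton _)

lemma measurableSet_degKey_lt (E : Multiset (ℕ × ℕ)) {n : ℕ}
    (hW : ∀ v, Measurable[F] fun ω => (ξ ω).W n v) (v w : ℕ) :
    MeasurableSet[F] {ω | degKey (ξ ω) E n v < degKey (ξ ω) E n w} := by
  simp only [degKey, Prod.Lex.toLex_lt_toLex]
  have h1 := measurableSet_lt (hW v) (hW w)
  have h2 := measurableSet_eq_fun (hW v) (hW w)
  exact (MeasurableSet.const _).union ((MeasurableSet.const _).inter
    (h1.union (h2.inter (MeasurableSet.const _))))

lemma measurable_torusDist {n v : ℕ} (h : Measurable[F] fun ω => (ξ ω).X (mdl.n₀ + n))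
    (hv : Measurable[F] fun ω => (ξ ω).X v) : Measurable[F] fun ω =>
      (n : ℝ) * ‖(((ξ ω).X (mdl.n₀ + n) - (ξ ω).X v : ℝ) : UnitAddCircle)‖ := by
  have hc : Continuous fun x : ℝ => ‖(x : UnitAddCircle)‖ :=
    continuous_norm.comp (AddCircle.continuous_mk' 1)
  exact (hc.measurable.comp (h.sub hv)).const_mul _

lemma dmeas_vertexTargets (E : Multiset (ℕ × ℕ)) {n : ℕ}
    (hX : ∀ v ≤ mdl.n₀ + n, Measurable[F] fun ω => (ξ ω).X v) :
    DMeas F fun ω => mdl.vertexTargets (ξ ω) E n := by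
  refine dmeas_finset fun v => ?_
  simp only [vertexTargets, Finset.mem_filter]
  by_cases hv : v ∈ mdl.verts n
  · have hv' : v < mdl.n₀ + n := by simpa [verts] using hv
    simpa [hv] using measurableSet_lt
      (mdl.measurable_torusDist ξ (hX _ le_rfl) (hX v hv'.le)) measurable_const
  · simp [hv]

lemma dmeas_edgeTargets (E : Multiset (ℕ × ℕ)) {n : ℕ}
    (hm : DMeas F fun ω => (ξ ω).m n) (hu : DMeas F fun ω => (ξ ω).u n)
    (hU : ∀ i v, Measurable[F] fun ω => (ξ ω).U n i v)
    (hT : ∀ i v, Measurable[F] fun ω => (ξ ω).T n i v)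
    (hW : ∀ v, Measurable[F] fun ω => (ξ ω).W n v) :
    DMeas F fun ω => mdl.edgeTargets (ξ ω) E n := by
  have hpool : DMeas F fun ω => mdl.pool (ξ ω) n :=
    hu.comp fun u => (mdl.verts (n + 1)).erase u
  have hsample : ∀ i, DMeas F fun ω => mdl.sample (ξ ω) E n i := by
    intro i
    have h1 := hpool.bind (g := fun S ω => S.filter fun v =>
      (n : ℝ) * (ξ ω).U n i v < mdl.α * inDeg E v + mdl.β) fun S => by
        convert dmeas_filter S (p := fun v ω => (n : ℝ) * (ξ ω).U n i v <
          mdl.α * inDeg E v + mdl.β) (fun v => measurableSet_lt ((hU i v).const_mul _)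
          measurable_const)
    exact h1
  have hfilled : ∀ i, DMeas F fun ω => mdl.filledSample (ξ ω) E n i := by
    intro i
    have htop : DMeas F fun ω => top (fun v => toLex ((ξ ω).T n i v, v))
        ((ξ ω).m n - (mdl.sample (ξ ω) E n i).card)
        (mdl.pool (ξ ω) n \ mdl.sample (ξ ω) E n i) := by
      refine DMeas.top (fun v w => ?_) ?_ ?_
      · simp only [Prod.Lex.toLex_lt_toLex]
        exact (measurableSet_lt (hT i v) (hT i w)).union
          ((measurableSet_eq_fun (hT i v) (hT i w)).inter (MeasurableSet.const _))
      · exact (hm.prod (hsample i)).comp fun p => p.1 - p.2.card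
      · exact (hpool.prod (hsample i)).comp fun p => p.1 \ p.2
    exact ((hsample i).prod htop).comp fun p => p.1 ∪ p.2
  have hsec : DMeas F fun ω => mdl.secondary (ξ ω) E n := by
    refine dmeas_finset fun v => ?_
    simp only [mem_secondary]
    have : {ω | ∃ i < mdl.d, v ∈ top (degKey (ξ ω) E n) ((ξ ω).m n)
        (mdl.filledSample (ξ ω) E n i)} = ⋃ i ∈ Finset.range mdl.d, {ω | v ∈
          top (degKey (ξ ω) E n) ((ξ ω).m n) (mdl.filledSample (ξ ω) E n i)} := by
      ext; simp
    rw [this]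
    exact Finset.measurableSet_biUnion _ fun i _ =>
      (DMeas.top (measurableSet_degKey_lt ξ E hW) hm (hfilled i)).measurableSet fun S => v ∈ S
  exact DMeas.top (measurableSet_degKey_lt ξ E hW) hm hsec

lemma dmeas_graph (n : ℕ) (h : ∀ s ∈ mdl.past n, Measurable[F] fun ω => (ξ ω).coord s) :
    DMeas F fun ω => mdl.graph (ξ ω) n := by
  induction n with
  | zero => exact DMeas.const _
  | succ n ih =>
    have ih' := ih fun s hs => h s (mdl.past_mono (Nat.le_succ n) hs)
    refine ih'.bind (g := fun E ω => E
      + (mdl.vertexTargets (ξ ω) E n).val.map (fun v => (mdl.n₀ + n, v))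
      + (mdl.edgeTargets (ξ ω) E n).val.map (fun v => ((ξ ω).u n, v))) fun E => ?_
    have hu : DMeas F fun ω => (ξ ω).u n := dmeas_of_coord (h (.u n) (Nat.lt_succ_self n))
    have h1 := mdl.dmeas_vertexTargets ξ E (n := n) fun v hv =>
      h (.X v) (show v < mdl.n₀ + (n + 1) by omega)
    have h2 := mdl.dmeas_edgeTargets ξ E (n := n)
      (dmeas_of_coord (h (.m n) (Nat.lt_succ_self n))) hu
      (fun i v => h (.U n i v) (Nat.lt_succ_self n)) (fun i v => h (.T n i v) (Nat.lt_succ_self n))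
      (fun v => h (.W n v) (Nat.le_succ n))
    exact ((h1.prod h2).prod hu).comp fun p => E + p.1.1.val.map (fun v => (mdl.n₀ + n, v))
      + p.1.2.val.map (fun v => (p.2, v))

end Model

end GraphMeasurable

/-! ### The filtration -/

section Independence

variable {Ω : Type*} (ξ : Ω → Noise)

/-- The `σ`-algebra generated by the variables in `A`. -/
@[reducible]
def srcAlg (A : Set Source) : MeasurableSpace Ω :=
  ⨆ s ∈ A, MeasurableSpace.comap (fun ω => (ξ ω).coord s) inferInstance

lemma measurable_coord_srcAlg {A : Set Source} {s : Source} (hs : s ∈ A) :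
    Measurable[srcAlg ξ A] fun ω => (ξ ω).coord s := by
  have h : MeasurableSpace.comap (fun ω => (ξ ω).coord s) inferInstance ≤ srcAlg ξ A :=
    le_iSup₂_of_le s hs le_rfl
  exact (comap_measurable _).mono h le_rfl

lemma srcAlg_mono {A B : Set Source} (h : A ⊆ B) : srcAlg ξ A ≤ srcAlg ξ B :=
  biSup_mono h

namespace Model

variable (mdl : Model)

/-- The information about the evolution up to time `n`, and the tie-breaking order in the next
step. -/
@[reducible]
def filt (n : ℕ) : MeasurableSpace Ω := srcAlg ξ (mdl.past n)

lemma filt_mono : Monotone (mdl.filt ξ) := fun _ _ h => srcAlg_mono ξ (mdl.past_mono h)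

lemma dmeas_graph_filt (n : ℕ) : DMeas (mdl.filt ξ n) fun ω => mdl.graph (ξ ω) n :=
  mdl.dmeas_graph ξ n fun _ hs => measurable_coord_srcAlg ξ hs

end Model

namespace IsNoise

variable {ξ} {mdl : Model} [mΩ : MeasurableSpace Ω] {P : Measure Ω} (hξ : IsNoise mdl P ξ)
include hξ

lemma srcAlg_le (A : Set Source) : srcAlg ξ A ≤ mΩ :=
  iSup₂_le fun s _ => (hξ.measurable s).comap_le

lemma filt_le (n : ℕ) : mdl.filt ξ n ≤ mΩ := hξ.srcAlg_le _

lemma indep_srcAlg {A B : Set Source} (h : Disjoint A B) : Indep (srcAlg ξ A) (srcAlg ξ B) P :=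
  indep_iSup_of_disjoint (fun s => (hξ.measurable s).comap_le) hξ.indep h

end IsNoise

end Independence

/-! ### Uniform variables -/

section Uniform

instance : IsProbabilityMeasure unif := ⟨by simp [unif]⟩

lemma unif_mul_lt {n : ℕ} (hn : 1 ≤ n) (c : ℝ) :
    unif {x : ℝ | (n : ℝ) * x < c} = ENNReal.ofReal (min 1 (c / n)) := by
  have hn' : (0 : ℝ) < n := by exact_mod_cast hn
  have h1 : {x : ℝ | (n : ℝ) * x < c} = Set.Iio (c / n) := by
    ext x; simp [lt_div_iff₀' hn']
  rw [h1, unif, Measure.restrict_apply measurableSet_Iio]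
  rcases le_or_gt (c / n) 1 with h | h
  · have h2 : Set.Iio (c / n) ∩ Set.Icc 0 1 = Set.Ico 0 (c / n) := by
      ext x; simp only [Set.mem_inter_iff, Set.mem_Iio, Set.mem_Icc, Set.mem_Ico]
      constructor
      · rintro ⟨h1, h2, -⟩; exact ⟨h2, h1⟩
      · rintro ⟨h1, h2⟩; exact ⟨h2, h1, by linarith⟩
    rw [h2, Real.volume_Ico, min_eq_right h, sub_zero]
  · have h2 : Set.Iio (c / n) ∩ Set.Icc 0 1 = Set.Icc 0 1 := by
      ext x; simp only [Set.mem_inter_iff, Set.mem_Iio, Set.mem_Icc]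
      constructor
      · rintro ⟨-, h⟩; exact h
      · rintro ⟨h1, h2⟩; exact ⟨by linarith, h1, h2⟩
    rw [h2, Real.volume_Icc, min_eq_left h.le, sub_zero]

/-- On a circle of length `1`, a ball of radius `r` has length `min 1 (2 r)`, which is why the
radius in the vertex step carries the factor `1 / 2`. -/
lemma unif_torus_lt {n : ℕ} (hn : 1 ≤ n) (c : ℝ) (x : ℝ) :
    unif {z : ℝ | (n : ℝ) * ‖((z - x : ℝ) : UnitAddCircle)‖ < c}
      = ENNReal.ofReal (min 1 (2 * c / n)) := by
  have hn' : (0 : ℝ) < n := by exact_mod_cast hn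
  have h1 : {z : ℝ | (n : ℝ) * ‖((z - x : ℝ) : UnitAddCircle)‖ < c} =
      (fun z : ℝ => (z : UnitAddCircle)) ⁻¹' Metric.ball (x : UnitAddCircle) (c / n) := by
    ext z
    simp [lt_div_iff₀' hn', dist_eq_norm]
  have h2 : unif = volume.restrict (Set.Ioc (0 : ℝ) (0 + 1)) := by
    rw [unif, zero_add]
    exact Measure.restrict_congr_set Ioc_ae_eq_Icc.symm
  rw [h1, h2, (AddCircle.measurePreserving_mk 1 0).measure_preimage
    measurableSet_ball.nullMeasurableSet, ← measure_congr AddCircle.closedBall_ae_eq_ball,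
    AddCircle.volume_closedBall, mul_div_assoc]

end Uniform

namespace Model

variable (mdl : Model)

/-- `v` is among the first `M + 1` of all vertices present, in the random order that is used to
complete the `i`-th sample. -/
def EarlyM (ξ : Noise) (n i v : ℕ) : Prop :=
  v ∈ mdl.verts (n + 1) ∧ ((mdl.verts (n + 1)).filter fun w => ξ.T n i v < ξ.T n i w).card ≤ mdl.M

/-- Sources of the variables used in the edge step from time `n` to time `n + 1`, apart from the
tie-breaking order. -/
def fresh (n : ℕ) : Set Source := {s | match s with
  | .X _ => False
  | .m j => j = n
  | .u j => j = n
  | .U j _ _ => j = n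
  | .T j _ _ => j = n
  | .W _ _ => False}

lemma disjoint_past_fresh (n : ℕ) : Disjoint (mdl.past n) (fresh n) := by
  rw [Set.disjoint_left]
  intro s hs hs'
  cases s <;> simp only [past, fresh, Set.mem_ofPred_eq] at hs hs' <;> omega

lemma past_X_disjoint (n : ℕ) : Disjoint (mdl.past n) {Source.X (mdl.n₀ + n)} := by
  rw [Set.disjoint_singleton_right]
  simp [past]

section Meas

variable {Ω : Type*} {F : MeasurableSpace Ω} (ξ : Ω → Noise)

lemma measurableSet_hit (E : Multiset (ℕ × ℕ)) {n v : ℕ}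
    (hU : ∀ i, Measurable[F] fun ω => (ξ ω).U n i v) :
    MeasurableSet[F] {ω | mdl.Hit (ξ ω) E n v} := by
  have : {ω | mdl.Hit (ξ ω) E n v} = ⋃ i ∈ Finset.range mdl.d,
      {ω | (n : ℝ) * (ξ ω).U n i v < mdl.α * inDeg E v + mdl.β} := by
    ext; simp [Hit]
  rw [this]
  exact Finset.measurableSet_biUnion _ fun i _ =>
    measurableSet_lt ((hU i).const_mul _) measurable_const

open Classical in
lemma measurableSet_earlyM {n i v : ℕ} (hT : ∀ w, Measurable[F] fun ω => (ξ ω).T n i w) :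
    MeasurableSet[F] {ω | mdl.EarlyM (ξ ω) n i v} := by
  have := (dmeas_filter (mdl.verts (n + 1)) (p := fun w ω => (ξ ω).T n i v < (ξ ω).T n i w)
    fun w => measurableSet_lt (hT v) (hT w)).measurableSet fun S => S.card ≤ mdl.M
  have h : MeasurableSet[F] {ω | ((mdl.verts (n + 1)).filter fun w =>
      (ξ ω).T n i v < (ξ ω).T n i w).card ≤ mdl.M} := by
    convert this
  exact (MeasurableSet.const _).inter h

end Meas

end Model

namespace IsNoise

open Model

variable {Ω : Type*} [mΩ : MeasurableSpace Ω] {P : Measure Ω}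
  {ξ : Ω → Noise} {mdl : Model} (hξ : IsNoise mdl P ξ)
include hξ

lemma measurable_U (n i v : ℕ) : Measurable fun ω => (ξ ω).U n i v := hξ.measurable (.U n i v)
lemma measurable_T (n i v : ℕ) : Measurable fun ω => (ξ ω).T n i v := hξ.measurable (.T n i v)
lemma dmeas_m (n : ℕ) : DMeas mΩ fun ω => (ξ ω).m n := dmeas_of_coord (hξ.measurable (.m n))
lemma dmeas_u (n : ℕ) : DMeas mΩ fun ω => (ξ ω).u n := dmeas_of_coord (hξ.measurable (.u n))

lemma ae_m_mem (n : ℕ) : ∀ᵐ ω ∂P, 1 ≤ (ξ ω).m n ∧ (ξ ω).m n ≤ mdl.M := by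
  have : ∀ᵐ ω ∂P, ∀ r, mdl.law r = 0 → (ξ ω).m n ≠ r := by
    rw [ae_all_iff]
    intro r
    by_cases h : mdl.law r = 0
    · have h1 := hξ.law_m n r
      rw [h] at h1
      filter_upwards [measure_eq_zero_iff_ae_notMem.1 h1] with ω hω _ using hω
    · exact Filter.Eventually.of_forall fun ω h' => absurd h' h
  filter_upwards [this] with ω hω
  exact mdl.law_supp _ fun h => hω _ h rfl

variable [IsProbabilityMeasure P]

lemma prob_hit (E : Multiset (ℕ × ℕ)) {n : ℕ} (hn : 1 ≤ n) (v : ℕ) :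
    P.real {ω | mdl.Hit (ξ ω) E n v} = mdl.hitProb n (inDeg E v) := by
  set c := mdl.α * inDeg E v + mdl.β with hc
  classical
  have hms : MeasurableSet {x : ℝ | (n : ℝ) * x < c} :=
    measurableSet_lt (by fun_prop) measurable_const
  have h1 : {ω | mdl.Hit (ξ ω) E n v}ᶜ = ⋂ s ∈ (Finset.range mdl.d).image (fun i => Source.U n i v),
      (fun ω => (ξ ω).coord s) ⁻¹' {x : ℝ | (n : ℝ) * x < c}ᶜ := by
    ext ω; simp [Hit, Noise.coord, hc]
  have h2 := hξ.indep.measure_inter_preimage_eq_mul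
    ((Finset.range mdl.d).image (fun i => Source.U n i v))
    (sets := fun _ => {x : ℝ | (n : ℝ) * x < c}ᶜ) (fun _ _ => hms.compl)
  rw [← h1, Finset.prod_image (fun i _ j _ h => by simpa using h)] at h2
  have h3 : ∀ i, P ((fun ω => (ξ ω).coord (.U n i v)) ⁻¹' {x : ℝ | (n : ℝ) * x < c}ᶜ) =
      1 - ENNReal.ofReal (min 1 (c / n)) := by
    intro i
    rw [← Measure.map_apply (hξ.measurable (.U n i v)) hms.compl]
    have : P.map (fun ω => (ξ ω).coord (.U n i v)) = unif := hξ.law_U n i v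
    rw [this, prob_compl_eq_one_sub hms, unif_mul_lt hn c]
  simp only [h3, Finset.prod_const, Finset.card_range] at h2
  have hmH : MeasurableSet {ω | mdl.Hit (ξ ω) E n v} :=
    mdl.measurableSet_hit ξ E fun i => hξ.measurable_U n i v
  have h4 := prob_compl_eq_one_sub (μ := P) hmH.compl
  rw [compl_compl] at h4
  have hp := mdl.sampleProb_mem n (inDeg E v)
  rw [measureReal_def, h4, h2, ENNReal.toReal_sub_of_le _ ENNReal.one_ne_top, ENNReal.toReal_pow,
    ENNReal.toReal_sub_of_le _ ENNReal.one_ne_top, ENNReal.toReal_ofReal hp.1]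
  · simp [hitProb]
  · exact ENNReal.ofReal_le_one.2 hp.2
  · exact pow_le_one₀ zero_le tsub_le_self

open Classical in
/-- The set of sampled vertices among `V` consists of independent choices. -/
lemma integral_filter_hit (E : Multiset (ℕ × ℕ)) {n : ℕ} (hn : 1 ≤ n) (V : Finset ℕ)
    (φ : Finset ℕ → ℝ) : ∫ ω, φ (V.filter fun v => mdl.Hit (ξ ω) E n v) ∂P =
      bernE V (fun v => mdl.hitProb n (inDeg E v)) φ := by
  have hbound : ∀ (V : Finset ℕ) (φ : Finset ℕ → ℝ) (S : Finset ℕ), S ⊆ V →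
      ‖φ S‖ ≤ ∑ R ∈ V.powerset, ‖φ R‖ := fun V φ S hS =>
    Finset.single_le_sum (f := fun R => ‖φ R‖) (fun _ _ => norm_nonneg _)
      (Finset.mem_powerset.2 hS)
  have hmeas : ∀ (V : Finset ℕ) (φ : Finset ℕ → ℝ), Measurable fun ω =>
      φ (V.filter fun v => mdl.Hit (ξ ω) E n v) := fun V φ =>
    (dmeas_filter V fun v => mdl.measurableSet_hit ξ E fun i => hξ.measurable_U n i v).measurable φ
  have hint : ∀ (V : Finset ℕ) (φ : Finset ℕ → ℝ), Integrable (fun ω =>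
      φ (V.filter fun v => mdl.Hit (ξ ω) E n v)) P := fun V φ =>
    Integrable.of_bound (hmeas V φ).aestronglyMeasurable _
      (Filter.Eventually.of_forall fun ω => hbound V φ _ (Finset.filter_subset _ _))
  induction V using Finset.induction_on generalizing φ with
  | empty => simp [bernE_empty]
  | insert a s ha ih =>
    set H : Set Ω := {ω | mdl.Hit (ξ ω) E n a} with hH
    have hHm : MeasurableSet H := mdl.measurableSet_hit ξ E fun i => hξ.measurable_U n i a
    set Z : Ω → Finset ℕ := fun ω => s.filter fun v => mdl.Hit (ξ ω) E n v with hZ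
    have hsplit : ∀ ω, φ ((insert a s).filter fun v => mdl.Hit (ξ ω) E n v) =
        H.indicator 1 ω * (φ (insert a (Z ω)) - φ (Z ω)) + φ (Z ω) := by
      intro ω
      rw [Finset.filter_insert]
      by_cases h : mdl.Hit (ξ ω) E n a
      · rw [if_pos h, Set.indicator_of_mem (by exact h)]
        simp [hZ]
      · rw [if_neg h, Set.indicator_of_notMem (by exact h)]
        simp [hZ]
    have hdisj : Disjoint {t : Source | ∃ i, t = .U n i a}
        {t : Source | ∃ i, ∃ v ∈ s, t = .U n i v} := by
      rw [Set.disjoint_left]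
      rintro t ⟨i, rfl⟩ ⟨j, v, hv, h⟩
      simp only [Source.U.injEq] at h
      exact ha (h.2.2 ▸ hv)
    have hind : IndepFun (H.indicator (1 : Ω → ℝ)) (fun ω => φ (insert a (Z ω)) - φ (Z ω)) P := by
      have h0 := hξ.indep_srcAlg hdisj
      rw [IndepFun_iff_Indep]
      refine indep_of_indep_of_le_left (indep_of_indep_of_le_right h0 ?_) ?_
      · refine Measurable.comap_le ?_
        have : DMeas (srcAlg ξ {t : Source | ∃ i, ∃ v ∈ s, t = .U n i v}) Z := by
          refine dmeas_finset fun v => ?_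
          by_cases hv : v ∈ s
          · simpa [hZ, hv] using mdl.measurableSet_hit
              (F := srcAlg ξ {t : Source | ∃ i, ∃ v ∈ s, t = .U n i v}) ξ E (n := n) (v := v)
              fun i => measurable_coord_srcAlg ξ (s := .U n i v) ⟨i, v, hv, rfl⟩
          · simp [hZ, hv]
        exact this.measurable fun S => φ (insert a S) - φ S
      · refine Measurable.comap_le ?_
        have : MeasurableSet[srcAlg ξ {t : Source | ∃ i, t = .U n i a}] H :=
          mdl.measurableSet_hit ξ E fun i => measurable_coord_srcAlg ξ (s := .U n i a) ⟨i, rfl⟩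
        exact (@measurable_one ℝ Ω _ (srcAlg ξ {t : Source | ∃ i, t = .U n i a}) _).indicator this
    have h1 := hind.integral_fun_mul_eq_mul_integral
      (measurable_one.indicator hHm).aestronglyMeasurable
      ((hmeas s fun S => φ (insert a S) - φ S)).aestronglyMeasurable
    have h2 : Integrable (fun ω => H.indicator 1 ω * (φ (insert a (Z ω)) - φ (Z ω))) P := by
      have := (hint s fun S => φ (insert a S) - φ S).indicator hHm
      refine this.congr (Filter.Eventually.of_forall fun ω => ?_)
      by_cases h : ω ∈ H <;> simp [h, hZ]
    have hH1 : ∫ ω, H.indicator (1 : Ω → ℝ) ω ∂P = mdl.hitProb n (inDeg E a) := by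
      rw [integral_indicator_one hHm, hH, hξ.prob_hit E hn]
    rw [integral_congr_ae (Filter.Eventually.of_forall hsplit), integral_add h2 (hint s φ), h1, hH1,
      integral_sub (hint s fun S => φ (insert a S)) (hint s φ), ih fun S => φ (insert a S), ih φ,
      bernE_insert ha]
    ring

open Classical in
/-- The number `m n` is independent of the set of sampled vertices. -/
lemma integral_m_filter_hit (E : Multiset (ℕ × ℕ)) {n : ℕ} (hn : 1 ≤ n) (V : Finset ℕ)
    (φ : ℕ → Finset ℕ → ℝ) : ∫ ω, φ ((ξ ω).m n) (V.filter fun v => mdl.Hit (ξ ω) E n v) ∂P =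
      ∑ r ∈ Finset.Icc 1 mdl.M, (mdl.law r).toReal *
        bernE V (fun v => mdl.hitProb n (inDeg E v)) (φ r) := by
  have hZm : DMeas mΩ fun ω => V.filter fun v => mdl.Hit (ξ ω) E n v :=
    dmeas_filter V fun v => mdl.measurableSet_hit ξ E fun i => hξ.measurable_U n i v
  set Z : Ω → Finset ℕ := fun ω => V.filter fun v => mdl.Hit (ξ ω) E n v with hZ
  have hint : ∀ (φ : Finset ℕ → ℝ), Integrable (fun ω => φ (Z ω)) P := fun φ =>
    Integrable.of_bound (hZm.measurable φ).aestronglyMeasurable (∑ R ∈ V.powerset, ‖φ R‖)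
      (Filter.Eventually.of_forall fun ω => Finset.single_le_sum (f := fun R => ‖φ R‖)
        (fun _ _ => norm_nonneg _) (Finset.mem_powerset.2 (Finset.filter_subset _ _)))
  have h1 : ∀ᵐ ω ∂P, φ ((ξ ω).m n) (Z ω) = ∑ r ∈ Finset.Icc 1 mdl.M,
      {ω | (ξ ω).m n = r}.indicator 1 ω * φ r (Z ω) := by
    filter_upwards [hξ.ae_m_mem n] with ω hω
    rw [Finset.sum_eq_single ((ξ ω).m n)]
    · simp
    · intro r _ hr
      rw [Set.indicator_of_notMem (by simpa using hr.symm), zero_mul]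
    · intro h
      exact absurd (Finset.mem_Icc.2 hω) h
  have hi : ∀ r, Integrable (fun ω => {ω | (ξ ω).m n = r}.indicator 1 ω * φ r (Z ω)) P := by
    intro r
    refine ((hint (φ r)).indicator (hξ.dmeas_m n r)).congr (Filter.Eventually.of_forall fun ω => ?_)
    by_cases h : (ξ ω).m n = r <;> simp [h]
  rw [integral_congr_ae h1, integral_finsetSum _ fun r _ => hi r]
  refine Finset.sum_congr rfl fun r _ => ?_
  have hind : IndepFun ({ω | (ξ ω).m n = r}.indicator (1 : Ω → ℝ)) (fun ω => φ r (Z ω)) P := by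
    have hdisj : Disjoint {Source.m n} {t : Source | ∃ i v, t = .U n i v} := by
      rw [Set.disjoint_singleton_left]
      simp
    rw [IndepFun_iff_Indep]
    refine indep_of_indep_of_le_left (indep_of_indep_of_le_right (hξ.indep_srcAlg hdisj) ?_) ?_
    · refine Measurable.comap_le ?_
      have : DMeas (srcAlg ξ {t : Source | ∃ i v, t = .U n i v}) Z :=
        dmeas_filter V fun v => mdl.measurableSet_hit
            (F := srcAlg ξ {t : Source | ∃ i v, t = .U n i v}) ξ E (n := n) (v := v)
            fun i => measurable_coord_srcAlg ξ (s := .U n i v) ⟨i, v, rfl⟩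
      exact this.measurable (φ r)
    · refine Measurable.comap_le ?_
      have : MeasurableSet[srcAlg ξ {Source.m n}] {ω | (ξ ω).m n = r} :=
        dmeas_of_coord (F := srcAlg ξ {Source.m n})
          (measurable_coord_srcAlg ξ (s := .m n) rfl) r
      exact (@measurable_one ℝ Ω _ (srcAlg ξ {Source.m n}) _).indicator this
  rw [hind.integral_fun_mul_eq_mul_integral
    (measurable_one.indicator (hξ.dmeas_m n r)).aestronglyMeasurable
    (hint (φ r)).aestronglyMeasurable, integral_indicator_one (hξ.dmeas_m n r), measureReal_def,
    hξ.law_m, hξ.integral_filter_hit E hn]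

end IsNoise

/-! ### Probabilities of a single step -/

instance : NullSingletonClass unif := by unfold unif; infer_instance

/-- Exchangeability: swapping two coordinates shows that all of them have the same chance to be
among the `M + 1` largest. -/
lemma pi_unif_rank_eq {N : ℕ} (M : ℕ) (v w : Fin N) :
    Measure.pi (fun _ : Fin N => unif) {x | (Finset.univ.filter fun j => x v < x j).card ≤ M} =
    Measure.pi (fun _ : Fin N => unif) {x | (Finset.univ.filter fun j => x w < x j).card ≤ M} := by
  have hmp := measurePreserving_piCongrLeft (fun _ : Fin N => unif) (Equiv.swap v w)
  have hpre : MeasurableEquiv.piCongrLeft (fun _ : Fin N => ℝ) (Equiv.swap v w) ⁻¹'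
      {x | (Finset.univ.filter fun j => x w < x j).card ≤ M} =
      {x | (Finset.univ.filter fun j => x v < x j).card ≤ M} := by
    ext x
    have h : ∀ j, MeasurableEquiv.piCongrLeft (fun _ : Fin N => ℝ) (Equiv.swap v w) x
        (Equiv.swap v w j) = x j := fun j => by
      exact Equiv.piCongrLeft_apply_apply (fun _ : Fin N => ℝ) (Equiv.swap v w) x j
    have hw := h v
    rw [Equiv.swap_apply_left] at hw
    simp only [Set.mem_preimage, Set.mem_ofPred_eq, hw]
    have : (Finset.univ.filter fun j => x v < x j).card = (Finset.univ.filter fun j => x v <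
        MeasurableEquiv.piCongrLeft (fun _ : Fin N => ℝ) (Equiv.swap v w) x j).card := by
      refine Finset.card_bij (fun j _ => Equiv.swap v w j) ?_ ?_ ?_
      · intro j hj
        simpa [h] using hj
      · intro i _ j _ hij
        simpa using hij
      · intro j hj
        refine ⟨Equiv.swap v w j, ?_, by simp⟩
        have := h (Equiv.swap v w j)
        rw [Equiv.swap_apply_self] at this
        simpa [← this] using hj
    rw [this]
  have hmeq := hmp.measure_preimage_equiv {x | (Finset.univ.filter fun j => x w < x j).card ≤ M}
  rw [hpre] at hmeq
  exact hmeq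

namespace IsNoise

open Model

variable {Ω : Type*} [mΩ : MeasurableSpace Ω] {P : Measure Ω} [IsProbabilityMeasure P]
  {ξ : Ω → Noise} {mdl : Model} (hξ : IsNoise mdl P ξ)
include hξ

lemma ae_T_ne (n i : ℕ) {v w : ℕ} (hvw : v ≠ w) : ∀ᵐ ω ∂P, (ξ ω).T n i v ≠ (ξ ω).T n i w := by
  have hind : IndepFun (fun ω => (ξ ω).T n i v) (fun ω => (ξ ω).T n i w) P :=
    hξ.indep.indepFun (i := .T n i v) (j := .T n i w) (by simpa using hvw)
  have h1 := (indepFun_iff_map_prod_eq_prod_map_map (hξ.measurable_T n i v).aemeasurable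
    (hξ.measurable_T n i w).aemeasurable).1 hind
  rw [hξ.law_T, hξ.law_T] at h1
  have hD : MeasurableSet {p : ℝ × ℝ | p.1 = p.2} :=
    measurableSet_eq_fun measurable_fst measurable_snd
  have h2 : (unif.prod unif) {p : ℝ × ℝ | p.1 = p.2} = 0 := by
    rw [Measure.measure_prod_null hD]
    refine Filter.Eventually.of_forall fun x => ?_
    have : Prod.mk x ⁻¹' {p : ℝ × ℝ | p.1 = p.2} = {x} := by
      ext y; simp [eq_comm]
    simp only [this, measure_singleton, Pi.zero_apply]
  rw [← h1, Measure.map_apply ((hξ.measurable_T n i v).prodMk (hξ.measurable_T n i w)) hD] at h2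
  filter_upwards [measure_eq_zero_iff_ae_notMem.1 h2] with ω hω
  simpa using hω

omit [IsProbabilityMeasure P] in
lemma measurableSet_earlyM' (n i v : ℕ) : MeasurableSet {ω | mdl.EarlyM (ξ ω) n i v} :=
  mdl.measurableSet_earlyM ξ fun w => hξ.measurable_T n i w

lemma prob_earlyM_eq (n i : ℕ) {v w : ℕ} (hv : v ∈ mdl.verts (n + 1)) (hw : w ∈ mdl.verts (n + 1)) :
    P.real {ω | mdl.EarlyM (ξ ω) n i v} = P.real {ω | mdl.EarlyM (ξ ω) n i w} := by
  set N := mdl.n₀ + (n + 1) with hN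
  have hinj : Function.Injective fun j : Fin N => Source.T n i j := by
    intro a b h
    simp only [Source.T.injEq, true_and] at h
    exact Fin.ext h
  have h1 := (iIndepFun_iff_map_fun_eq_pi_map
    (fun j : Fin N => (hξ.measurable_T n i j).aemeasurable)).1 (hξ.indep.precomp hinj)
  have hlaw : (fun j : Fin N => P.map fun ω => (ξ ω).T n i j) = fun _ => unif :=
    funext fun j => hξ.law_T n i j
  rw [hlaw] at h1
  have key : ∀ v (hv : v ∈ mdl.verts (n + 1)), P {ω | mdl.EarlyM (ξ ω) n i v} =
      Measure.pi (fun _ : Fin N => unif) {x | (Finset.univ.filter fun j =>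
        x ⟨v, (mdl.mem_verts).1 hv⟩ < x j).card ≤ mdl.M} := by
    intro v hv
    have hTm : Measurable fun ω (j : Fin N) => (ξ ω).T n i j :=
      measurable_pi_lambda _ fun j => hξ.measurable_T n i j
    rw [← h1, Measure.map_apply hTm]
    · congr 1
      ext ω
      simp only [EarlyM, Set.mem_ofPred_eq, hv, true_and, Set.mem_preimage]
      have : ((mdl.verts (n + 1)).filter fun w => (ξ ω).T n i v < (ξ ω).T n i w).card =
          (Finset.univ.filter fun j : Fin N => (ξ ω).T n i v < (ξ ω).T n i j).card := by
        symm
        refine Finset.card_bij (fun j _ => (j : ℕ)) ?_ ?_ ?_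
        · intro j hj
          have := j.2
          simp only [Finset.mem_filter, Finset.mem_univ, true_and, verts, Finset.mem_range] at hj ⊢
          exact ⟨this, hj⟩
        · intro a _ b _ h
          exact Fin.ext h
        · intro j hj
          simp only [Finset.mem_filter, verts, Finset.mem_range] at hj
          exact ⟨⟨j, hj.1⟩, by simpa using hj.2, rfl⟩
      rw [this]
    · classical
      have : {x : Fin N → ℝ | (Finset.univ.filter fun j =>
          x ⟨v, (mdl.mem_verts).1 hv⟩ < x j).card ≤ mdl.M} =
          {x : Fin N → ℝ | ∑ j, ({x : Fin N → ℝ | x ⟨v, (mdl.mem_verts).1 hv⟩ < x j}.indicator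
            (fun _ => (1 : ℝ)) x) ≤ mdl.M} := by
        ext x
        simp only [Set.mem_ofPred_eq, Set.indicator_apply, Finset.sum_boole]
        norm_cast
      rw [this]
      refine measurableSet_le (Finset.measurable_sum _ fun j _ => ?_) measurable_const
      exact measurable_const.indicator
        (measurableSet_lt (measurable_pi_apply _) (measurable_pi_apply _))
  rw [measureReal_def, measureReal_def, key v hv, key w hw, pi_unif_rank_eq]

open Classical in
/-- By exchangeability, a given vertex is used to complete a sample with probability `O(1 / n)`. -/
lemma prob_earlyM_le {n : ℕ} (hn : 1 ≤ n) (i v : ℕ) :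
    P.real {ω | mdl.EarlyM (ξ ω) n i v} ≤ (mdl.M + 1) / n := by
  have hn' : (0 : ℝ) < n := by exact_mod_cast hn
  by_cases hv : v ∈ mdl.verts (n + 1)
  swap
  · have : {ω | mdl.EarlyM (ξ ω) n i v} = ∅ := by
      ext ω; simp [EarlyM, hv]
    rw [this, measureReal_empty]
    positivity
  have hms : ∀ w, MeasurableSet {ω | mdl.EarlyM (ξ ω) n i w} := hξ.measurableSet_earlyM' n i
  have h1 : ∀ᵐ ω ∂P, ∑ w ∈ mdl.verts (n + 1),
      {ω | mdl.EarlyM (ξ ω) n i w}.indicator (1 : Ω → ℝ) ω ≤ mdl.M + 1 := by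
    have hne : ∀ᵐ ω ∂P, ∀ v w, v ≠ w → (ξ ω).T n i v ≠ (ξ ω).T n i w := by
      rw [ae_all_iff]; intro v
      rw [ae_all_iff]; intro w
      by_cases h : v = w
      · exact Filter.Eventually.of_forall fun _ h' => absurd h h'
      · filter_upwards [hξ.ae_T_ne n i h] with ω hω _ using hω
    filter_upwards [hne] with ω hω
    have hκ : Function.Injective fun v => toLex ((ξ ω).T n i v, v) := fun v w h => by
      simp only [EmbeddingLike.apply_eq_iff_eq, Prod.mk.injEq] at h
      exact h.2
    have h2 := card_top_le hκ (mdl.M + 1) (mdl.verts (n + 1))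
    have h3 : ∑ w ∈ mdl.verts (n + 1), {ω | mdl.EarlyM (ξ ω) n i w}.indicator (1 : Ω → ℝ) ω =
        ((mdl.verts (n + 1)).filter fun w => mdl.EarlyM (ξ ω) n i w).card := by
      simp [Set.indicator_apply, Finset.sum_boole]
    rw [h3]
    refine le_trans (Nat.cast_le.2 (Finset.card_le_card ?_))
      ((Nat.cast_le (α := ℝ)).2 h2 |>.trans (by push_cast; exact le_rfl))
    intro w hw
    rw [Finset.mem_filter] at hw
    refine mem_top.2 ⟨hw.1, Nat.lt_succ_of_le (le_trans
      (Finset.card_le_card fun x hx => ?_) hw.2.2)⟩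
    rw [Finset.mem_filter, Prod.Lex.toLex_lt_toLex] at hx
    rw [Finset.mem_filter]
    refine ⟨hx.1, ?_⟩
    rcases hx.2 with h | h
    · exact h
    · exact absurd h.1 (hω _ _ h.2.ne)
  have hint : ∀ w, Integrable ({ω | mdl.EarlyM (ξ ω) n i w}.indicator (1 : Ω → ℝ)) P := fun w =>
    (integrable_const (1 : ℝ)).indicator (hms w)
  have h4 : ∫ ω, ∑ w ∈ mdl.verts (n + 1),
      {ω | mdl.EarlyM (ξ ω) n i w}.indicator (1 : Ω → ℝ) ω ∂P ≤ ∫ _, ((mdl.M : ℝ) + 1) ∂P :=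
    integral_mono_ae (integrable_finsetSum _ fun w _ => hint w) (integrable_const _) h1
  rw [integral_finsetSum _ fun w _ => hint w] at h4
  have h5 : ∑ w ∈ mdl.verts (n + 1), ∫ ω, {ω | mdl.EarlyM (ξ ω) n i w}.indicator (1 : Ω → ℝ) ω ∂P =
      (mdl.n₀ + (n + 1) : ℕ) * P.real {ω | mdl.EarlyM (ξ ω) n i v} := by
    rw [Finset.sum_congr rfl fun w hw => by
      rw [integral_indicator_one (hms w), hξ.prob_earlyM_eq n i hw hv]]
    simp [verts]
  rw [h5] at h4
  simp only [integral_const, probReal_univ, one_smul] at h4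
  rw [le_div_iff₀ hn', mul_comm]
  refine le_trans (mul_le_mul_of_nonneg_right ?_ measureReal_nonneg) h4
  push_cast
  have : (0 : ℝ) ≤ mdl.n₀ := Nat.cast_nonneg _
  linarith

/-- The location of the new vertex is independent of the past. -/
lemma prob_torus_lt {n v : ℕ} (hn : 1 ≤ n) (hv : v < mdl.n₀ + n) (c : ℝ) {A : Set Ω}
    (hA : MeasurableSet[mdl.filt ξ n] A) :
    P (A ∩ {ω | (n : ℝ) * ‖(((ξ ω).X (mdl.n₀ + n) - (ξ ω).X v : ℝ) : UnitAddCircle)‖ < c}) =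
      P A * ENNReal.ofReal (min 1 (2 * c / n)) := by
  have hA' : MeasurableSet A := hξ.filt_le n A hA
  set Y : Ω → ℝ × ℝ := fun ω => (A.indicator 1 ω, (ξ ω).X v) with hY
  have hXv : Measurable fun ω => (ξ ω).X v := hξ.measurable (.X v)
  have hX : Measurable fun ω => (ξ ω).X (mdl.n₀ + n) := hξ.measurable (.X _)
  have hYm : Measurable Y := (measurable_one.indicator hA').prodMk hXv
  have hind : IndepFun Y (fun ω => (ξ ω).X (mdl.n₀ + n)) P := by
    rw [IndepFun_iff_Indep]
    refine indep_of_indep_of_le_left (indep_of_indep_of_le_right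
      (hξ.indep_srcAlg (mdl.past_X_disjoint n)) ?_) ?_
    · exact Measurable.comap_le (measurable_coord_srcAlg ξ (s := .X (mdl.n₀ + n)) rfl)
    · refine Measurable.comap_le ?_
      have h1 : Measurable[mdl.filt ξ n] (A.indicator (1 : Ω → ℝ)) :=
        (@measurable_one ℝ Ω _ (mdl.filt ξ n) _).indicator hA
      have h2 : Measurable[mdl.filt ξ n] fun ω => (ξ ω).X v :=
        measurable_coord_srcAlg ξ (s := .X v) hv
      exact h1.prodMk h2
  have h1 := (indepFun_iff_map_prod_eq_prod_map_map hYm.aemeasurable hX.aemeasurable).1 hind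
  rw [hξ.law_X _ (Nat.le_add_right _ _)] at h1
  set D : Set ((ℝ × ℝ) × ℝ) := {p | p.1.1 = 1 ∧
    (n : ℝ) * ‖((p.2 - p.1.2 : ℝ) : UnitAddCircle)‖ < c} with hD
  have hc : Continuous fun x : ℝ => ‖(x : UnitAddCircle)‖ :=
    continuous_norm.comp (AddCircle.continuous_mk' 1)
  have hDm : MeasurableSet D := by
    have h1 : Measurable fun p : (ℝ × ℝ) × ℝ =>
        (n : ℝ) * ‖((p.2 - p.1.2 : ℝ) : UnitAddCircle)‖ :=
      (hc.measurable.comp (measurable_snd.sub (measurable_snd.comp measurable_fst))).const_mul _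
    exact (measurableSet_eq_fun (measurable_fst.comp measurable_fst) measurable_const).inter
      (measurableSet_lt h1 measurable_const)
  have h2 : A ∩ {ω | (n : ℝ) * ‖(((ξ ω).X (mdl.n₀ + n) - (ξ ω).X v : ℝ) : UnitAddCircle)‖ < c} =
      (fun ω => (Y ω, (ξ ω).X (mdl.n₀ + n))) ⁻¹' D := by
    ext ω
    by_cases h : ω ∈ A <;> simp [hD, hY, h]
  rw [h2, ← Measure.map_apply (hYm.prodMk hX) hDm, h1, Measure.prod_apply hDm]
  have h3 : ∀ y : ℝ × ℝ, unif (Prod.mk y ⁻¹' D) =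
      {y : ℝ × ℝ | y.1 = 1}.indicator (fun _ => ENNReal.ofReal (min 1 (2 * c / n))) y := by
    intro y
    by_cases h : y.1 = 1
    · rw [Set.indicator_of_mem (by exact h), ← unif_torus_lt hn c y.2]
      congr 1
      ext z; simp [hD, h]
    · rw [Set.indicator_of_notMem (by exact h)]
      have : Prod.mk y ⁻¹' D = ∅ := by ext z; simp [hD, h]
      rw [this, measure_empty]
  have hS : MeasurableSet {y : ℝ × ℝ | y.1 = 1} :=
    measurableSet_eq_fun measurable_fst measurable_const
  simp only [h3]
  rw [lintegral_indicator_const hS, Measure.map_apply hYm hS, mul_comm]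
  congr 2
  ext ω
  by_cases h : ω ∈ A <;> simp [hY, h]

lemma prob_vertexTargets (E : Multiset (ℕ × ℕ)) {n v : ℕ} (hn : 1 ≤ n) (hv : v < mdl.n₀ + n)
    {A : Set Ω} (hA : MeasurableSet[mdl.filt ξ n] A) :
    P (A ∩ {ω | v ∈ mdl.vertexTargets (ξ ω) E n}) =
      P A * ENNReal.ofReal (min 1 ((mdl.a * inDeg E v + mdl.b) / n)) := by
  have h := hξ.prob_torus_lt hn hv (mdl.a / 2 * inDeg E v + mdl.b / 2) hA
  have h1 : {ω | v ∈ mdl.vertexTargets (ξ ω) E n} = {ω | (n : ℝ) *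
      ‖(((ξ ω).X (mdl.n₀ + n) - (ξ ω).X v : ℝ) : UnitAddCircle)‖
        < mdl.a / 2 * inDeg E v + mdl.b / 2} := by
    ext ω
    simp only [Set.mem_ofPred_eq, mem_vertexTargets, hv, true_and]
  rw [h1, h]
  congr 4
  ring

lemma prob_vertexTargets_le (E : Multiset (ℕ × ℕ)) {n : ℕ} (v : ℕ) (hn : 1 ≤ n)
    {A : Set Ω} (hA : MeasurableSet[mdl.filt ξ n] A) :
    P (A ∩ {ω | v ∈ mdl.vertexTargets (ξ ω) E n}) ≤
      P A * ENNReal.ofReal ((mdl.a * inDeg E v + mdl.b) / n) := by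
  by_cases hv : v < mdl.n₀ + n
  · rw [hξ.prob_vertexTargets E hn hv hA]
    gcongr
    exact min_le_right _ _
  · have : {ω | v ∈ mdl.vertexTargets (ξ ω) E n} = ∅ := by
      ext ω
      simp only [Set.mem_ofPred_eq, mem_vertexTargets, hv, false_and, Set.mem_empty_iff_false]
    simp [this]

omit [IsProbabilityMeasure P] in
/-- The variables of the edge step are independent of the past. -/
lemma lintegral_fresh {n : ℕ} {A : Set Ω} (hA : MeasurableSet[mdl.filt ξ n] A)
    {g : Ω → ENNReal} (hg : Measurable[srcAlg ξ (fresh n)] g) :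
    ∫⁻ ω in A, g ω ∂P = P A * ∫⁻ ω, g ω ∂P := by
  have hA' : MeasurableSet A := hξ.filt_le n A hA
  have h := lintegral_mul_eq_lintegral_mul_lintegral_of_independent_measurableSpace
    (hξ.filt_le n) (hξ.srcAlg_le (fresh n)) (hξ.indep_srcAlg (mdl.disjoint_past_fresh n))
    ((@measurable_one ENNReal Ω _ (mdl.filt ξ n) _).indicator hA) hg
  rw [lintegral_indicator_one hA'] at h
  rw [← h, ← lintegral_indicator hA']
  refine lintegral_congr fun ω => ?_
  by_cases hω : ω ∈ A <;> simp [hω]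

open Classical in
/-- Bound for the expected number of edges drawn in the edge step to vertices of `V`. -/
lemma lintegral_edgeTargets_le (E : Multiset (ℕ × ℕ)) {n : ℕ} (hn : 1 ≤ n) (V : Finset ℕ)
    {A : Set Ω} (hA : MeasurableSet[mdl.filt ξ n] A) :
    ∫⁻ ω in A, ENNReal.ofReal (V ∩ mdl.edgeTargets (ξ ω) E n).card ∂P ≤
      P A * ENNReal.ofReal (∑ r ∈ Finset.Icc 1 mdl.M, (mdl.law r).toReal *
        bernE V (fun v => mdl.hitProb n (inDeg E v)) (fun S => (min r S.card : ℕ))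
        + V.card * mdl.d * ((mdl.M + 1) / n)) := by
  set φ : ℕ → Finset ℕ → ℝ := fun r S => (min r S.card : ℕ) with hφ
  set g : Ω → ℝ := fun ω => φ ((ξ ω).m n) (V.filter fun v => mdl.Hit (ξ ω) E n v) +
    ∑ v ∈ V, ∑ i ∈ Finset.range mdl.d, {ω | mdl.EarlyM (ξ ω) n i v}.indicator (1 : Ω → ℝ) ω with hg
  have hφm : ∀ F : MeasurableSpace Ω, (DMeas F fun ω => (ξ ω).m n) →
      (∀ i v, Measurable[F] fun ω => (ξ ω).U n i v) →
      Measurable[F] fun ω => φ ((ξ ω).m n) (V.filter fun v => mdl.Hit (ξ ω) E n v) := by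
    intro F hm hU
    have := dmeas_filter V fun v => mdl.measurableSet_hit ξ E (hU · v)
    exact (hm.prod this).measurable fun p => φ p.1 p.2
  have hem : ∀ F : MeasurableSpace Ω, (∀ i v, Measurable[F] fun ω => (ξ ω).T n i v) →
      Measurable[F] fun ω => ∑ v ∈ V, ∑ i ∈ Finset.range mdl.d,
        {ω | mdl.EarlyM (ξ ω) n i v}.indicator (1 : Ω → ℝ) ω := by
    intro F hT
    refine Finset.measurable_sum _ fun v _ => Finset.measurable_sum _ fun i _ => ?_
    exact (@measurable_one ℝ Ω _ F _).indicator (mdl.measurableSet_earlyM ξ (hT i))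
  have hg0 : ∀ ω, 0 ≤ g ω := fun ω => add_nonneg (Nat.cast_nonneg _)
    (Finset.sum_nonneg fun v _ => Finset.sum_nonneg fun i _ =>
      Set.indicator_nonneg (fun _ _ => zero_le_one) _)
  have h1 : ∫⁻ ω in A, ENNReal.ofReal (V ∩ mdl.edgeTargets (ξ ω) E n).card ∂P ≤
      ∫⁻ ω in A, ENNReal.ofReal (g ω) ∂P := by
    refine lintegral_mono_ae (ae_restrict_of_ae ?_)
    filter_upwards [hξ.ae_m_mem n] with ω hω
    refine ENNReal.ofReal_le_ofReal ?_
    have h2 := mdl.card_inter_edgeTargets_le (ξ ω) E n V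
    refine (Nat.cast_le (α := ℝ).2 h2).trans ?_
    rw [Nat.cast_add]
    refine add_le_add le_rfl ?_
    push_cast
    refine Finset.sum_le_sum fun v _ => Finset.sum_le_sum fun i _ => ?_
    split_ifs with h
    · rw [Set.indicator_of_mem (show ω ∈ {ω | mdl.EarlyM (ξ ω) n i v} from ⟨h.1, h.2.trans hω.2⟩)]
      simp
    · exact Set.indicator_nonneg (fun _ _ => zero_le_one) _
  refine h1.trans ?_
  rw [hξ.lintegral_fresh hA]
  swap
  · refine Measurable.ennreal_ofReal ((hφm _ ?_ ?_).add (hem _ ?_))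
    · exact dmeas_of_coord (measurable_coord_srcAlg ξ (s := .m n) rfl)
    · exact fun i v => measurable_coord_srcAlg ξ (s := .U n i v) rfl
    · exact fun i v => measurable_coord_srcAlg ξ (s := .T n i v) rfl
  have hm1 := hφm _ (hξ.dmeas_m n) (hξ.measurable_U n)
  have hi1 : Integrable (fun ω => φ ((ξ ω).m n) (V.filter fun v => mdl.Hit (ξ ω) E n v)) P := by
    refine Integrable.of_bound hm1.aestronglyMeasurable V.card
      (Filter.Eventually.of_forall fun ω => ?_)
    rw [Real.norm_of_nonneg (Nat.cast_nonneg _)]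
    exact Nat.cast_le.2 ((min_le_right _ _).trans (Finset.card_le_card (Finset.filter_subset _ _)))
  have hi2 : ∀ v i, Integrable ({ω | mdl.EarlyM (ξ ω) n i v}.indicator (1 : Ω → ℝ)) P :=
    fun v i => (integrable_const (1 : ℝ)).indicator (hξ.measurableSet_earlyM' n i v)
  have hi3 : Integrable (fun ω => ∑ v ∈ V, ∑ i ∈ Finset.range mdl.d,
      {ω | mdl.EarlyM (ξ ω) n i v}.indicator (1 : Ω → ℝ) ω) P :=
    integrable_finsetSum _ fun v _ => integrable_finsetSum _ fun i _ => hi2 v i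
  have hgi : Integrable g P := hi1.add hi3
  rw [← ofReal_integral_eq_lintegral_ofReal hgi (Filter.Eventually.of_forall hg0)]
  gcongr
  rw [integral_add hi1 hi3, hξ.integral_m_filter_hit E hn V φ]
  refine add_le_add le_rfl ?_
  rw [integral_finsetSum _ fun v _ => integrable_finsetSum _ fun i _ => hi2 v i]
  have h4 : ∀ v ∈ V, ∫ ω, ∑ i ∈ Finset.range mdl.d,
      {ω | mdl.EarlyM (ξ ω) n i v}.indicator (1 : Ω → ℝ) ω ∂P ≤ mdl.d * ((mdl.M + 1) / n) := by
    intro v _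
    rw [integral_finsetSum _ fun i _ => hi2 v i]
    calc _ ≤ ∑ i ∈ Finset.range mdl.d, ((mdl.M : ℝ) + 1) / n := Finset.sum_le_sum fun i _ => by
          rw [integral_indicator_one (hξ.measurableSet_earlyM' n i v)]
          exact hξ.prob_earlyM_le hn i v
      _ = _ := by simp
  refine (Finset.sum_le_sum h4).trans ?_
  rw [Finset.sum_const, nsmul_eq_mul, mul_assoc]

open Classical in
/-- Bound for the probability that a vertex `v` receives no edge in the edge step, if `S` contains
all vertices that are better than `v`. -/
lemma prob_notMem_edgeTargets_le (E : Multiset (ℕ × ℕ)) {n v : ℕ} (hn : 1 ≤ n) {S : Finset ℕ}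
    (hvS : v ∉ S) {A : Set Ω} (hA : MeasurableSet[mdl.filt ξ n] A)
    (hv : v ∈ mdl.verts (n + 1)) (hAS : ∀ ω ∈ A, ∀ w ∈ mdl.verts (n + 1),
      degKey (ξ ω) E n v < degKey (ξ ω) E n w → w ∈ S) :
    P (A ∩ {ω | v ∉ mdl.edgeTargets (ξ ω) E n}) ≤
      P A * ENNReal.ofReal (1 - mdl.hitProb n (inDeg E v) * (∑ r ∈ Finset.Icc 1 mdl.M,
        (mdl.law r).toReal * bernE S (fun v => mdl.hitProb n (inDeg E v))
          (fun R => if R.card < r then 1 else 0) - (1 + S.card * mdl.d * (mdl.M + 1)) / n)) := by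
  have hn' : (0 : ℝ) < n := by exact_mod_cast hn
  set p := mdl.hitProb n (inDeg E v) with hp
  set H : Set Ω := {ω | mdl.Hit (ξ ω) E n v} with hH
  set C : Set Ω := {ω | (S.filter fun w => mdl.Hit (ξ ω) E n w).card < (ξ ω).m n} with hC
  set U : Set Ω := {ω | (ξ ω).u n = v} with hU
  set T : ℕ → ℕ → Set Ω := fun w i => {ω | mdl.EarlyM (ξ ω) n i w} with hT
  set G : Set Ω := (H ∩ C)ᶜ ∪ (H ∩ U) ∪ ⋃ w ∈ S, ⋃ i ∈ Finset.range mdl.d, H ∩ T w i with hG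
  -- measurability with respect to a general `σ`-algebra
  have hHm : ∀ F : MeasurableSpace Ω, (∀ i v, Measurable[F] fun ω => (ξ ω).U n i v) →
      MeasurableSet[F] H := fun F h => mdl.measurableSet_hit ξ E (h · v)
  have hCm : ∀ F : MeasurableSpace Ω, (DMeas F fun ω => (ξ ω).m n) →
      (∀ i v, Measurable[F] fun ω => (ξ ω).U n i v) → MeasurableSet[F] C := by
    intro F hm h
    exact ((dmeas_filter S fun v => mdl.measurableSet_hit ξ E (h · v)).prod hm).measurableSet
      fun q => q.1.card < q.2
  have hTm : ∀ F : MeasurableSpace Ω, (∀ i v, Measurable[F] fun ω => (ξ ω).T n i v) →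
      ∀ w i, MeasurableSet[F] (T w i) := fun F h w i => mdl.measurableSet_earlyM ξ (h i)
  have hGm : MeasurableSet[srcAlg ξ (fresh n)] G := by
    have h1 : ∀ i v, Measurable[srcAlg ξ (fresh n)] fun ω => (ξ ω).U n i v :=
      fun i v => measurable_coord_srcAlg ξ (s := .U n i v) rfl
    have h2 : ∀ i v, Measurable[srcAlg ξ (fresh n)] fun ω => (ξ ω).T n i v :=
      fun i v => measurable_coord_srcAlg ξ (s := .T n i v) rfl
    have h3 : DMeas (srcAlg ξ (fresh n)) fun ω => (ξ ω).m n :=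
      dmeas_of_coord (measurable_coord_srcAlg ξ (s := .m n) rfl)
    have h4 : DMeas (srcAlg ξ (fresh n)) fun ω => (ξ ω).u n :=
      dmeas_of_coord (measurable_coord_srcAlg ξ (s := .u n) rfl)
    refine ((((hHm _ h1).inter (hCm _ h3 h1)).compl).union ((hHm _ h1).inter (h4 v))).union ?_
    exact Finset.measurableSet_biUnion _ fun w _ => Finset.measurableSet_biUnion _ fun i _ =>
      (hHm _ h1).inter (hTm _ h2 w i)
  have hsub : P (A ∩ {ω | v ∉ mdl.edgeTargets (ξ ω) E n}) ≤ P (A ∩ G) := by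
    refine measure_mono_ae ?_
    filter_upwards [hξ.ae_m_mem n] with ω hω
    rintro ⟨hωA, hωv⟩
    refine ⟨hωA, ?_⟩
    by_contra hωG
    simp only [hG, Set.mem_union, Set.mem_iUnion, Finset.mem_range, not_or, not_exists] at hωG
    obtain ⟨⟨h12, h3⟩, h4⟩ := hωG
    obtain ⟨h1, h2⟩ := Set.notMem_compl_iff.1 h12
    refine hωv (mdl.mem_edgeTargets_of_hit (ξ ω) (hAS ω hωA) hv (fun h => h3 ⟨h1, h⟩) h1 h2
      fun w hw i hi he => ?_)
    exact h4 w hw i hi ⟨h1, he.1, he.2.trans hω.2⟩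
  refine hsub.trans ?_
  have hAG : P (A ∩ G) = P A * P G := by
    exact (Indep_iff _ _ _).1 (hξ.indep_srcAlg (mdl.disjoint_past_fresh n)) A G hA hGm
  rw [hAG, ← ofReal_measureReal (μ := P) (s := G)]
  gcongr
  have hHm' := hHm _ (hξ.measurable_U n)
  have hCm' := hCm _ (hξ.dmeas_m n) (hξ.measurable_U n)
  -- the vertex is sampled and fewer than `m n` better ones are
  have hHC : P.real (H ∩ C) = p * ∑ r ∈ Finset.Icc 1 mdl.M, (mdl.law r).toReal *
      bernE S (fun v => mdl.hitProb n (inDeg E v)) (fun R => if R.card < r then 1 else 0) := by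
    rw [← integral_indicator_one (hHm'.inter hCm')]
    have h1 := hξ.integral_m_filter_hit E hn (insert v S)
      fun r R => if v ∈ R ∧ (R.erase v).card < r then 1 else 0
    have h2 : ∀ ω, (H ∩ C).indicator (1 : Ω → ℝ) ω = if v ∈ (insert v S).filter (fun v =>
        mdl.Hit (ξ ω) E n v) ∧ (((insert v S).filter fun v => mdl.Hit (ξ ω) E n v).erase v).card
        < (ξ ω).m n then 1 else 0 := by
      intro ω
      have : (((insert v S).filter fun v => mdl.Hit (ξ ω) E n v).erase v) =
          S.filter fun v => mdl.Hit (ξ ω) E n v := by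
        ext w
        simp only [Finset.mem_erase, Finset.mem_filter, Finset.mem_insert]
        constructor
        · rintro ⟨h1, h2 | h2, h3⟩
          · exact absurd h2 h1
          · exact ⟨h2, h3⟩
        · rintro ⟨h1, h2⟩
          exact ⟨fun h => hvS (h ▸ h1), Or.inr h1, h2⟩
      rw [this]
      by_cases h : mdl.Hit (ξ ω) E n v <;> simp [Set.indicator_apply, hH, hC, h]
    rw [integral_congr_ae (Filter.Eventually.of_forall h2), h1, Finset.mul_sum]
    refine Finset.sum_congr rfl fun r _ => ?_
    rw [bernE_insert hvS]
    have h3 : bernE S (fun v => mdl.hitProb n (inDeg E v)) (fun R =>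
        if v ∈ insert v R ∧ ((insert v R).erase v).card < r then (1 : ℝ) else 0) =
        bernE S (fun v => mdl.hitProb n (inDeg E v)) (fun R => if R.card < r then 1 else 0) := by
      refine bernE_congr (fun _ _ => rfl) fun R hR => ?_
      rw [Finset.erase_insert (fun h => hvS (hR h))]
      simp
    have h4 : bernE S (fun v => mdl.hitProb n (inDeg E v)) (fun R =>
        if v ∈ R ∧ (R.erase v).card < r then (1 : ℝ) else 0) = 0 := by
      refine Eq.trans ?_ (bernE_const S (fun v => mdl.hitProb n (inDeg E v)) 0)
      refine bernE_congr (fun _ _ => rfl) fun R hR => ?_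
      rw [if_neg fun h => hvS (hR h.1)]
    rw [h3, h4]
    ring
  have hHp : P.real H = p := hξ.prob_hit E hn v
  have hHU : P.real (H ∩ U) ≤ p * (1 / n) := by
    have hdisj : Disjoint {t : Source | ∃ i v, t = .U n i v}
        {Source.u n} := by
      rw [Set.disjoint_singleton_right]; simp
    have h1 := (Indep_iff _ _ _).1 (hξ.indep_srcAlg hdisj) H U
      (hHm (srcAlg ξ {t : Source | ∃ i v, t = .U n i v})
        fun i v => measurable_coord_srcAlg ξ (s := .U n i v) ⟨i, v, rfl⟩)
      (dmeas_of_coord (F := srcAlg ξ {Source.u n})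
        (measurable_coord_srcAlg ξ (s := .u n) rfl) v)
    rw [measureReal_def, h1, ENNReal.toReal_mul, ← measureReal_def, hHp]
    refine mul_le_mul_of_nonneg_left ?_ (mdl.hitProb_mem _ _).1
    rw [hU, hξ.law_u n v (by simpa [verts, add_assoc] using hv), ENNReal.toReal_inv,
      ENNReal.toReal_natCast,
      one_div]
    refine inv_anti₀ hn' ?_
    push_cast
    have : (0 : ℝ) ≤ mdl.n₀ := Nat.cast_nonneg _
    linarith
  have hHT : ∀ w i, P.real (H ∩ T w i) ≤ p * ((mdl.M + 1) / n) := by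
    intro w i
    have hdisj : Disjoint {t : Source | ∃ i v, t = .U n i v}
        {t : Source | ∃ i v, t = .T n i v} := by
      rw [Set.disjoint_left]
      rintro t ⟨i, v, rfl⟩ ⟨j, w, h⟩
      simp at h
    have h1 := (Indep_iff _ _ _).1 (hξ.indep_srcAlg hdisj) H (T w i)
      (hHm (srcAlg ξ {t : Source | ∃ i v, t = .U n i v})
        fun i v => measurable_coord_srcAlg ξ (s := .U n i v) ⟨i, v, rfl⟩)
      (hTm (srcAlg ξ {t : Source | ∃ i v, t = .T n i v})
        (fun i v => measurable_coord_srcAlg ξ (s := .T n i v) ⟨i, v, rfl⟩) w i)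
    rw [measureReal_def, h1, ENNReal.toReal_mul, ← measureReal_def, hHp]
    exact mul_le_mul_of_nonneg_left (hξ.prob_earlyM_le hn i w) (mdl.hitProb_mem _ _).1
  have hGle : P.real G ≤ (1 - P.real (H ∩ C)) + P.real (H ∩ U) +
      ∑ w ∈ S, ∑ i ∈ Finset.range mdl.d, P.real (H ∩ T w i) := by
    rw [← probReal_compl_eq_one_sub (hHm'.inter hCm')]
    refine (measureReal_union_le _ _).trans (add_le_add (measureReal_union_le _ _) ?_)
    refine (measureReal_biUnion_finset_le _ _).trans (Finset.sum_le_sum fun w _ => ?_)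
    exact measureReal_biUnion_finset_le _ _
  have hsum : ∑ w ∈ S, ∑ i ∈ Finset.range mdl.d, P.real (H ∩ T w i) ≤
      S.card * (mdl.d * (p * ((mdl.M + 1) / n))) := by
    calc _ ≤ ∑ w ∈ S, ∑ i ∈ Finset.range mdl.d, p * (((mdl.M : ℝ) + 1) / n) :=
          Finset.sum_le_sum fun w _ => Finset.sum_le_sum fun i _ => hHT w i
      _ = _ := by simp
  rw [hHC] at hGle
  have : p * (1 / n) + S.card * (mdl.d * (p * ((mdl.M + 1) / n))) =
      p * ((1 + S.card * mdl.d * (mdl.M + 1)) / n) := by ring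
  linarith

end IsNoise

/-! ### Bounds for conditional expectations -/

section CondLE

variable {Ω : Type*} {F mΩ : MeasurableSpace Ω} {P : Measure Ω} {Y q : Ω → ℝ}

/-- For nonnegative `Y` and `q`: the conditional expectation of `Y` given `F` is at most `q`. -/
def CondLE (F : MeasurableSpace Ω) {mΩ : MeasurableSpace Ω} (P : Measure Ω) (Y q : Ω → ℝ) : Prop :=
  ∀ A, MeasurableSet[F] A →
    ∫⁻ ω in A, ENNReal.ofReal (Y ω) ∂P ≤ ∫⁻ ω in A, ENNReal.ofReal (q ω) ∂P

lemma CondLE.lintegral_mul_le (h : CondLE F P Y q) (hF : F ≤ mΩ) (hY : Measurable Y)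
    (hq : Measurable q) {Φ : Ω → ENNReal} (hΦ : Measurable[F] Φ) :
    ∫⁻ ω, Φ ω * ENNReal.ofReal (Y ω) ∂P ≤ ∫⁻ ω, Φ ω * ENNReal.ofReal (q ω) ∂P := by
  have hΦ' : Measurable Φ := hΦ.mono hF le_rfl
  have key : ∀ Y : Ω → ℝ, Measurable Y → ∫⁻ ω, Φ ω * ENNReal.ofReal (Y ω) ∂P =
      ∫⁻ ω, Φ ω ∂((P.withDensity fun ω => ENNReal.ofReal (Y ω)).trim hF) := by
    intro Y hY
    rw [lintegral_trim hF hΦ, lintegral_withDensity_eq_lintegral_mul _ hY.ennreal_ofReal hΦ']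
    exact lintegral_congr fun ω => mul_comm _ _
  rw [key Y hY, key q hq]
  refine lintegral_mono' ?_ le_rfl
  refine Measure.le_iff.2 fun A hA => ?_
  rw [trim_measurableSet_eq hF hA, trim_measurableSet_eq hF hA, withDensity_apply _ (hF A hA),
    withDensity_apply _ (hF A hA)]
  exact h A hA

lemma CondLE.mono (h : CondLE F P Y q) {q' : Ω → ℝ} (hq : ∀ ω, q ω ≤ q' ω) : CondLE F P Y q' :=
  fun A hA => (h A hA).trans (lintegral_mono fun ω => ENNReal.ofReal_le_ofReal (hq ω))

/-- To bound a conditional expectation, a discrete part of the conditioning may be fixed. -/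
lemma condLE_of_dmeas {β : Type*} [Countable β] {Z : Ω → β} (hZ : DMeas F Z) (hF : F ≤ mΩ)
    (h : ∀ z A, MeasurableSet[F] A → (∀ ω ∈ A, Z ω = z) →
      ∫⁻ ω in A, ENNReal.ofReal (Y ω) ∂P ≤ ∫⁻ ω in A, ENNReal.ofReal (q ω) ∂P) :
    CondLE F P Y q := by
  intro A hA
  have hAu : A = ⋃ z, A ∩ {ω | Z ω = z} := by ext; simp
  have hd : Pairwise (Function.onFun Disjoint fun z => A ∩ {ω | Z ω = z}) := by
    intro z w hzw
    rw [Function.onFun, Set.disjoint_left]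
    rintro ω ⟨-, h1⟩ ⟨-, h2⟩
    exact hzw (h1.symm.trans h2)
  have hm : ∀ z, MeasurableSet (A ∩ {ω | Z ω = z}) := fun z => hF _ (hA.inter (hZ z))
  rw [hAu, lintegral_iUnion hm hd, lintegral_iUnion hm hd]
  exact ENNReal.tsum_le_tsum fun z => h z _ (hA.inter (hZ z)) fun ω hω => hω.2

end CondLE

namespace Model

variable (mdl : Model) (ξ : Noise)

/-- Probability that the `i`-th vertex by degree is sampled. -/
noncomputable def topHit (n i : ℕ) : ℝ := mdl.hitProb n (mdl.maxDeg ξ i n)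

/-- Bound for the expected total increment of the degrees of the vertices in `V`. -/
noncomputable def driftSet (V : Finset ℕ) (n : ℕ) : ℝ :=
  (∑ v ∈ V, (mdl.a * mdl.deg ξ n v + mdl.b)) / n + (∑ r ∈ Finset.Icc 1 mdl.M, (mdl.law r).toReal *
    bernE V (fun v => mdl.hitProb n (mdl.deg ξ n v)) (fun S => (min r S.card : ℕ))
    + V.card * mdl.d * ((mdl.M + 1) / n))

/-- Bound for the expected total increment of the degrees of any `k` vertices, in terms of the
highest degrees. -/
noncomputable def driftUp (k n : ℕ) : ℝ := (mdl.a * mdl.topSum ξ k n + k * mdl.b) / n +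
  (∑ i ∈ Finset.Icc 1 k, mdl.topHit ξ n i * mdl.Qt i (mdl.topHit ξ n)
    + k * mdl.d * ((mdl.M + 1) / n))

/-- The `k`-th highest degree is positive and separated from the `(k-1)`-st highest one. -/
def Separated (k n : ℕ) : Prop :=
  1 ≤ mdl.maxDeg ξ k n ∧ (k = 1 ∨ mdl.maxDeg ξ k n + 2 ≤ mdl.maxDeg ξ (k - 1) n)

open Classical in
/-- Lower bound for the expected increment of the `k`-th highest degree; it is `0` unless this
degree is separated from the next higher one. The term of order `1 / n` accounts for the choice of
`u n` and for the completion of samples. -/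
noncomputable def driftLow (k n : ℕ) : ℝ := if mdl.Separated ξ k n then
  min 1 ((mdl.a * mdl.maxDeg ξ k n + mdl.b) / n) + mdl.topHit ξ n k *
    (mdl.Qt k (mdl.topHit ξ n) - (1 + (k - 1 : ℕ) * mdl.d * (mdl.M + 1)) / n) else 0

lemma topHit_mem (n i : ℕ) : 0 ≤ mdl.topHit ξ n i ∧ mdl.topHit ξ n i ≤ 1 := mdl.hitProb_mem _ _

variable {ξ}

lemma deg_congr {ζ : Noise} {n : ℕ} (h : mdl.graph ξ n = mdl.graph ζ n) :
    mdl.deg ξ n = mdl.deg ζ n := by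
  funext v; rw [deg, deg, h]

lemma maxDeg_congr {ζ : Noise} {n : ℕ} (h : mdl.graph ξ n = mdl.graph ζ n) (i : ℕ) :
    mdl.maxDeg ξ i n = mdl.maxDeg ζ i n := by
  rw [maxDeg, maxDeg, h]

lemma topHit_congr {ζ : Noise} {n : ℕ} (h : mdl.graph ξ n = mdl.graph ζ n) :
    mdl.topHit ξ n = mdl.topHit ζ n := by
  funext i; rw [topHit, topHit, mdl.maxDeg_congr h]

lemma driftSet_congr {ζ : Noise} {n : ℕ} (h : mdl.graph ξ n = mdl.graph ζ n) (V : Finset ℕ) :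
    mdl.driftSet ξ V n = mdl.driftSet ζ V n := by
  rw [driftSet, driftSet, mdl.deg_congr h]

lemma driftUp_congr {ζ : Noise} {n : ℕ} (h : mdl.graph ξ n = mdl.graph ζ n) (k : ℕ) :
    mdl.driftUp ξ k n = mdl.driftUp ζ k n := by
  simp only [driftUp, topSum, mdl.maxDeg_congr h, mdl.topHit_congr h]

lemma driftLow_congr {ζ : Noise} {n : ℕ} (h : mdl.graph ξ n = mdl.graph ζ n) (k : ℕ) :
    mdl.driftLow ξ k n = mdl.driftLow ζ k n := by
  have hS : mdl.Separated ξ k n ↔ mdl.Separated ζ k n := by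
    simp only [Separated, mdl.maxDeg_congr h]
  by_cases hs : mdl.Separated ζ k n
  · rw [driftLow, if_pos (hS.2 hs), driftLow, if_pos hs, mdl.maxDeg_congr h, mdl.topHit_congr h]
  · rw [driftLow, if_neg (fun h' => hs (hS.1 h')), driftLow, if_neg hs]

variable (ξ)

/-- The expected number of vertices of `V` among the targets is largest for the top vertices. -/
lemma sum_law_bernE_le (n : ℕ) (V : Finset ℕ) :
    ∑ r ∈ Finset.Icc 1 mdl.M, (mdl.law r).toReal *
        bernE V (fun v => mdl.hitProb n (mdl.deg ξ n v)) (fun S => (min r S.card : ℕ)) ≤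
      ∑ i ∈ Finset.Icc 1 V.card, mdl.topHit ξ n i * mdl.Qt i (mdl.topHit ξ n) := by
  obtain ⟨e, he, hV, h⟩ := mdl.exists_enumeration_le_maxDeg ξ n V
  rw [← sum_law_bernE_min]
  refine Finset.sum_le_sum fun r _ => mul_le_mul_of_nonneg_left ?_ ENNReal.toReal_nonneg
  have h1 := bernE_card_image he (fun v => mdl.hitProb n (mdl.deg ξ n v))
    (fun c => ((min r c : ℕ) : ℝ))
  rw [hV] at h1
  rw [h1]
  refine bernE_mono (fun j _ => (mdl.hitProb_mem _ _).1)
    (fun j hj => mdl.hitProb_mono n (h j hj)) (fun j _ => (mdl.topHit_mem ξ n j).2) ?_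
  intro S T hST
  exact Nat.cast_le.2 (min_le_min_left r (Finset.card_le_card hST))

lemma driftSet_le_driftUp (V : Finset ℕ) (n : ℕ) :
    mdl.driftSet ξ V n ≤ mdl.driftUp ξ V.card n := by
  have ha := mdl.a_pos
  refine add_le_add ?_ (add_le_add (mdl.sum_law_bernE_le ξ n V) le_rfl)
  gcongr
  rw [Finset.sum_add_distrib, ← Finset.mul_sum, Finset.sum_const, nsmul_eq_mul]
  gcongr
  exact_mod_cast mdl.sum_deg_le_topSum ξ n V

/-- The expected increment of a single degree is bounded by the linearised dynamics. -/
lemma driftSet_singleton_le (n v : ℕ) : mdl.driftSet ξ {v} n ≤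
    ((mdl.a + mdl.d * mdl.α) * mdl.deg ξ n v
      + (mdl.b + mdl.d * mdl.β + mdl.d * (mdl.M + 1))) / n := by
  have h1 : ∑ r ∈ Finset.Icc 1 mdl.M, (mdl.law r).toReal * bernE {v}
      (fun v => mdl.hitProb n (mdl.deg ξ n v)) (fun S => (min r S.card : ℕ)) =
      mdl.hitProb n (mdl.deg ξ n v) := by
    rw [← one_mul (mdl.hitProb n (mdl.deg ξ n v)), ← mdl.sum_law, Finset.sum_mul]
    refine Finset.sum_congr rfl fun r hr => ?_
    have hr1 := (Finset.mem_Icc.1 hr).1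
    rw [← insert_empty_eq, bernE_insert (Finset.notMem_empty v), bernE_empty, bernE_empty]
    simp [hr1]
  have h2 := mdl.hitProb_le n (mdl.deg ξ n v)
  rw [driftSet, h1, Finset.sum_singleton, Finset.card_singleton, Nat.cast_one, one_mul]
  calc _ ≤ (mdl.a * mdl.deg ξ n v + mdl.b) / n + (mdl.d * ((mdl.α * mdl.deg ξ n v + mdl.β) / n) +
        mdl.d * ((mdl.M + 1) / n)) := by gcongr
    _ = _ := by ring

end Model

namespace IsNoise

open Model

variable {Ω : Type*} [mΩ : MeasurableSpace Ω] {P : Measure Ω} [IsProbabilityMeasure P]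
  {ξ : Ω → Noise} {mdl : Model} (hξ : IsNoise mdl P ξ)
include hξ

/-- Given the graph at time `n`, the edges to `V` drawn in the vertex step and in the edge step are
bounded separately. -/
lemma condLE_driftSet {n : ℕ} (hn : 1 ≤ n) (V : Finset ℕ) :
    CondLE (mdl.filt ξ n) P
      (fun ω => ∑ v ∈ V, ((mdl.deg (ξ ω) (n + 1) v : ℝ) - mdl.deg (ξ ω) n v))
      (fun ω => mdl.driftSet (ξ ω) V n) := by
  classical
  refine condLE_of_dmeas (mdl.dmeas_graph_filt ξ n) (hξ.filt_le n) fun E A hA hAE => ?_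
  have hA' : MeasurableSet A := hξ.filt_le n A hA
  rcases A.eq_empty_or_nonempty with rfl | ⟨ω₀, hω₀⟩
  · simp
  have hE := hAE ω₀ hω₀
  have hvm : ∀ v, MeasurableSet {ω | v ∈ mdl.vertexTargets (ξ ω) E n} := fun v =>
    (mdl.dmeas_vertexTargets ξ E fun v _ => hξ.measurable (.X v)).measurableSet fun S => v ∈ S
  have h1 : ∫⁻ ω in A, ENNReal.ofReal
      (∑ v ∈ V, ((mdl.deg (ξ ω) (n + 1) v : ℝ) - mdl.deg (ξ ω) n v)) ∂P =
      ∫⁻ ω in A, (∑ v ∈ V, {ω | v ∈ mdl.vertexTargets (ξ ω) E n}.indicator 1 ω +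
        ENNReal.ofReal (V ∩ mdl.edgeTargets (ξ ω) E n).card) ∂P := by
    refine setLIntegral_congr_fun hA' fun ω hω => ?_
    have hs : ∀ v ∈ V, ((mdl.deg (ξ ω) (n + 1) v : ℝ) - mdl.deg (ξ ω) n v) =
        (if v ∈ mdl.vertexTargets (ξ ω) E n then 1 else 0)
          + (if v ∈ mdl.edgeTargets (ξ ω) E n then 1 else 0) := by
      intro v _
      rw [deg_succ, hAE ω hω]
      push_cast
      ring
    rw [Finset.sum_congr rfl hs, Finset.sum_add_distrib, ENNReal.ofReal_add
      (Finset.sum_nonneg fun _ _ => by split_ifs <;> norm_num)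
      (Finset.sum_nonneg fun _ _ => by split_ifs <;> norm_num),
      ENNReal.ofReal_sum_of_nonneg fun _ _ => by split_ifs <;> norm_num]
    congr 1
    · refine Finset.sum_congr rfl fun v _ => ?_
      by_cases h : v ∈ mdl.vertexTargets (ξ ω) E n <;> simp [h]
    · rw [Finset.sum_boole, Finset.filter_mem_eq_inter]
  rw [h1, lintegral_add_left (Finset.measurable_sum _ fun v _ => measurable_one.indicator (hvm v)),
    lintegral_finsetSum _ fun v _ => measurable_one.indicator (hvm v)]
  have h2 : ∀ v ∈ V, ∫⁻ ω in A, {ω | v ∈ mdl.vertexTargets (ξ ω) E n}.indicator 1 ω ∂P ≤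
      P A * ENNReal.ofReal ((mdl.a * inDeg E v + mdl.b) / n) := by
    intro v _
    rw [lintegral_indicator_one (hvm v), Measure.restrict_apply (hvm v), Set.inter_comm]
    exact hξ.prob_vertexTargets_le E v hn hA
  have h3 := hξ.lintegral_edgeTargets_le E hn V hA
  have h4 : ∫⁻ ω in A, ENNReal.ofReal (mdl.driftSet (ξ ω) V n) ∂P =
      P A * ENNReal.ofReal (mdl.driftSet (ξ ω₀) V n) := by
    rw [setLIntegral_congr_fun hA' (g := fun _ => ENNReal.ofReal (mdl.driftSet (ξ ω₀) V n))
      fun ω hω => by simp only [mdl.driftSet_congr ((hAE ω hω).trans hE.symm)]]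
    rw [setLIntegral_const, mul_comm]
  rw [h4]
  have ha := mdl.a_pos
  have hb := mdl.b_pos
  have hdE : ∀ v, inDeg E v = mdl.deg (ξ ω₀) n v := fun v => by rw [deg, hE]
  simp only [hdE] at h2 h3
  refine (add_le_add (Finset.sum_le_sum h2) h3).trans ?_
  rw [← Finset.mul_sum, ← mul_add, ← ENNReal.ofReal_sum_of_nonneg fun v _ => by positivity]
  rw [← ENNReal.ofReal_add (Finset.sum_nonneg fun v _ => by positivity)]
  swap
  · refine add_nonneg (Finset.sum_nonneg fun r _ => mul_nonneg ENNReal.toReal_nonneg ?_)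
      (by positivity)
    refine (bernE_const V (fun v => mdl.hitProb n (mdl.deg (ξ ω₀) n v)) 0).ge.trans ?_
    exact bernE_mono_fun (fun v _ => mdl.hitProb_mem _ _) fun _ _ => Nat.cast_nonneg _
  rw [driftSet, ← Finset.sum_div]

lemma condLE_driftUp {n : ℕ} (hn : 1 ≤ n) (V : Finset ℕ) :
    CondLE (mdl.filt ξ n) P
      (fun ω => ∑ v ∈ V, ((mdl.deg (ξ ω) (n + 1) v : ℝ) - mdl.deg (ξ ω) n v))
      (fun ω => mdl.driftUp (ξ ω) V.card n) :=
  (hξ.condLE_driftSet hn V).mono fun ω => mdl.driftSet_le_driftUp (ξ ω) V n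

/-- Fixing the graph and the sets of the `k - 1` and the `k` top vertices fixes the `k`-th vertex by
degree; it misses an edge with the probabilities of the single steps, and `maxDeg k` inherits its
increment as long as it is separated from `maxDeg (k - 1)`. Increments are at most `2`, so the lower
bound is stated as an upper bound for the nonnegative quantity `2 - increment`. -/
lemma condLE_driftLow {n k : ℕ} (hn : 1 ≤ n) (hk : 1 ≤ k) :
    CondLE (mdl.filt ξ n) P
      (fun ω => 2 - ((mdl.maxDeg (ξ ω) k (n + 1) : ℝ) - mdl.maxDeg (ξ ω) k n))
      (fun ω => 2 - mdl.driftLow (ξ ω) k n) := by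
  classical
  have hgm := mdl.dmeas_graph_filt ξ n
  have htop : ∀ r, DMeas (mdl.filt ξ n) fun ω =>
      top (degKey (ξ ω) (mdl.graph (ξ ω) n) n) r (mdl.verts n) := fun r =>
    hgm.bind (g := fun E ω => top (degKey (ξ ω) E n) r (mdl.verts n)) fun E =>
      DMeas.top (measurableSet_degKey_lt ξ E
        fun v => measurable_coord_srcAlg ξ (s := .W n v) (le_refl n))
        (DMeas.const r) (DMeas.const _)
  refine condLE_of_dmeas (hgm.prod ((htop (k - 1)).prod (htop k))) (hξ.filt_le n) ?_
  rintro ⟨E, S, S'⟩ A hA hAZ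
  have hA' : MeasurableSet A := hξ.filt_le n A hA
  rcases A.eq_empty_or_nonempty with rfl | ⟨ω₀, hω₀⟩
  · simp
  simp only [Prod.mk.injEq] at hAZ
  have hE := (hAZ ω₀ hω₀).1
  have hcongr : ∀ ω ∈ A, mdl.graph (ξ ω) n = mdl.graph (ξ ω₀) n := fun ω hω =>
    (hAZ ω hω).1.trans hE.symm
  have h4 : ∫⁻ ω in A, ENNReal.ofReal (2 - mdl.driftLow (ξ ω) k n) ∂P =
      P A * ENNReal.ofReal (2 - mdl.driftLow (ξ ω₀) k n) := by
    rw [setLIntegral_congr_fun hA' (g := fun _ => ENNReal.ofReal (2 - mdl.driftLow (ξ ω₀) k n))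
      fun ω hω => by simp only [mdl.driftLow_congr (hcongr ω hω)]]
    rw [setLIntegral_const, mul_comm]
  rw [h4]
  by_cases hsep : mdl.Separated (ξ ω₀) k n
  swap
  · rw [driftLow, if_neg hsep, sub_zero, mul_comm, ← setLIntegral_const]
    refine lintegral_mono fun ω => ENNReal.ofReal_le_ofReal ?_
    have : mdl.maxDeg (ξ ω) k n ≤ mdl.maxDeg (ξ ω) k (n + 1) :=
      mdl.maxDeg_mono (ξ ω) hk (Nat.le_succ n)
    have : (mdl.maxDeg (ξ ω) k n : ℝ) ≤ mdl.maxDeg (ξ ω) k (n + 1) := by exact_mod_cast this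
    linarith
  -- the `k`-th vertex by degree
  have hkc : k ≤ (mdl.verts n).card :=
    ((le_kthLargest_iff hk hsep.1).1 le_rfl).trans (Finset.card_le_card (Finset.filter_subset _ _))
  have hκ : ∀ ω, Function.Injective (degKey (ξ ω) (mdl.graph (ξ ω) n) n) :=
    fun ω => degKey_injective _ _ _
  obtain ⟨e, heinj, he⟩ := exists_enumeration (hκ ω₀) (mdl.verts n) hkc
  set v := e k with hv
  have hvk := he k (Finset.mem_Icc.2 ⟨hk, le_rfl⟩)
  have hrank : ∀ ω ∈ A, ((mdl.verts n).filter fun w => degKey (ξ ω) (mdl.graph (ξ ω) n) n v <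
      degKey (ξ ω) (mdl.graph (ξ ω) n) n w).card = k - 1 := by
    intro ω hω
    have h1 : v ∈ S' := by
      rw [← (hAZ ω₀ hω₀).2.2, mem_top]
      exact ⟨hvk.1, by rw [hvk.2]; omega⟩
    have h2 : v ∉ S := by
      rw [← (hAZ ω₀ hω₀).2.1, mem_top, hvk.2]
      exact fun h => lt_irrefl _ h.2
    rw [← (hAZ ω hω).2.2, mem_top] at h1
    rw [← (hAZ ω hω).2.1, mem_top, not_and, not_lt] at h2
    have := h2 hvk.1
    have := h1.2
    omega
  have hdeg : mdl.deg (ξ ω₀) n v = mdl.maxDeg (ξ ω₀) k n :=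
    mdl.deg_eq_maxDeg_of_rank (ξ ω₀) n hk hvk.1 (hrank ω₀ hω₀)
  have hdE : ∀ w, inDeg E w = mdl.deg (ξ ω₀) n w := fun w => by rw [deg, hE]
  have hSimg : S = (Finset.Ico 1 k).image e := by
    ext w
    rw [← (hAZ ω₀ hω₀).2.1, mem_top, Finset.mem_image]
    constructor
    · rintro ⟨hw, hr⟩
      refine ⟨_, Finset.mem_Ico.2 ⟨Nat.le_add_left 1 ((mdl.verts n).filter fun x =>
        degKey (ξ ω₀) (mdl.graph (ξ ω₀) n) n w < degKey (ξ ω₀) (mdl.graph (ξ ω₀) n) n x).card,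
        by omega⟩, ?_⟩
      have h1 := he (((mdl.verts n).filter fun x => degKey (ξ ω₀) (mdl.graph (ξ ω₀) n) n w <
        degKey (ξ ω₀) (mdl.graph (ξ ω₀) n) n x).card + 1) (Finset.mem_Icc.2 ⟨by omega, by omega⟩)
      exact rank_injOn (hκ ω₀) (mdl.verts n) h1.1 hw (by simpa using h1.2)
    · rintro ⟨i, hi, rfl⟩
      rw [Finset.mem_Ico] at hi
      have h1 := he i (Finset.mem_Icc.2 ⟨hi.1, hi.2.le⟩)
      exact ⟨h1.1, by rw [h1.2]; omega⟩
  have hinj' : Set.InjOn e (Finset.Ico 1 k : Set ℕ) :=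
    heinj.mono fun i hi => by simp at hi ⊢; omega
  have hScard : S.card = k - 1 := by
    rw [hSimg, Finset.card_image_of_injOn hinj', Nat.card_Ico]
  have hvS : v ∉ S := by
    rw [← (hAZ ω₀ hω₀).2.1, mem_top, hvk.2]
    exact fun h => lt_irrefl _ h.2
  have hv1 : v ∈ mdl.verts (n + 1) := mdl.mem_verts.2 (by
    have := mdl.mem_verts.1 hvk.1
    omega)
  have hAS : ∀ ω ∈ A, ∀ w ∈ mdl.verts (n + 1),
      degKey (ξ ω) E n v < degKey (ξ ω) E n w → w ∈ S := by
    intro ω hω w hw hlt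
    have hwn : w ∈ mdl.verts n := by
      by_contra hwn
      have h0 : inDeg E w = 0 := by
        rw [hdE]
        exact mdl.deg_eq_zero (ξ ω₀) (by simpa [mem_verts] using hwn)
      have h1 : 1 ≤ inDeg E v := by
        rw [hdE, hdeg]; exact hsep.1
      rw [degKey, degKey, Prod.Lex.toLex_lt_toLex] at hlt
      rcases hlt with h | h
      · simp only at h; omega
      · have := h.1; simp only at this; omega
    rw [← (hAZ ω hω).2.1, mem_top]
    refine ⟨hwn, ?_⟩
    rw [← hrank ω hω]
    refine rank_lt_rank hwn ?_
    rw [(hAZ ω hω).1]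
    exact hlt
  have h5 := hξ.prob_notMem_edgeTargets_le E hn hvS hA hv1 hAS
  have h6 := hξ.prob_vertexTargets E hn (mdl.mem_verts.1 hvk.1) hA
  have hvm : MeasurableSet {ω | v ∈ mdl.vertexTargets (ξ ω) E n} :=
    (mdl.dmeas_vertexTargets ξ E fun v _ => hξ.measurable (.X v)).measurableSet fun S => v ∈ S
  have hem : MeasurableSet {ω | v ∈ mdl.edgeTargets (ξ ω) E n} :=
    (mdl.dmeas_edgeTargets ξ E (hξ.dmeas_m n) (hξ.dmeas_u n) (hξ.measurable_U n)
      (hξ.measurable_T n) fun v => hξ.measurable (.W n v)).measurableSet fun S => v ∈ S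
  have hp0 : 0 ≤ min 1 ((mdl.a * inDeg E v + mdl.b) / n) := by
    have := mdl.a_pos; have := mdl.b_pos
    exact le_min zero_le_one (by positivity)
  have h7 : P (A ∩ {ω | v ∉ mdl.vertexTargets (ξ ω) E n}) =
      P A * ENNReal.ofReal (1 - min 1 ((mdl.a * inDeg E v + mdl.b) / n)) := by
    have := measure_inter_add_sdiff (μ := P) A hvm
    rw [h6] at this
    have h8 : A ∩ {ω | v ∉ mdl.vertexTargets (ξ ω) E n} =
        A \ {ω | v ∈ mdl.vertexTargets (ξ ω) E n} := rfl
    have hfin : P A * ENNReal.ofReal (min 1 ((mdl.a * inDeg E v + mdl.b) / n)) ≠ ⊤ :=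
      ENNReal.mul_ne_top (measure_ne_top _ _) ENNReal.ofReal_ne_top
    rw [h8, ENNReal.ofReal_sub _ hp0, ENNReal.mul_sub fun _ _ => measure_ne_top _ _,
      ENNReal.ofReal_one, mul_one]
    exact ENNReal.eq_sub_of_add_eq hfin (by rw [add_comm]; exact this)
  have h9 : ∫⁻ ω in A, ENNReal.ofReal
      (2 - ((mdl.maxDeg (ξ ω) k (n + 1) : ℝ) - mdl.maxDeg (ξ ω) k n)) ∂P ≤
      ∫⁻ ω in A, ({ω | v ∉ mdl.vertexTargets (ξ ω) E n}.indicator 1 ω +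
        {ω | v ∉ mdl.edgeTargets (ξ ω) E n}.indicator 1 ω) ∂P := by
    refine setLIntegral_mono' hA' fun ω hω => ?_
    have hg := hcongr ω hω
    have h10 := mdl.deg_succ_le_maxDeg_succ (ξ ω) n hk hvk.1 (hrank ω hω) (by
      rw [mdl.maxDeg_congr hg, mdl.maxDeg_congr hg]; exact hsep.2)
    rw [deg_succ, mdl.deg_congr hg, (hAZ ω hω).1, hdeg] at h10
    rw [mdl.maxDeg_congr hg]
    have h11 : (mdl.maxDeg (ξ ω₀) k n : ℝ) + (if v ∈ mdl.vertexTargets (ξ ω) E n then 1 else 0)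
        + (if v ∈ mdl.edgeTargets (ξ ω) E n then 1 else 0) ≤ mdl.maxDeg (ξ ω) k (n + 1) := by
      exact_mod_cast h10
    have h12 : ({ω | v ∉ mdl.vertexTargets (ξ ω) E n}.indicator 1 ω +
        {ω | v ∉ mdl.edgeTargets (ξ ω) E n}.indicator 1 ω : ENNReal) = ENNReal.ofReal
        ((if v ∈ mdl.vertexTargets (ξ ω) E n then 0 else 1)
          + (if v ∈ mdl.edgeTargets (ξ ω) E n then 0 else 1)) := by
      by_cases h : v ∈ mdl.vertexTargets (ξ ω) E n <;>
        by_cases h' : v ∈ mdl.edgeTargets (ξ ω) E n <;> simp [h, h']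
      norm_num
    rw [h12]
    refine ENNReal.ofReal_le_ofReal ?_
    by_cases h : v ∈ mdl.vertexTargets (ξ ω) E n <;>
      by_cases h' : v ∈ mdl.edgeTargets (ξ ω) E n <;>
      simp only [h, h', if_true, if_false] at h11 ⊢ <;> linarith
  refine h9.trans ?_
  have hvm' : MeasurableSet {ω | v ∉ mdl.vertexTargets (ξ ω) E n} := hvm.compl
  have hem' : MeasurableSet {ω | v ∉ mdl.edgeTargets (ξ ω) E n} := hem.compl
  rw [lintegral_add_left (measurable_one.indicator hvm'), lintegral_indicator_one hvm',
    lintegral_indicator_one hem', Measure.restrict_apply hvm', Measure.restrict_apply hem',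
    Set.inter_comm _ A, Set.inter_comm _ A]
  have hQ : ∑ r ∈ Finset.Icc 1 mdl.M, (mdl.law r).toReal *
      bernE S (fun v => mdl.hitProb n (inDeg E v)) (fun R => if R.card < r then 1 else 0) =
      mdl.Qt k (mdl.topHit (ξ ω₀) n) := by
    rw [Qt]
    refine Finset.sum_congr rfl fun r _ => ?_
    have h13 := bernE_card_image hinj' (fun v => mdl.hitProb n (inDeg E v))
      (fun c => if c < r then (1 : ℝ) else 0)
    rw [← hSimg] at h13
    rw [h13]
    congr 1
    refine bernE_congr (fun i hi => ?_) fun _ _ => rfl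
    rw [Finset.mem_Ico] at hi
    have h1 := he i (Finset.mem_Icc.2 ⟨hi.1, hi.2.le⟩)
    rw [Function.comp, hdE, topHit, mdl.deg_eq_maxDeg_of_rank (ξ ω₀) n hi.1 h1.1 h1.2]
  rw [hQ, hScard] at h5
  refine (add_le_add h7.le h5).trans ?_
  rw [← mul_add, hdE, hdeg, ← ENNReal.ofReal_add]
  · gcongr
    rw [driftLow, if_pos hsep, topHit]
    linarith
  · linarith [min_le_left (1 : ℝ) ((mdl.a * mdl.maxDeg (ξ ω₀) k n + mdl.b) / n)]
  · have h14 := mdl.hitProb_mem n (mdl.maxDeg (ξ ω₀) k n)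
    have h15 := mdl.Qt_le_one (i := k) (t := mdl.topHit (ξ ω₀) n)
      fun j _ => mdl.topHit_mem (ξ ω₀) n j
    have h16 : (0 : ℝ) ≤ (1 + (k - 1 : ℕ) * mdl.d * (mdl.M + 1)) / n := by positivity
    nlinarith

end IsNoise

/-! ### Concentration -/

section Concentration

variable {Ω : Type*} {mΩ : MeasurableSpace Ω} {P : Measure Ω} [IsProbabilityMeasure P]
  {𝓕 : ℕ → MeasurableSpace Ω} {Y q : ℕ → Ω → ℝ} {B : ℝ}

/-- Exponential moments of a sum of bounded increments, compensated by upper bounds for their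
conditional expectations. -/
lemma lintegral_exp_compensated_le (h𝓕 : Monotone 𝓕) (h𝓕' : ∀ n, 𝓕 n ≤ mΩ)
    (hY : ∀ n, Measurable[𝓕 (n + 1)] (Y n)) (hq : ∀ n, Measurable[𝓕 n] (q n))
    (hY0 : ∀ n ω, 0 ≤ Y n ω) (hYB : ∀ n ω, Y n ω ≤ B) (hq0 : ∀ n ω, 0 ≤ q n ω)
    (hc : ∀ n, 1 ≤ n → CondLE (𝓕 n) P (Y n) (q n)) {l : ℝ} (hl : 0 ≤ l) (hlB : l * B ≤ 1)
    {s n : ℕ} (hs : 1 ≤ s) (hsn : s ≤ n) :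
    ∫⁻ ω, ENNReal.ofReal (Real.exp (l * ∑ j ∈ Finset.Ico s n, (Y j ω - q j ω))) ∂P ≤
      ENNReal.ofReal (Real.exp (l ^ 2 * B ^ 2 * (n - s : ℕ))) := by
  induction n, hsn using Nat.le_induction with
  | base => simp
  | succ n hsn ih =>
    set R : Ω → ℝ := fun ω => ∑ j ∈ Finset.Ico s n, (Y j ω - q j ω) with hR
    have hRm : Measurable[𝓕 n] R := by
      refine Finset.measurable_sum _ fun j hj => ?_
      have hj' := (Finset.mem_Ico.1 hj).2
      exact ((hY j).mono (h𝓕 hj') le_rfl).sub ((hq j).mono (h𝓕 hj'.le) le_rfl)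
    set Φ : Ω → ℝ := fun ω => Real.exp (l * R ω - l * q n ω) with hΦ
    have hΦm : Measurable[𝓕 n] Φ :=
      Real.measurable_exp.comp ((hRm.const_mul l).sub ((hq n).const_mul l))
    have hYm : Measurable (Y n) := (hY n).mono (h𝓕' _) le_rfl
    have hqm : Measurable (q n) := (hq n).mono (h𝓕' _) le_rfl
    have hΦm' : Measurable Φ := hΦm.mono (h𝓕' _) le_rfl
    have h1 : ∀ ω, Real.exp (l * ∑ j ∈ Finset.Ico s (n + 1), (Y j ω - q j ω)) ≤
        Φ ω * (1 + l ^ 2 * B ^ 2) + (l * Φ ω) * Y n ω := by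
      intro ω
      rw [Finset.sum_Ico_succ_top hsn, show l * (∑ j ∈ Finset.Ico s n, (Y j ω - q j ω) +
        (Y n ω - q n ω)) = (l * R ω - l * q n ω) + l * Y n ω by simp only [hR]; ring, Real.exp_add]
      have h2 : |l * Y n ω| ≤ 1 := by
        rw [abs_of_nonneg (mul_nonneg hl (hY0 n ω))]
        exact (mul_le_mul_of_nonneg_left (hYB n ω) hl).trans hlB
      -- `exp x ≤ 1 + x + x ^ 2` for `|x| ≤ 1`
      have h3 := (abs_le.1 (Real.abs_exp_sub_one_sub_id_le h2)).2
      have h4 : (l * Y n ω) ^ 2 ≤ l ^ 2 * B ^ 2 := by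
        rw [mul_pow]
        exact mul_le_mul_of_nonneg_left (pow_le_pow_left₀ (hY0 n ω) (hYB n ω) 2) (sq_nonneg l)
      have h5 : Real.exp (l * Y n ω) ≤ 1 + l ^ 2 * B ^ 2 + l * Y n ω := by linarith
      calc _ ≤ Φ ω * (1 + l ^ 2 * B ^ 2 + l * Y n ω) :=
            mul_le_mul_of_nonneg_left h5 (Real.exp_pos _).le
        _ = _ := by ring
    have hΦ0 : ∀ ω, 0 ≤ Φ ω := fun ω => (Real.exp_pos _).le
    calc ∫⁻ ω, ENNReal.ofReal (Real.exp (l * ∑ j ∈ Finset.Ico s (n + 1), (Y j ω - q j ω))) ∂P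
        ≤ ∫⁻ ω, (ENNReal.ofReal (Φ ω * (1 + l ^ 2 * B ^ 2)) +
          ENNReal.ofReal (l * Φ ω) * ENNReal.ofReal (Y n ω)) ∂P := by
          refine lintegral_mono fun ω => ?_
          rw [← ENNReal.ofReal_mul (mul_nonneg hl (hΦ0 ω)), ← ENNReal.ofReal_add
            (mul_nonneg (hΦ0 ω) (by positivity))
            (mul_nonneg (mul_nonneg hl (hΦ0 ω)) (hY0 n ω))]
          exact ENNReal.ofReal_le_ofReal (h1 ω)
      _ = ∫⁻ ω, ENNReal.ofReal (Φ ω * (1 + l ^ 2 * B ^ 2)) ∂P +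
          ∫⁻ ω, ENNReal.ofReal (l * Φ ω) * ENNReal.ofReal (Y n ω) ∂P :=
          lintegral_add_left (hΦm'.mul_const _).ennreal_ofReal _
      _ ≤ ∫⁻ ω, ENNReal.ofReal (Φ ω * (1 + l ^ 2 * B ^ 2)) ∂P +
          ∫⁻ ω, ENNReal.ofReal (l * Φ ω) * ENNReal.ofReal (q n ω) ∂P := by
          gcongr 1
          exact (hc n (hs.trans hsn)).lintegral_mul_le (h𝓕' n) hYm hqm
            (hΦm.const_mul l).ennreal_ofReal
      _ = ∫⁻ ω, (ENNReal.ofReal (Φ ω * (1 + l ^ 2 * B ^ 2)) +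
          ENNReal.ofReal (l * Φ ω) * ENNReal.ofReal (q n ω)) ∂P :=
          (lintegral_add_left (hΦm'.mul_const _).ennreal_ofReal _).symm
      _ ≤ ∫⁻ ω, ENNReal.ofReal (Real.exp (l * R ω)) *
          ENNReal.ofReal (Real.exp (l ^ 2 * B ^ 2)) ∂P := by
          refine lintegral_mono fun ω => ?_
          rw [← ENNReal.ofReal_mul (mul_nonneg hl (hΦ0 ω)), ← ENNReal.ofReal_add
            (mul_nonneg (hΦ0 ω) (by positivity))
            (mul_nonneg (mul_nonneg hl (hΦ0 ω)) (hq0 n ω)),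
            ← ENNReal.ofReal_mul (Real.exp_pos _).le]
          refine ENNReal.ofReal_le_ofReal ?_
          have h6 := Real.add_one_le_exp (l ^ 2 * B ^ 2 + l * q n ω)
          calc Φ ω * (1 + l ^ 2 * B ^ 2) + l * Φ ω * q n ω
              = Φ ω * (l ^ 2 * B ^ 2 + l * q n ω + 1) := by ring
            _ ≤ Φ ω * Real.exp (l ^ 2 * B ^ 2 + l * q n ω) :=
              mul_le_mul_of_nonneg_left h6 (hΦ0 ω)
            _ = _ := by rw [hΦ, ← Real.exp_add, ← Real.exp_add]; ring_nf
      _ = (∫⁻ ω, ENNReal.ofReal (Real.exp (l * R ω)) ∂P) *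
          ENNReal.ofReal (Real.exp (l ^ 2 * B ^ 2)) :=
          lintegral_mul_const _ (Real.measurable_exp.comp
            ((hRm.mono (h𝓕' _) le_rfl).const_mul l)).ennreal_ofReal
      _ ≤ ENNReal.ofReal (Real.exp (l ^ 2 * B ^ 2 * (n - s : ℕ))) *
          ENNReal.ofReal (Real.exp (l ^ 2 * B ^ 2)) := by gcongr
      _ = ENNReal.ofReal (Real.exp (l ^ 2 * B ^ 2 * (n + 1 - s : ℕ))) := by
          rw [← ENNReal.ofReal_mul (Real.exp_pos _).le, ← Real.exp_add, Nat.succ_sub hsn]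
          push_cast
          ring_nf

/-- Deviations of order `n ^ (2/3)` are exponentially unlikely. -/
lemma prob_compensated_ge_le (h𝓕 : Monotone 𝓕) (h𝓕' : ∀ n, 𝓕 n ≤ mΩ)
    (hY : ∀ n, Measurable[𝓕 (n + 1)] (Y n)) (hq : ∀ n, Measurable[𝓕 n] (q n))
    (hY0 : ∀ n ω, 0 ≤ Y n ω) (hYB : ∀ n ω, Y n ω ≤ B) (hq0 : ∀ n ω, 0 ≤ q n ω)
    (hc : ∀ n, 1 ≤ n → CondLE (𝓕 n) P (Y n) (q n)) (hB : 1 ≤ B)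
    {s n : ℕ} (hs : 1 ≤ s) (hsn : s ≤ n) :
    P {ω | (n : ℝ) ^ (2 / 3 : ℝ) ≤ ∑ j ∈ Finset.Ico s n, (Y j ω - q j ω)} ≤
      ENNReal.ofReal (Real.exp (-(n : ℝ) ^ (1 / 3 : ℝ) / (4 * B ^ 2))) := by
  have hn : (1 : ℝ) ≤ n := by exact_mod_cast hs.trans hsn
  have hn0 : (0 : ℝ) < n := by linarith
  set t : ℝ := (n : ℝ) ^ (1 / 3 : ℝ) with ht
  have ht1 : 1 ≤ t := Real.one_le_rpow hn (by norm_num)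
  have ht0 : 0 < t := by linarith
  have ht2 : (n : ℝ) ^ (2 / 3 : ℝ) = t ^ 2 := by
    rw [ht, ← Real.rpow_natCast, ← Real.rpow_mul hn0.le]; norm_num
  have ht3 : (n : ℝ) = t ^ 3 := by
    rw [ht, ← Real.rpow_natCast, ← Real.rpow_mul hn0.le]; norm_num
  have hB0 : 0 < B := by linarith
  -- minimizes `l ^ 2 * B ^ 2 * n - l * n ^ (2 / 3)`
  set l : ℝ := 1 / (2 * B ^ 2 * t) with hl
  have hl0 : 0 < l := by positivity
  have hlB : l * B ≤ 1 := by
    rw [hl, one_div, inv_mul_le_iff₀ (by positivity)]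
    nlinarith
  set R : Ω → ℝ := fun ω => ∑ j ∈ Finset.Ico s n, (Y j ω - q j ω) with hR
  have hRm : Measurable R := by
    refine Finset.measurable_sum _ fun j _ => ?_
    exact ((hY j).mono (h𝓕' _) le_rfl).sub ((hq j).mono (h𝓕' _) le_rfl)
  have h1 := lintegral_exp_compensated_le h𝓕 h𝓕' hY hq hY0 hYB hq0 hc hl0.le hlB hs hsn
  have h2 := meas_ge_le_lintegral_div (μ := P)
    (f := fun ω => ENNReal.ofReal (Real.exp (l * R ω)))
    (Real.measurable_exp.comp (hRm.const_mul l)).ennreal_ofReal.aemeasurable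
    (ε := ENNReal.ofReal (Real.exp (l * t ^ 2))) (by simp [Real.exp_pos]) ENNReal.ofReal_ne_top
  calc _ ≤ P {ω | ENNReal.ofReal (Real.exp (l * t ^ 2)) ≤ ENNReal.ofReal (Real.exp (l * R ω))} := by
        refine measure_mono fun ω hω => ?_
        rw [Set.mem_ofPred_eq, ht2] at hω
        exact ENNReal.ofReal_le_ofReal (Real.exp_le_exp.2 (mul_le_mul_of_nonneg_left hω hl0.le))
    _ ≤ _ := h2
    _ ≤ ENNReal.ofReal (Real.exp (l ^ 2 * B ^ 2 * (n - s : ℕ))) /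
        ENNReal.ofReal (Real.exp (l * t ^ 2)) := by gcongr
    _ = ENNReal.ofReal (Real.exp (l ^ 2 * B ^ 2 * (n - s : ℕ) - l * t ^ 2)) := by
        rw [← ENNReal.ofReal_div_of_pos (Real.exp_pos _), Real.exp_sub]
    _ ≤ _ := by
        refine ENNReal.ofReal_le_ofReal (Real.exp_le_exp.2 ?_)
        have h3 : ((n - s : ℕ) : ℝ) ≤ t ^ 3 := by
          rw [← ht3]; exact_mod_cast Nat.sub_le n s
        have h4 : l ^ 2 * B ^ 2 * (n - s : ℕ) ≤ l ^ 2 * B ^ 2 * t ^ 3 :=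
          mul_le_mul_of_nonneg_left h3 (by positivity)
        have h5 : l ^ 2 * B ^ 2 * t ^ 3 - l * t ^ 2 = -t / (4 * B ^ 2) := by
          rw [hl]; field_simp; ring
        linarith

lemma summable_pow_mul_exp (K κ : ℕ) {c : ℝ} (hc : 0 < c) :
    Summable fun n : ℕ => ((n : ℝ) + K) ^ κ * Real.exp (-(n : ℝ) ^ (1 / 3 : ℝ) / c) := by
  set m := 3 * (κ + 2) with hm
  have hs : Summable fun n : ℕ => (((1 : ℝ) + K) ^ κ * m.factorial * c ^ m) * ((n : ℝ) ^ 2)⁻¹ :=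
    (Real.summable_nat_pow_inv.2 (by norm_num)).mul_left _
  refine Summable.of_norm_bounded_eventually_nat hs ?_
  filter_upwards [Filter.eventually_ge_atTop 1] with n hn
  have hn1 : (1 : ℝ) ≤ n := by exact_mod_cast hn
  have hn0 : (0 : ℝ) < n := by linarith
  set t : ℝ := (n : ℝ) ^ (1 / 3 : ℝ) with ht
  have ht0 : 0 < t := Real.rpow_pos_of_pos hn0 _
  have ht3 : t ^ 3 = (n : ℝ) := by
    rw [ht, ← Real.rpow_natCast, ← Real.rpow_mul hn0.le]; norm_num
  rw [Real.norm_of_nonneg (by positivity)]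
  have h1 := Real.pow_div_factorial_le_exp (t / c) (by positivity) m
  have h2 : Real.exp (-t / c) ≤ m.factorial * c ^ m / (n : ℝ) ^ (κ + 2) := by
    rw [neg_div, Real.exp_neg]
    have h3 : (t / c) ^ m / m.factorial = (n : ℝ) ^ (κ + 2) / (m.factorial * c ^ m) := by
      rw [div_pow, hm, pow_mul, ht3]; field_simp
    rw [h3] at h1
    exact (inv_anti₀ (by positivity) h1).trans_eq (inv_div _ _)
  have h4 : ((n : ℝ) + K) ^ κ ≤ ((1 : ℝ) + K) ^ κ * (n : ℝ) ^ κ := by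
    rw [← mul_pow]
    refine pow_le_pow_left₀ (by positivity) ?_ κ
    have : (K : ℝ) ≤ K * n := le_mul_of_one_le_right (Nat.cast_nonneg K) hn1
    nlinarith
  calc _ ≤ (((1 : ℝ) + K) ^ κ * (n : ℝ) ^ κ) * (m.factorial * c ^ m / (n : ℝ) ^ (κ + 2)) := by
        gcongr
    _ = _ := by rw [pow_add]; field_simp

/-- Almost surely, the compensated sums over all late intervals are uniformly small, for a
polynomially growing family of processes. -/
lemma ae_eventually_compensated_lt {ι : Type*} {Y q : ι → ℕ → Ω → ℝ} (I : ℕ → Finset ι)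
    {K κ : ℕ} (hI : ∀ n, (I n).card ≤ (n + K) ^ κ) (h𝓕 : Monotone 𝓕) (h𝓕' : ∀ n, 𝓕 n ≤ mΩ)
    (hY : ∀ V n, Measurable[𝓕 (n + 1)] (Y V n)) (hq : ∀ V n, Measurable[𝓕 n] (q V n))
    (hY0 : ∀ V n ω, 0 ≤ Y V n ω) (hYB : ∀ m, ∀ V ∈ I m, ∀ n ω, Y V n ω ≤ B)
    (hq0 : ∀ V n ω, 0 ≤ q V n ω)
    (hc : ∀ V n, 1 ≤ n → CondLE (𝓕 n) P (Y V n) (q V n)) (hB : 1 ≤ B) :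
    ∀ᵐ ω ∂P, ∀ᶠ n : ℕ in atTop, ∀ V ∈ I n, ∀ s, 1 ≤ s → s ≤ n →
      ∑ j ∈ Finset.Ico s n, (Y V j ω - q V j ω) < (n : ℝ) ^ (2 / 3 : ℝ) := by
  set bad : ℕ → Set Ω := fun n => ⋃ V ∈ I n, ⋃ s ∈ Finset.Icc 1 n,
    {ω | (n : ℝ) ^ (2 / 3 : ℝ) ≤ ∑ j ∈ Finset.Ico s n, (Y V j ω - q V j ω)} with hbad
  have hP : ∀ n, P (bad n) ≤ ENNReal.ofReal (((n : ℝ) + K) ^ (κ + 1) *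
      Real.exp (-(n : ℝ) ^ (1 / 3 : ℝ) / (4 * B ^ 2))) := by
    intro n
    have h1 : P (bad n) ≤ ∑ V ∈ I n, ∑ s ∈ Finset.Icc 1 n,
        ENNReal.ofReal (Real.exp (-(n : ℝ) ^ (1 / 3 : ℝ) / (4 * B ^ 2))) := by
      refine (measure_biUnion_finset_le _ _).trans (Finset.sum_le_sum fun V hV => ?_)
      refine (measure_biUnion_finset_le _ _).trans (Finset.sum_le_sum fun s hs => ?_)
      rw [Finset.mem_Icc] at hs
      exact prob_compensated_ge_le h𝓕 h𝓕' (hY V) (hq V) (hY0 V) (hYB n V hV) (hq0 V) (hc V) hB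
        hs.1 hs.2
    refine h1.trans ?_
    simp only [Finset.sum_const, Nat.card_Icc, Nat.add_sub_cancel, nsmul_eq_mul]
    rw [ENNReal.ofReal_mul (by positivity), ← mul_assoc]
    gcongr
    rw [pow_succ, ENNReal.ofReal_mul (by positivity)]
    have h2 : (((n : ℝ) + K)) = ((n + K : ℕ) : ℝ) := by push_cast; ring
    rw [h2, ← Nat.cast_pow, ENNReal.ofReal_natCast, ENNReal.ofReal_natCast]
    gcongr
    · exact_mod_cast hI n
    · exact Nat.le_add_right n K
  have hsum : ∑' n, P (bad n) ≠ ⊤ := by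
    refine ne_top_of_le_ne_top ?_ (ENNReal.tsum_le_tsum hP)
    exact (summable_pow_mul_exp K (κ + 1) (by positivity)).tsum_ofReal_ne_top
  filter_upwards [ae_eventually_notMem hsum] with ω hω
  filter_upwards [hω] with n hn V hV s hs hsn
  simp only [hbad, Set.mem_iUnion, not_exists, Finset.mem_Icc] at hn
  exact not_le.1 (hn V hV s ⟨hs, hsn⟩)

end Concentration

/-! ### Polynomial growth from a positive drift -/

section Growth

lemma add_one_rpow_le {γ : ℝ} (hγ0 : 0 ≤ γ) (hγ1 : γ ≤ 1) {n : ℕ} (hn : 1 ≤ n) :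
    ((n + 1 : ℕ) : ℝ) ^ γ ≤ (n : ℝ) ^ γ * (1 + γ / n) := by
  have hn0 : (0 : ℝ) < n := by exact_mod_cast hn
  have h1 : ((n + 1 : ℕ) : ℝ) = n * (1 + 1 / n) := by push_cast; field_simp
  have h2 := rpow_one_add_le_one_add_mul_self (s := 1 / (n : ℝ)) (p := γ)
    (by have : (0 : ℝ) ≤ 1 / n := by positivity
        linarith) hγ0 hγ1
  rw [h1, Real.mul_rpow hn0.le (by positivity)]
  refine mul_le_mul_of_nonneg_left (h2.trans_eq ?_) (by positivity)
  ring

variable {Ω : Type*} {mΩ : MeasurableSpace Ω} {P : Measure Ω} [IsProbabilityMeasure P]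
  {𝓕 : ℕ → MeasurableSpace Ω} {M q : ℕ → Ω → ℝ}

open Classical in
/-- One step of the bound for `𝔼 (n ^ γ / M n)` on the event that the drift of `M` has been large.
-/
lemma lintegral_rpow_div_succ_le (h𝓕 : ∀ n, 𝓕 n ≤ mΩ)
    (hM : ∀ n, Measurable[𝓕 n] (M n)) (hq : ∀ n, Measurable[𝓕 n] (q n))
    (hmono : ∀ n ω, M n ω ≤ M (n + 1) ω) (hstep : ∀ n ω, M (n + 1) ω ≤ M n ω + 2)
    (hc : ∀ n, 1 ≤ n → CondLE (𝓕 n) P (fun ω => 2 - (M (n + 1) ω - M n ω)) (fun ω => 2 - q n ω))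
    (hq2 : ∀ n ω, q n ω ≤ 2)
    {γ δ : ℝ} (hγ0 : 0 < γ) (hγ1 : γ ≤ 1) (hδ : 0 < δ) {n : ℕ} (hn : 1 ≤ n)
    {B B' : Set Ω} (hB : MeasurableSet[𝓕 n] B) (hBB : B' ⊆ B)
    (hB1 : ∀ ω ∈ B, 1 ≤ M n ω ∧ (M n ω ≤ δ * n → γ * (M n ω + 2) / n ≤ q n ω)) :
    ∫⁻ ω, ENNReal.ofReal (if ω ∈ B' then ((n + 1 : ℕ) : ℝ) ^ γ / M (n + 1) ω else 0) ∂P ≤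
      ∫⁻ ω, ENNReal.ofReal (if ω ∈ B then (n : ℝ) ^ γ / M n ω else 0) ∂P +
        ENNReal.ofReal (γ / δ * (n : ℝ) ^ (γ - 2)) := by
  have hn0 : (0 : ℝ) < n := by exact_mod_cast hn
  set g : ℝ := (n : ℝ) ^ γ with hg
  set g' : ℝ := ((n + 1 : ℕ) : ℝ) ^ γ with hg'
  have hg0 : 0 < g := Real.rpow_pos_of_pos hn0 _
  have hg'0 : 0 < g' := Real.rpow_pos_of_pos (by positivity) _
  have hgg : g' ≤ g * (1 + γ / n) := add_one_rpow_le hγ0.le hγ1 hn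
  set A : Set Ω := B ∩ {ω | M n ω ≤ δ * n} with hA
  have hAm : MeasurableSet[𝓕 n] A := hB.inter ((hM n) measurableSet_Iic)
  set u : Ω → ENNReal := fun ω => if ω ∈ A then ENNReal.ofReal (g' / (M n ω + 2)) else
    if ω ∈ B then ENNReal.ofReal (g' / M n ω) else 0 with hu
  set Φ : Ω → ENNReal := fun ω => if ω ∈ A then ENNReal.ofReal (g' / (M n ω * (M n ω + 2))) else 0
    with hΦ
  have hum : Measurable[𝓕 n] u := by
    refine Measurable.ite hAm ?_ (Measurable.ite hB ?_ measurable_const)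
    · exact (((hM n).add_const 2).const_div g').ennreal_ofReal
    · exact ((hM n).const_div g').ennreal_ofReal
  have hΦm : Measurable[𝓕 n] Φ := by
    refine Measurable.ite hAm ?_ measurable_const
    exact (((hM n).mul ((hM n).add_const 2)).const_div g').ennreal_ofReal
  have hMm : ∀ n, Measurable (M n) := fun n => (hM n).mono (h𝓕 n) le_rfl
  calc ∫⁻ ω, ENNReal.ofReal (if ω ∈ B' then g' / M (n + 1) ω else 0) ∂P
      ≤ ∫⁻ ω, (u ω + Φ ω * ENNReal.ofReal (2 - (M (n + 1) ω - M n ω))) ∂P := by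
        refine lintegral_mono fun ω => ?_
        by_cases hω' : ω ∈ B'
        swap
        · simp [hω']
        have hω : ω ∈ B := hBB hω'
        obtain ⟨h1, -⟩ := hB1 ω hω
        have hm := hmono n ω
        have hs := hstep n ω
        simp only [hω', if_true]
        by_cases hωA : ω ∈ A
        · simp only [hu, hΦ, hωA, if_true]
          rw [← ENNReal.ofReal_mul (by positivity), ← ENNReal.ofReal_add (by positivity)
            (mul_nonneg (by positivity) (by linarith))]
          refine ENNReal.ofReal_le_ofReal ?_
          -- convexity of `1 / x` on `[M, M + 2]`
          have h3 : g' / (M n ω + 2) + g' / (M n ω * (M n ω + 2)) * (2 - (M (n + 1) ω - M n ω)) =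
              g' * (2 * M n ω + 2 - M (n + 1) ω) / (M n ω * (M n ω + 2)) := by
            field_simp; ring
          rw [h3, div_le_div_iff₀ (by linarith) (by positivity), mul_assoc]
          refine mul_le_mul_of_nonneg_left ?_ hg'0.le
          nlinarith [mul_nonneg (sub_nonneg.2 hm) (sub_nonneg.2 hs)]
        · simp only [hu, hΦ, hωA, hω, if_true, if_false, zero_mul, add_zero]
          exact ENNReal.ofReal_le_ofReal (div_le_div_of_nonneg_left hg'0.le (by linarith) hm)
    _ = ∫⁻ ω, u ω ∂P + ∫⁻ ω, Φ ω * ENNReal.ofReal (2 - (M (n + 1) ω - M n ω)) ∂P :=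
        lintegral_add_left (hum.mono (h𝓕 n) le_rfl) _
    _ ≤ ∫⁻ ω, u ω ∂P + ∫⁻ ω, Φ ω * ENNReal.ofReal (2 - q n ω) ∂P := by
        gcongr 1
        exact (hc n hn).lintegral_mul_le (h𝓕 n) (((hMm _).sub (hMm _)).const_sub 2)
          (((hq n).mono (h𝓕 n) le_rfl).const_sub 2) hΦm
    _ = ∫⁻ ω, (u ω + Φ ω * ENNReal.ofReal (2 - q n ω)) ∂P :=
        (lintegral_add_left (hum.mono (h𝓕 n) le_rfl) _).symm
    _ ≤ ∫⁻ ω, (ENNReal.ofReal (if ω ∈ B then g / M n ω else 0) +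
          ENNReal.ofReal (γ / δ * (n : ℝ) ^ (γ - 2))) ∂P := by
        refine lintegral_mono fun ω => ?_
        by_cases hω : ω ∈ B
        swap
        · have hωA : ω ∉ A := fun h => hω h.1
          simp [hu, hΦ, hω, hωA]
        obtain ⟨h1, h2⟩ := hB1 ω hω
        by_cases hωA : ω ∈ A
        · refine le_trans ?_ le_self_add
          simp only [hu, hΦ, hωA, hω, if_true]
          rw [← ENNReal.ofReal_mul (by positivity), ← ENNReal.ofReal_add (by positivity)
            (mul_nonneg (by positivity) (by linarith [hq2 n ω]))]
          refine ENNReal.ofReal_le_ofReal ?_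
          have h3 : g' / (M n ω + 2) + g' / (M n ω * (M n ω + 2)) * (2 - q n ω) =
              g' * ((M n ω + 2) - q n ω) / (M n ω * (M n ω + 2)) := by
            field_simp; ring
          rw [h3, div_le_div_iff₀ (by positivity) (by linarith)]
          have h4 := h2 hωA.2
          have h5 : g' * ((M n ω + 2) - q n ω) ≤ g * (1 + γ / n) * ((M n ω + 2) * (1 - γ / n)) := by
            have h6 : (M n ω + 2) - q n ω ≤ (M n ω + 2) * (1 - γ / n) := by
              have : γ * (M n ω + 2) / n = (M n ω + 2) * (γ / n) := by ring
              linarith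
            exact mul_le_mul hgg h6 (by linarith [hq2 n ω]) (by positivity)
          have h7 : g * (1 + γ / n) * ((M n ω + 2) * (1 - γ / n)) ≤ g * (M n ω + 2) := by
            have : g * (1 + γ / n) * ((M n ω + 2) * (1 - γ / n)) =
              g * (M n ω + 2) - g * (M n ω + 2) * (γ / n) ^ 2 := by ring
            rw [this]
            have : 0 ≤ g * (M n ω + 2) * (γ / n) ^ 2 := by positivity
            linarith
          calc _ ≤ g * (M n ω + 2) * M n ω := by
                refine mul_le_mul_of_nonneg_right (h5.trans h7) (by linarith)
            _ = _ := by ring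
        · have h3 : δ * n < M n ω := not_le.1 fun h => hωA ⟨hω, h⟩
          simp only [hu, hΦ, hωA, hω, if_true, if_false, zero_mul, add_zero]
          rw [← ENNReal.ofReal_add (by positivity) (by positivity)]
          refine ENNReal.ofReal_le_ofReal ?_
          have h4 : γ / δ * (n : ℝ) ^ (γ - 2) = g * (γ / n) / (δ * n) := by
            rw [Real.rpow_sub hn0, ← hg, Real.rpow_two]; field_simp
          rw [h4]
          calc g' / M n ω ≤ g * (1 + γ / n) / M n ω := by gcongr
            _ = g / M n ω + g * (γ / n) / M n ω := by ring
            _ ≤ _ := by gcongr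
    _ = _ := by
        rw [lintegral_add_right _ measurable_const, lintegral_const, measure_univ, mul_one]

open Classical in
/-- A process with increments in `[0, 2]` grows at least like `n ^ γ` if its expected increment is
eventually at least `γ * M n / n` as long as `M n` is small compared to `n`. -/
lemma ae_eventually_rpow_le (h𝓕 : Monotone 𝓕) (h𝓕' : ∀ n, 𝓕 n ≤ mΩ)
    (hM : ∀ n, Measurable[𝓕 n] (M n)) (hq : ∀ n, Measurable[𝓕 n] (q n))
    (hmono : ∀ n ω, M n ω ≤ M (n + 1) ω) (hstep : ∀ n ω, M (n + 1) ω ≤ M n ω + 2)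
    (hc : ∀ n, 1 ≤ n → CondLE (𝓕 n) P (fun ω => 2 - (M (n + 1) ω - M n ω)) (fun ω => 2 - q n ω))
    (hq2 : ∀ n ω, q n ω ≤ 2)
    {γ γ' δ : ℝ} (hγ'0 : 0 < γ') (hγ' : γ' < γ) (hγ1 : γ < 1) (hδ : 0 < δ) :
    ∀ᵐ ω ∂P, (∀ᶠ n : ℕ in atTop, 1 ≤ M n ω ∧ (M n ω ≤ δ * n → γ * (M n ω + 2) / n ≤ q n ω)) →
      ∀ᶠ n : ℕ in atTop, (n : ℝ) ^ γ' ≤ M n ω := by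
  have hγ0 : 0 < γ := hγ'0.trans hγ'
  set good : ℕ → Set Ω := fun n =>
    {ω | 1 ≤ M n ω ∧ (M n ω ≤ δ * n → γ * (M n ω + 2) / n ≤ q n ω)} with hgood
  have hgm : ∀ n, MeasurableSet[𝓕 n] (good n) := by
    intro n
    have e : good n = {ω | 1 ≤ M n ω} ∩ ({ω | M n ω ≤ δ * n}ᶜ ∪
        {ω | γ * (M n ω + 2) / n ≤ q n ω}) := by
      ext ω
      simp only [hgood, Set.mem_ofPred_eq, Set.mem_inter_iff, Set.mem_union, Set.mem_compl_iff,
        imp_iff_not_or]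
    rw [e]
    refine MeasurableSet.inter ((hM n) measurableSet_Ici) (MeasurableSet.union ?_ ?_)
    · exact ((hM n) measurableSet_Iic).compl
    · exact measurableSet_le ((((hM n).add_const 2).const_mul γ).div_const _) (hq n)
  set B : ℕ → ℕ → Set Ω := fun N n => ⋂ i ∈ Finset.Icc N n, good i with hBdef
  have hBm : ∀ N n, MeasurableSet[𝓕 n] (B N n) := fun N n =>
    Finset.measurableSet_biInter _ fun i hi => h𝓕 (Finset.mem_Icc.1 hi).2 _ (hgm i)
  have hBmono : ∀ N n, B N (n + 1) ⊆ B N n := fun N n =>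
    Set.biInter_subset_biInter_left fun i hi => by
      have hi' := Finset.mem_Icc.1 hi
      exact Finset.mem_coe.2 (Finset.mem_Icc.2 ⟨hi'.1, hi'.2.trans n.le_succ⟩)
  have hBgood : ∀ {N n}, N ≤ n → B N n ⊆ good n := fun {N n} h =>
    Set.biInter_subset_of_mem (Finset.mem_coe.2 (Finset.mem_Icc.2 ⟨h, le_rfl⟩))
  -- `𝔼 (n ^ γ / M n)` is bounded in `n`, restricted to the event that the drift was large from time
  -- `N` on
  have hE : ∀ N, 1 ≤ N → ∃ C : ℝ, 0 ≤ C ∧ ∀ n, N ≤ n →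
      ∫⁻ ω, ENNReal.ofReal (if ω ∈ B N n then (n : ℝ) ^ γ / M n ω else 0) ∂P ≤
        ENNReal.ofReal C := by
    intro N hN
    have hs : Summable fun j : ℕ => γ / δ * (j : ℝ) ^ (γ - 2) :=
      (Real.summable_nat_rpow.2 (by linarith)).mul_left _
    have h0 : ∀ j : ℕ, 0 ≤ γ / δ * (j : ℝ) ^ (γ - 2) := fun j => by positivity
    have h1 : ∀ n, N ≤ n → ∫⁻ ω, ENNReal.ofReal (if ω ∈ B N n then (n : ℝ) ^ γ / M n ω else 0) ∂P ≤
        ENNReal.ofReal ((N : ℝ) ^ γ + ∑ j ∈ Finset.Ico N n, γ / δ * (j : ℝ) ^ (γ - 2)) := by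
      intro n hn
      induction n, hn using Nat.le_induction with
      | base =>
        calc _ ≤ ∫⁻ _, ENNReal.ofReal ((N : ℝ) ^ γ) ∂P := by
              refine lintegral_mono fun ω => ENNReal.ofReal_le_ofReal ?_
              split_ifs with hω
              · exact div_le_self (by positivity) (hBgood le_rfl hω).1
              · positivity
          _ = _ := by simp
      | succ n hn ih =>
        have h2 := lintegral_rpow_div_succ_le h𝓕' hM hq hmono hstep hc hq2 hγ0 hγ1.le hδ
          (hN.trans hn) (hBm N n) (hBmono N n) fun ω hω => hBgood hn hω
        refine h2.trans ((add_le_add_left ih _).trans_eq ?_)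
        rw [← ENNReal.ofReal_add (add_nonneg (by positivity) (Finset.sum_nonneg fun j _ => h0 j))
          (h0 n), Finset.sum_Ico_succ_top hn, add_assoc]
    refine ⟨(N : ℝ) ^ γ + ∑' j : ℕ, γ / δ * (j : ℝ) ^ (γ - 2),
      add_nonneg (by positivity) (tsum_nonneg h0), fun n hn => (h1 n hn).trans ?_⟩
    exact ENNReal.ofReal_le_ofReal (add_le_add_right (hs.sum_le_tsum _ fun j _ => h0 j) _)
  -- by Markov, `M n < 2 * n ^ γ'` is summably unlikely along powers of two; monotonicity of `M`
  -- covers the times in between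
  have hkey : ∀ N, 1 ≤ N → ∀ᵐ ω ∂P, (∀ i, N ≤ i → ω ∈ good i) →
      ∀ᶠ n : ℕ in atTop, (n : ℝ) ^ γ' ≤ M n ω := by
    intro N hN
    obtain ⟨C, hC0, hC⟩ := hE N hN
    set r : ℝ := (2 : ℝ) ^ (γ' - γ) with hr
    have hr1 : r < 1 := Real.rpow_lt_one_of_one_lt_of_neg (by norm_num) (by linarith)
    have hr0 : 0 < r := by positivity
    set bad : ℕ → Set Ω := fun j => {ω | N ≤ 2 ^ j ∧ ω ∈ B N (2 ^ j) ∧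
      M (2 ^ j) ω < 2 * ((2 ^ j : ℕ) : ℝ) ^ γ'} with hbad
    have hPb : ∀ j, P (bad j) ≤ ENNReal.ofReal (2 * C * r ^ j) := by
      intro j
      by_cases hj : N ≤ 2 ^ j
      swap
      · have : bad j = ∅ := by ext; simp [hbad, hj]
        rw [this, measure_empty]; exact zero_le
      set n : ℕ := 2 ^ j with hn
      have hn0 : (0 : ℝ) < n := by positivity
      have hrj : r ^ j = (n : ℝ) ^ γ' / (n : ℝ) ^ γ := by
        rw [← Real.rpow_sub hn0, hr, hn, ← Real.rpow_natCast, ← Real.rpow_mul (by norm_num),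
          Nat.cast_pow, ← Real.rpow_natCast, ← Real.rpow_mul (by norm_num), mul_comm]
        norm_num
      have hfm : Measurable fun ω =>
          ENNReal.ofReal (if ω ∈ B N n then (n : ℝ) ^ γ / M n ω else 0) := by
        refine (Measurable.ite (h𝓕' n _ (hBm N n)) ?_ measurable_const).ennreal_ofReal
        exact ((hM n).mono (h𝓕' n) le_rfl).const_div _
      have hpos : 0 < 1 / (2 * r ^ j) := by positivity
      have h3 := meas_ge_le_lintegral_div (μ := P) hfm.aemeasurable
        (ε := ENNReal.ofReal (1 / (2 * r ^ j))) (by simpa using hpos) ENNReal.ofReal_ne_top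
      calc P (bad j) ≤ P {ω | ENNReal.ofReal (1 / (2 * r ^ j)) ≤
            ENNReal.ofReal (if ω ∈ B N n then (n : ℝ) ^ γ / M n ω else 0)} := by
            refine measure_mono fun ω hω => ?_
            obtain ⟨-, h4, h5⟩ := hω
            rw [Set.mem_ofPred_eq, if_pos (show ω ∈ B N n from h4)]
            refine ENNReal.ofReal_le_ofReal ?_
            have h6 : 1 ≤ M n ω := (hBgood hj h4).1
            rw [hrj, div_le_div_iff₀ (by positivity) (by linarith), one_mul]
            have h7 : (n : ℝ) ^ γ * (2 * ((n : ℝ) ^ γ' / (n : ℝ) ^ γ)) = 2 * (n : ℝ) ^ γ' := by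
              have : (n : ℝ) ^ γ ≠ 0 := (Real.rpow_pos_of_pos hn0 _).ne'
              field_simp
            rw [h7]
            exact h5.le
        _ ≤ _ := h3
        _ ≤ ENNReal.ofReal C / ENNReal.ofReal (1 / (2 * r ^ j)) := by
            gcongr
            exact hC n hj
        _ = _ := by
            rw [← ENNReal.ofReal_div_of_pos hpos]
            congr 1
            field_simp
    have hsum : ∑' j, P (bad j) ≠ ⊤ :=
      ne_top_of_le_ne_top ((summable_geometric_of_lt_one hr0.le hr1).mul_left
        (2 * C)).tsum_ofReal_ne_top (ENNReal.tsum_le_tsum hPb)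
    filter_upwards [ae_eventually_notMem hsum] with ω hω hg
    obtain ⟨J, hJ⟩ := Filter.eventually_atTop.1 hω
    have hMmono : Monotone fun n => M n ω := monotone_nat_of_le_succ fun n => hmono n ω
    filter_upwards [Filter.eventually_ge_atTop (max 1 (2 ^ (max J N)))] with n hn
    have hn1 : 1 ≤ n := (le_max_left _ _).trans hn
    set j := Nat.log 2 n with hj
    have hj1 : 2 ^ j ≤ n := Nat.pow_log_le_self 2 (by omega)
    have hj2 : n < 2 ^ (j + 1) := Nat.lt_pow_succ_log_self (by norm_num) n
    have hjJ : max J N ≤ j := by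
      have h := (le_max_right _ _).trans hn
      exact (Nat.le_log_iff_pow_le (by norm_num) (by omega)).2 h
    have hNj : N ≤ 2 ^ j := ((le_max_right J N).trans hjJ).trans Nat.lt_two_pow_self.le
    have h1 := hJ j ((le_max_left J N).trans hjJ)
    have h2 : 2 * ((2 ^ j : ℕ) : ℝ) ^ γ' ≤ M (2 ^ j) ω := by
      by_contra h
      refine h1 ⟨hNj, ?_, not_le.1 h⟩
      simp only [hBdef, Set.mem_iInter]
      intro i hi
      exact hg i (Finset.mem_Icc.1 hi).1
    refine le_trans ?_ (h2.trans (hMmono hj1))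
    have h3 : (n : ℝ) ≤ 2 * ((2 ^ j : ℕ) : ℝ) := by
      have : n ≤ 2 * 2 ^ j := by rw [pow_succ] at hj2; omega
      exact_mod_cast this
    calc (n : ℝ) ^ γ' ≤ (2 * ((2 ^ j : ℕ) : ℝ)) ^ γ' :=
          Real.rpow_le_rpow (by positivity) h3 hγ'0.le
      _ = 2 ^ γ' * ((2 ^ j : ℕ) : ℝ) ^ γ' := Real.mul_rpow (by norm_num) (by positivity)
      _ ≤ 2 * ((2 ^ j : ℕ) : ℝ) ^ γ' := by
          gcongr
          calc (2 : ℝ) ^ γ' ≤ 2 ^ (1 : ℝ) :=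
                Real.rpow_le_rpow_of_exponent_le (by norm_num) (by linarith)
            _ = 2 := Real.rpow_one 2
  have hall : ∀ᵐ ω ∂P, ∀ N : ℕ, 1 ≤ N → (∀ i, N ≤ i → ω ∈ good i) →
      ∀ᶠ n : ℕ in atTop, (n : ℝ) ^ γ' ≤ M n ω :=
    ae_all_iff.2 fun N => ae_all_iff.2 fun hN => hkey N hN
  filter_upwards [hall] with ω hω hev
  obtain ⟨N, hN⟩ := Filter.eventually_atTop.1 hev
  exact hω (max 1 N) (le_max_left _ _) fun i hi => hN i ((le_max_right _ _).trans hi)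

end Growth

/-! ### The degrees follow their drifts -/

namespace Model

variable (mdl : Model)

lemma driftUp_nonneg (ξ : Noise) (k n : ℕ) : 0 ≤ mdl.driftUp ξ k n := by
  have ha := mdl.a_pos
  have hb := mdl.b_pos
  have h1 : 0 ≤ ∑ i ∈ Finset.Icc 1 k, mdl.topHit ξ n i * mdl.Qt i (mdl.topHit ξ n) :=
    Finset.sum_nonneg fun i _ => mul_nonneg (mdl.topHit_mem ξ n i).1
      (mdl.Qt_nonneg fun j _ => mdl.topHit_mem ξ n j)
  rw [driftUp]
  positivity

lemma driftLow_le_two (ξ : Noise) (k n : ℕ) : mdl.driftLow ξ k n ≤ 2 := by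
  rw [driftLow]
  split_ifs with h
  · have h1 := mdl.topHit_mem ξ n k
    have h2 := mdl.Qt_le_one (i := k) fun j _ => mdl.topHit_mem ξ n j
    have h3 : (0 : ℝ) ≤ (1 + (k - 1 : ℕ) * mdl.d * (mdl.M + 1)) / n := by positivity
    have h4 := min_le_left 1 ((mdl.a * mdl.maxDeg ξ k n + mdl.b) / (n : ℝ))
    have h5 : mdl.topHit ξ n k * (mdl.Qt k (mdl.topHit ξ n) -
        (1 + (k - 1 : ℕ) * mdl.d * (mdl.M + 1)) / n) ≤ 1 * 1 :=
      (mul_le_mul_of_nonneg_left (by linarith) h1.1).trans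
        (mul_le_mul_of_nonneg_right h1.2 zero_le_one)
    linarith
  · norm_num

variable {Ω : Type*} (ξ : Ω → Noise)

lemma measurable_of_graph_congr {n : ℕ} {G : Noise → ℝ}
    (hG : ∀ ζ ζ', mdl.graph ζ n = mdl.graph ζ' n → G ζ = G ζ') :
    Measurable[mdl.filt ξ n] fun ω => G (ξ ω) := by
  intro s _
  have h : (fun ω => G (ξ ω)) ⁻¹' s =
      {ω | ∃ ζ, mdl.graph ζ n = mdl.graph (ξ ω) n ∧ G ζ ∈ s} := by
    ext ω
    refine ⟨fun h => ⟨ξ ω, rfl, h⟩, ?_⟩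
    rintro ⟨ζ, h1, h2⟩
    rw [Set.mem_preimage, ← hG _ _ h1]
    exact h2
  rw [h]
  exact (mdl.dmeas_graph_filt ξ n).measurableSet fun E => ∃ ζ, mdl.graph ζ n = E ∧ G ζ ∈ s

lemma measurable_maxDeg (k n : ℕ) :
    Measurable[mdl.filt ξ n] fun ω => (mdl.maxDeg (ξ ω) k n : ℝ) :=
  mdl.measurable_of_graph_congr ξ (G := fun ζ => (mdl.maxDeg ζ k n : ℝ)) fun ζ ζ' h => by
    rw [mdl.maxDeg_congr h]

lemma measurable_deg (n v : ℕ) :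
    Measurable[mdl.filt ξ n] fun ω => (mdl.deg (ξ ω) n v : ℝ) :=
  mdl.measurable_of_graph_congr ξ (G := fun ζ => (mdl.deg ζ n v : ℝ)) fun ζ ζ' h => by
    rw [mdl.deg_congr h]

lemma measurable_driftUp (k n : ℕ) :
    Measurable[mdl.filt ξ n] fun ω => mdl.driftUp (ξ ω) k n :=
  mdl.measurable_of_graph_congr ξ (G := fun ζ => mdl.driftUp ζ k n) fun _ _ h =>
    mdl.driftUp_congr h k

lemma measurable_driftLow (k n : ℕ) :
    Measurable[mdl.filt ξ n] fun ω => mdl.driftLow (ξ ω) k n :=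
  mdl.measurable_of_graph_congr ξ (G := fun ζ => mdl.driftLow ζ k n) fun _ _ h =>
    mdl.driftLow_congr h k

end Model

namespace IsNoise

variable {Ω : Type*} {mΩ : MeasurableSpace Ω} {P : Measure Ω} [IsProbabilityMeasure P]
  {mdl : Model} {ξ : Ω → Noise} (hξ : IsNoise mdl P ξ)

include hξ

/-- The sum of the `k` highest degrees follows its drift from above, up to an error of lower order.
Concentration is used simultaneously for all sets of `k` vertices present at time `n`, of which
there are polynomially many; one of them attains the sum at time `n`. -/
lemma ae_topSum_le (k : ℕ) : ∀ᵐ ω ∂P, ∀ᶠ n : ℕ in atTop, ∀ s, 1 ≤ s → s ≤ n →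
    (mdl.topSum (ξ ω) k n : ℝ) ≤ mdl.topSum (ξ ω) k s +
      ∑ j ∈ Finset.Ico s n, mdl.driftUp (ξ ω) k j + (n : ℝ) ^ (2 / 3 : ℝ) := by
  have key := ae_eventually_compensated_lt (P := P) (𝓕 := mdl.filt ξ) (B := 2 * k + 1)
    (Y := fun (V : Finset ℕ) n ω => ∑ v ∈ V, ((mdl.deg (ξ ω) (n + 1) v : ℝ) - mdl.deg (ξ ω) n v))
    (q := fun V n ω => mdl.driftUp (ξ ω) V.card n)
    (fun n => Finset.powersetCard k (Finset.range (mdl.n₀ + n))) (K := mdl.n₀) (κ := k)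
    (fun n => by
      rw [Finset.card_powersetCard, Finset.card_range, add_comm]
      exact Nat.choose_le_pow _ _)
    (mdl.filt_mono ξ) hξ.filt_le
    (fun V n => Finset.measurable_sum _ fun v _ => (mdl.measurable_deg ξ (n + 1) v).sub
      ((mdl.measurable_deg ξ n v).mono (mdl.filt_mono ξ n.le_succ) le_rfl))
    (fun V n => mdl.measurable_driftUp ξ V.card n)
    (fun V n ω => Finset.sum_nonneg fun v _ => by
      rw [sub_nonneg, Nat.cast_le]
      exact mdl.deg_mono (ξ ω) v n.le_succ)
    (fun m V hV n ω => by
      have h1 : ∀ v ∈ V, ((mdl.deg (ξ ω) (n + 1) v : ℝ) - mdl.deg (ξ ω) n v) ≤ 2 := fun v _ => by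
        have : (mdl.deg (ξ ω) (n + 1) v : ℝ) ≤ mdl.deg (ξ ω) n v + 2 := by
          exact_mod_cast mdl.deg_succ_le (ξ ω) n v
        linarith
      have h2 := Finset.sum_le_card_nsmul V _ 2 h1
      rw [(Finset.mem_powersetCard.1 hV).2, nsmul_eq_mul] at h2
      linarith)
    (fun V n ω => mdl.driftUp_nonneg (ξ ω) _ n)
    (fun V n hn => hξ.condLE_driftUp hn V)
    (by have : (0 : ℝ) ≤ k := Nat.cast_nonneg k
        linarith)
  filter_upwards [key] with ω hω
  filter_upwards [hω, Filter.eventually_ge_atTop k] with n hn hk s hs hsn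
  obtain ⟨V, hV, hVc, hVs⟩ := mdl.exists_sum_deg_eq_topSum (ξ ω) n (k := k) (by omega)
  have h1 := hn V (Finset.mem_powersetCard.2 ⟨hV, hVc⟩) s hs hsn
  rw [Finset.sum_sub_distrib, Finset.sum_comm] at h1
  have h2 : ∀ v, ∑ j ∈ Finset.Ico s n, ((mdl.deg (ξ ω) (j + 1) v : ℝ) - mdl.deg (ξ ω) j v) =
      mdl.deg (ξ ω) n v - mdl.deg (ξ ω) s v := fun v =>
    Finset.sum_Ico_sub (fun j => (mdl.deg (ξ ω) j v : ℝ)) hsn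
  simp only [h2, Finset.sum_sub_distrib, hVc] at h1
  have h3 : (∑ v ∈ V, (mdl.deg (ξ ω) n v : ℝ)) = mdl.topSum (ξ ω) k n := by
    rw [← hVs]; push_cast; rfl
  have h4 : (∑ v ∈ V, (mdl.deg (ξ ω) s v : ℝ)) ≤ mdl.topSum (ξ ω) k s := by
    rw [← Nat.cast_sum]
    exact_mod_cast hVc ▸ mdl.sum_deg_le_topSum (ξ ω) s V
  linarith

/-- The `k`-th highest degree follows its drift from below, up to an error of lower order. -/
lemma ae_le_maxDeg {k : ℕ} (hk : 1 ≤ k) : ∀ᵐ ω ∂P, ∀ᶠ n : ℕ in atTop, ∀ s, 1 ≤ s → s ≤ n →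
    (mdl.maxDeg (ξ ω) k s : ℝ) + ∑ j ∈ Finset.Ico s n, mdl.driftLow (ξ ω) k j -
      (n : ℝ) ^ (2 / 3 : ℝ) ≤ mdl.maxDeg (ξ ω) k n := by
  have key := ae_eventually_compensated_lt (P := P) (𝓕 := mdl.filt ξ) (B := 2)
    (Y := fun (_ : Unit) n ω => 2 - ((mdl.maxDeg (ξ ω) k (n + 1) : ℝ) - mdl.maxDeg (ξ ω) k n))
    (q := fun _ n ω => 2 - mdl.driftLow (ξ ω) k n)
    (fun n => {()}) (K := 0) (κ := 0) (fun n => by simp)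
    (mdl.filt_mono ξ) hξ.filt_le
    (fun _ n => ((mdl.measurable_maxDeg ξ k (n + 1)).sub
      ((mdl.measurable_maxDeg ξ k n).mono (mdl.filt_mono ξ n.le_succ) le_rfl)).const_sub 2)
    (fun _ n => (mdl.measurable_driftLow ξ k n).const_sub 2)
    (fun _ n ω => by
      have : (mdl.maxDeg (ξ ω) k (n + 1) : ℝ) ≤ mdl.maxDeg (ξ ω) k n + 2 := by
        exact_mod_cast mdl.maxDeg_succ_le (ξ ω) hk n
      linarith)
    (fun _ _ _ n ω => by
      have : (mdl.maxDeg (ξ ω) k n : ℝ) ≤ mdl.maxDeg (ξ ω) k (n + 1) := by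
        exact_mod_cast mdl.maxDeg_mono (ξ ω) hk n.le_succ
      linarith)
    (fun _ n ω => sub_nonneg.2 (mdl.driftLow_le_two (ξ ω) k n))
    (fun _ n hn => hξ.condLE_driftLow hn hk) (by norm_num)
  filter_upwards [key] with ω hω
  filter_upwards [hω] with n hn s hs hsn
  have h1 := hn () (Finset.mem_singleton_self ()) s hs hsn
  have h2 := Finset.sum_Ico_sub (fun j => (mdl.maxDeg (ξ ω) k j : ℝ)) hsn
  have h3 : ∑ j ∈ Finset.Ico s n, (2 - ((mdl.maxDeg (ξ ω) k (j + 1) : ℝ) - mdl.maxDeg (ξ ω) k j) -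
      (2 - mdl.driftLow (ξ ω) k j)) = ∑ j ∈ Finset.Ico s n, mdl.driftLow (ξ ω) k j -
      ∑ j ∈ Finset.Ico s n, ((mdl.maxDeg (ξ ω) k (j + 1) : ℝ) - mdl.maxDeg (ξ ω) k j) := by
    rw [← Finset.sum_sub_distrib]
    exact Finset.sum_congr rfl fun j _ => by ring
  rw [h3, h2] at h1
  linarith

/-- A lower bound for the drift yields polynomial growth of the `k`-th highest degree. -/
lemma ae_rpow_le_maxDeg {k : ℕ} (hk : 1 ≤ k) {γ γ' δ : ℝ} (hγ'0 : 0 < γ') (hγ' : γ' < γ)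
    (hγ1 : γ < 1) (hδ : 0 < δ) :
    ∀ᵐ ω ∂P, (∀ᶠ n : ℕ in atTop, 1 ≤ (mdl.maxDeg (ξ ω) k n : ℝ) ∧
      ((mdl.maxDeg (ξ ω) k n : ℝ) ≤ δ * n →
        γ * (mdl.maxDeg (ξ ω) k n + 2) / n ≤ mdl.driftLow (ξ ω) k n)) →
      ∀ᶠ n : ℕ in atTop, (n : ℝ) ^ γ' ≤ mdl.maxDeg (ξ ω) k n :=
  ae_eventually_rpow_le (P := P) (𝓕 := mdl.filt ξ) (M := fun n ω => (mdl.maxDeg (ξ ω) k n : ℝ))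
    (q := fun n ω => mdl.driftLow (ξ ω) k n) (mdl.filt_mono ξ) hξ.filt_le
    (mdl.measurable_maxDeg ξ k) (mdl.measurable_driftLow ξ k)
    (fun n ω => by exact_mod_cast mdl.maxDeg_mono (ξ ω) hk n.le_succ)
    (fun n ω => by exact_mod_cast mdl.maxDeg_succ_le (ξ ω) hk n)
    (fun n hn => hξ.condLE_driftLow hn hk) (fun n ω => mdl.driftLow_le_two (ξ ω) k n)
    hγ'0 hγ' hγ1 hδ

/-- Every degree tends to infinity: the vertex step alone gives a vertex infinitely many edges. -/
lemma ae_tendsto_deg (v : ℕ) : ∀ᵐ ω ∂P, Tendsto (fun n => mdl.deg (ξ ω) n v) atTop atTop := by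
  set c : ℝ := min 1 mdl.b with hc
  have hc0 : 0 < c := lt_min one_pos mdl.b_pos
  set near : ℕ → Set Ω := fun n => {ω | (n : ℝ) *
    ‖(((ξ ω).X (mdl.n₀ + n) - (ξ ω).X v : ℝ) : UnitAddCircle)‖ < mdl.b / 2} with hnear
  set far : ℕ → ℕ → Set Ω := fun s n => ⋂ j ∈ Finset.Ico s n, (near j)ᶜ with hfar
  have hnearm : ∀ j n, v < mdl.n₀ + j → j < n → MeasurableSet[mdl.filt ξ n] (near j) := by
    intro j n hv hj
    have h1 : Measurable[mdl.filt ξ n] fun ω => (ξ ω).X (mdl.n₀ + j) :=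
      measurable_coord_srcAlg ξ (s := .X (mdl.n₀ + j)) (show mdl.n₀ + j < mdl.n₀ + n by omega)
    have h2 : Measurable[mdl.filt ξ n] fun ω => (ξ ω).X v :=
      measurable_coord_srcAlg ξ (s := .X v) (show v < mdl.n₀ + n by omega)
    have h3 : Measurable fun x : ℝ => (j : ℝ) * ‖(x : UnitAddCircle)‖ := by
      refine Continuous.measurable ?_
      have : Continuous fun x : ℝ => (x : UnitAddCircle) := AddCircle.continuous_mk' 1
      fun_prop
    exact (h3.comp (h1.sub h2)) measurableSet_Iio
  have hfarm : ∀ s n, v < mdl.n₀ + s → MeasurableSet[mdl.filt ξ n] (far s n) := fun s n hv =>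
    Finset.measurableSet_biInter _ fun j hj => by
      have := Finset.mem_Ico.1 hj
      exact (hnearm j n (by omega) this.2).compl
  -- the probability of no short distance up to time `n` is at most of order `n ^ (-c)`
  have hP : ∀ s, 1 ≤ s → v < mdl.n₀ + s → ∀ n, s ≤ n →
      P.real (far s n) * (n : ℝ) ^ c ≤ (s : ℝ) ^ c := by
    intro s hs hv n hn
    induction n, hn using Nat.le_induction with
    | base => exact mul_le_of_le_one_left (by positivity) measureReal_le_one
    | succ n hn ih =>
      have hn0 : (0 : ℝ) < n := by exact_mod_cast hs.trans hn
      have h1 : far s (n + 1) = far s n \ near n := by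
        ext ω
        simp only [hfar, Set.mem_iInter, Finset.mem_Ico, Set.mem_sdiff, Set.mem_compl_iff]
        constructor
        · exact fun h => ⟨fun j hj => h j ⟨hj.1, by omega⟩, h n ⟨hn, by omega⟩⟩
        · rintro ⟨h1, h2⟩ j hj
          rcases Nat.lt_succ_iff_lt_or_eq.1 hj.2 with h | rfl
          · exact h1 j ⟨hj.1, h⟩
          · exact h2
      have h2 := hξ.prob_torus_lt (hs.trans hn) (show v < mdl.n₀ + n by omega) (mdl.b / 2)
        (hfarm s n hv)
      have h3 : P.real (far s n ∩ near n) = P.real (far s n) * min 1 (mdl.b / n) := by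
        rw [measureReal_def, h2, ENNReal.toReal_mul, ENNReal.toReal_ofReal
          (le_min zero_le_one (by have := mdl.b_pos; positivity)), ← measureReal_def]
        congr 3; ring
      have h4 : P.real (far s (n + 1)) = P.real (far s n) * (1 - min 1 (mdl.b / n)) := by
        have h5 := measureReal_sdiff_add_inter (μ := P) (s := far s n) (t := near n)
          (hξ.filt_le (n + 1) _ (hnearm n (n + 1) (by omega) (by omega)))
        rw [h3] at h5
        rw [h1]; linarith
      have h5 : c / n ≤ min 1 (mdl.b / n) := by
        refine le_min ?_ (by gcongr; exact min_le_right _ _)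
        rw [div_le_one hn0]
        have : (1 : ℝ) ≤ n := by exact_mod_cast hs.trans hn
        exact (min_le_left _ _).trans this
      have h6 := add_one_rpow_le hc0.le (min_le_left 1 mdl.b) (hs.trans hn)
      have h7 : 0 ≤ P.real (far s n) := measureReal_nonneg
      have h8 : 0 ≤ 1 - min 1 (mdl.b / n) := sub_nonneg.2 (min_le_left _ _)
      calc P.real (far s (n + 1)) * ((n + 1 : ℕ) : ℝ) ^ c
          ≤ (P.real (far s n) * (1 - c / n)) * ((n : ℝ) ^ c * (1 + c / n)) := by
            rw [h4]
            have h9 : 0 ≤ 1 - c / n := by linarith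
            exact mul_le_mul (mul_le_mul_of_nonneg_left (by linarith) h7) h6 (by positivity)
              (mul_nonneg h7 h9)
        _ = P.real (far s n) * (n : ℝ) ^ c * (1 - (c / n) ^ 2) := by ring
        _ ≤ P.real (far s n) * (n : ℝ) ^ c :=
            mul_le_of_le_one_right (by positivity) (by linarith [sq_nonneg (c / n)])
        _ ≤ _ := ih
  have hzero : ∀ s, 1 ≤ s → v < mdl.n₀ + s → P (⋂ n, far s n) = 0 := by
    intro s hs hv
    have h1 : ∀ n, s ≤ n → P.real (⋂ n, far s n) * (n : ℝ) ^ c ≤ (s : ℝ) ^ c := fun n hn =>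
      (mul_le_mul_of_nonneg_right (measureReal_mono (Set.iInter_subset _ n)) (by positivity)).trans
        (hP s hs hv n hn)
    by_contra h
    have h2 : 0 < P.real (⋂ n, far s n) :=
      lt_of_le_of_ne measureReal_nonneg fun h' => h ((measureReal_eq_zero_iff).1 h'.symm)
    have h3 : Tendsto (fun n : ℕ => P.real (⋂ n, far s n) * (n : ℝ) ^ c) atTop atTop :=
      ((tendsto_rpow_atTop hc0).comp tendsto_natCast_atTop_atTop).const_mul_atTop h2
    obtain ⟨n, hn1, hn2⟩ := ((h3.eventually_gt_atTop ((s : ℝ) ^ c)).and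
      (Filter.eventually_ge_atTop s)).exists
    exact absurd (h1 n hn2) (not_le.2 hn1)
  have hall : ∀ᵐ ω ∂P, ∀ s, 1 ≤ s → v < mdl.n₀ + s → ω ∉ ⋂ n, far s n :=
    ae_all_iff.2 fun s => ae_all_iff.2 fun hs => ae_all_iff.2 fun hv =>
      measure_eq_zero_iff_ae_notMem.1 (hzero s hs hv)
  filter_upwards [hall] with ω hω
  refine Filter.tendsto_atTop_atTop_of_monotone (mdl.deg_mono (ξ ω) v) fun t => ?_
  induction t with
  | zero => exact ⟨0, Nat.zero_le _⟩
  | succ t ih =>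
    obtain ⟨n, hn⟩ := ih
    have h1 := hω (max (v + 1) n) (by omega) (by omega)
    obtain ⟨j, hj, hjn⟩ : ∃ j, max (v + 1) n ≤ j ∧ ω ∈ near j := by
      by_contra! h
      refine h1 (Set.mem_iInter.2 fun n' => ?_)
      simp only [hfar, Set.mem_iInter, Finset.mem_Ico]
      exact fun j hj => h j hj.1
    refine ⟨j + 1, ?_⟩
    have h2 : v ∈ mdl.vertexTargets (ξ ω) (mdl.graph (ξ ω) j) j := by
      refine (mdl.mem_vertexTargets (ξ ω)).2 ⟨by omega, lt_of_lt_of_le hjn ?_⟩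
      have := mdl.a_pos
      have : 0 ≤ mdl.a / 2 * inDeg (mdl.graph (ξ ω) j) v := by positivity
      linarith
    have h3 := mdl.deg_mono (ξ ω) v (show n ≤ j by omega)
    simp only at h3
    rw [mdl.deg_succ, if_pos h2]
    omega

/-- The first `k` vertices have large degrees. -/
lemma ae_tendsto_maxDeg {k : ℕ} (hk : 1 ≤ k) :
    ∀ᵐ ω ∂P, Tendsto (fun n => mdl.maxDeg (ξ ω) k n) atTop atTop := by
  filter_upwards [ae_all_iff.2 hξ.ae_tendsto_deg] with ω hω
  refine tendsto_atTop.2 fun t => ?_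
  have h : ∀ᶠ n in atTop, ∀ v ∈ Finset.range k, t ≤ mdl.deg (ξ ω) n v :=
    (Filter.eventually_all_finset _).2 fun v _ => (hω v).eventually_ge_atTop t
  filter_upwards [h, Filter.eventually_ge_atTop k] with n hn hkn
  refine le_kthLargest hk ?_
  calc k = (Finset.range k).card := (Finset.card_range k).symm
    _ ≤ _ := Finset.card_le_card fun v hv => Finset.mem_filter.2
      ⟨mdl.mem_verts.2 (by have := Finset.mem_range.1 hv; omega), hn v hv⟩

end IsNoise

/-! ### Moments of degrees -/

lemma pow_sub_pow_le_mul {x y : ℝ} (hx : 0 ≤ x) (hxy : x ≤ y) (p : ℕ) :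
    y ^ (p + 1) - x ^ (p + 1) ≤ (p + 1) * y ^ p * (y - x) := by
  have hy : 0 ≤ y := hx.trans hxy
  induction p with
  | zero => simp
  | succ p ih =>
    have h1 := mul_le_mul_of_nonneg_left ih hy
    have h2 : x ^ (p + 1) * (y - x) ≤ y ^ (p + 1) * (y - x) :=
      mul_le_mul_of_nonneg_right (pow_le_pow_left₀ hx hxy _) (by linarith)
    calc y ^ (p + 1 + 1) - x ^ (p + 1 + 1)
        = y * (y ^ (p + 1) - x ^ (p + 1)) + x ^ (p + 1) * (y - x) := by ring
      _ ≤ y * ((p + 1) * y ^ p * (y - x)) + y ^ (p + 1) * (y - x) := add_le_add h1 h2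
      _ = _ := by push_cast; ring

namespace IsNoise

variable {Ω : Type*} {mΩ : MeasurableSpace Ω} {P : Measure Ω} [IsProbabilityMeasure P]
  {mdl : Model} {ξ : Ω → Noise} (hξ : IsNoise mdl P ξ)

include hξ

/-- Growth of the moments of order `p + 1` of a degree shifted by `c`. The shift absorbs the
constant part of the drift and, if large, the effect of the jumps on the power function. -/
lemma lintegral_deg_pow_succ_le (v p : ℕ) {c η : ℝ} (hc : 0 < c)
    (hc1 : mdl.b + mdl.d * mdl.β + mdl.d * (mdl.M + 1) ≤ (mdl.a + mdl.d * mdl.α) * c)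
    (hc2 : (1 + 2 / c) ^ p ≤ 1 + η) {n : ℕ} (hn : 1 ≤ n) :
    ∫⁻ ω, ENNReal.ofReal ((mdl.deg (ξ ω) (n + 1) v + c) ^ (p + 1)) ∂P ≤
      (∫⁻ ω, ENNReal.ofReal ((mdl.deg (ξ ω) n v + c) ^ (p + 1)) ∂P) *
        ENNReal.ofReal (1 + (p + 1) * (1 + η) * (mdl.a + mdl.d * mdl.α) / n) := by
  have hn0 : (0 : ℝ) < n := by exact_mod_cast hn
  set γ : ℝ := mdl.a + mdl.d * mdl.α with hγ
  have hγ0 : 0 < γ := by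
    have := mdl.a_pos
    have := mdl.α_pos
    positivity
  have hη : 0 ≤ 1 + η := le_trans (by positivity) hc2
  set X : Ω → ℝ := fun ω => mdl.deg (ξ ω) n v + c with hX
  have hX0 : ∀ ω, c ≤ X ω := fun ω => le_add_of_nonneg_left (Nat.cast_nonneg _)
  have hXp : ∀ ω, 0 < X ω := fun ω => hc.trans_le (hX0 ω)
  have hXm : Measurable[mdl.filt ξ n] X := (mdl.measurable_deg ξ n v).add_const c
  have hXm' : Measurable X := hXm.mono (hξ.filt_le n) le_rfl
  have hdm : ∀ n, Measurable fun ω => (mdl.deg (ξ ω) n v : ℝ) := fun n =>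
    (mdl.measurable_deg ξ n v).mono (hξ.filt_le n) le_rfl
  set Φ : Ω → ℝ := fun ω => (p + 1) * (1 + η) * X ω ^ p with hΦ
  have hΦ0 : ∀ ω, 0 ≤ Φ ω := fun ω => by have := hXp ω; positivity
  have hΦm : Measurable[mdl.filt ξ n] Φ := (hXm.pow_const p).const_mul _
  have hcond : CondLE (mdl.filt ξ n) P
      (fun ω => (mdl.deg (ξ ω) (n + 1) v : ℝ) - mdl.deg (ξ ω) n v) (fun ω => γ * X ω / n) := by
    have h := (hξ.condLE_driftSet hn {v}).mono (q' := fun ω => γ * X ω / n) fun ω => by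
      refine (mdl.driftSet_singleton_le (ξ ω) n v).trans ?_
      gcongr
      simp only [hX]
      rw [mul_add γ]
      exact add_le_add le_rfl hc1
    simpa using h
  calc ∫⁻ ω, ENNReal.ofReal ((mdl.deg (ξ ω) (n + 1) v + c) ^ (p + 1)) ∂P
      ≤ ∫⁻ ω, (ENNReal.ofReal (X ω ^ (p + 1)) + ENNReal.ofReal (Φ ω) *
          ENNReal.ofReal ((mdl.deg (ξ ω) (n + 1) v : ℝ) - mdl.deg (ξ ω) n v)) ∂P := by
        refine lintegral_mono fun ω => ?_
        have h1 : (mdl.deg (ξ ω) n v : ℝ) ≤ mdl.deg (ξ ω) (n + 1) v := by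
          exact_mod_cast mdl.deg_mono (ξ ω) v n.le_succ
        have h2 : (mdl.deg (ξ ω) (n + 1) v : ℝ) ≤ mdl.deg (ξ ω) n v + 2 := by
          exact_mod_cast mdl.deg_succ_le (ξ ω) n v
        have h3 := hXp ω
        rw [← ENNReal.ofReal_mul (hΦ0 ω), ← ENNReal.ofReal_add (by positivity)
          (mul_nonneg (hΦ0 ω) (by linarith))]
        refine ENNReal.ofReal_le_ofReal ?_
        set Y : ℝ := mdl.deg (ξ ω) (n + 1) v + c with hY
        have hXY : X ω ≤ Y := by simp only [hX, hY]; linarith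
        have hd : (mdl.deg (ξ ω) (n + 1) v : ℝ) - mdl.deg (ξ ω) n v = Y - X ω := by
          simp only [hX, hY]; ring
        have h4 := pow_sub_pow_le_mul h3.le hXY p
        have h5 : Y ≤ X ω * (1 + 2 / c) := by
          have h6 : 2 ≤ X ω * (2 / c) := by
            rw [mul_div_assoc', le_div_iff₀ hc]
            nlinarith [hX0 ω]
          have h7 : Y ≤ X ω + 2 := by simp only [hX, hY]; linarith
          linarith
        have h6 : Y ^ p ≤ X ω ^ p * (1 + η) := by
          calc Y ^ p ≤ (X ω * (1 + 2 / c)) ^ p := pow_le_pow_left₀ (h3.le.trans hXY) h5 p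
            _ = X ω ^ p * (1 + 2 / c) ^ p := mul_pow _ _ _
            _ ≤ _ := by gcongr
        have h7 : ((p : ℝ) + 1) * Y ^ p * (Y - X ω) ≤
            ((p : ℝ) + 1) * (X ω ^ p * (1 + η)) * (Y - X ω) :=
          mul_le_mul_of_nonneg_right (mul_le_mul_of_nonneg_left h6 (by positivity)) (by linarith)
        rw [hd]
        calc Y ^ (p + 1) ≤ X ω ^ (p + 1) + ((p : ℝ) + 1) * (X ω ^ p * (1 + η)) * (Y - X ω) := by
              linarith
          _ = _ := by simp only [hΦ]; ring
    _ = ∫⁻ ω, ENNReal.ofReal (X ω ^ (p + 1)) ∂P + ∫⁻ ω, ENNReal.ofReal (Φ ω) *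
          ENNReal.ofReal ((mdl.deg (ξ ω) (n + 1) v : ℝ) - mdl.deg (ξ ω) n v) ∂P :=
        lintegral_add_left (hXm'.pow_const _).ennreal_ofReal _
    _ ≤ ∫⁻ ω, ENNReal.ofReal (X ω ^ (p + 1)) ∂P + ∫⁻ ω, ENNReal.ofReal (Φ ω) *
          ENNReal.ofReal (γ * X ω / n) ∂P := by
        gcongr 1
        exact hcond.lintegral_mul_le (hξ.filt_le n) ((hdm _).sub (hdm _))
          ((hXm'.const_mul γ).div_const _) hΦm.ennreal_ofReal
    _ = ∫⁻ ω, (ENNReal.ofReal (X ω ^ (p + 1)) + ENNReal.ofReal (Φ ω) *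
          ENNReal.ofReal (γ * X ω / n)) ∂P :=
        (lintegral_add_left (hXm'.pow_const _).ennreal_ofReal _).symm
    _ = ∫⁻ ω, ENNReal.ofReal (X ω ^ (p + 1)) *
          ENNReal.ofReal (1 + (p + 1) * (1 + η) * γ / n) ∂P := by
        refine lintegral_congr fun ω => ?_
        have h3 := hXp ω
        rw [← ENNReal.ofReal_mul (hΦ0 ω), ← ENNReal.ofReal_add (by positivity)
          (mul_nonneg (hΦ0 ω) (by positivity)), ← ENNReal.ofReal_mul (by positivity)]
        congr 1
        simp only [hΦ]
        ring
    _ = _ := lintegral_mul_const _ (hXm'.pow_const _).ennreal_ofReal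

/-- Polynomial upper bound for the highest degree: all moments of a degree grow at most like the
corresponding power of `n ^ (a + d α)`, and there are only linearly many vertices. -/
lemma ae_eventually_maxDeg_lt {ε : ℝ} (hε : 0 < ε) : ∀ᵐ ω ∂P, ∀ᶠ n : ℕ in atTop,
    (mdl.maxDeg (ξ ω) 1 n : ℝ) < (n : ℝ) ^ (mdl.a + mdl.d * mdl.α + ε) := by
  set γ : ℝ := mdl.a + mdl.d * mdl.α with hγ
  have hγ0 : 0 < γ := by
    have := mdl.a_pos
    have := mdl.α_pos
    positivity
  -- with `p ε ≥ 6`, the moment of order `p + 1` makes the bound fail with probability `O(n ^ (-3))`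
  -- for each vertex, and the number of vertices is `O(n)`
  obtain ⟨p, hp⟩ := exists_nat_ge (max (6 / ε) (1 / γ))
  have hp1 : 6 ≤ p * ε := by
    have := (le_max_left _ _).trans hp
    rwa [div_le_iff₀ hε] at this
  have hp2 : 1 ≤ p * γ := by
    have := (le_max_right _ _).trans hp
    rwa [div_le_iff₀ hγ0] at this
  set η : ℝ := ε / (2 * γ) with hη
  have hη0 : 0 < η := by positivity
  obtain ⟨c, hc0, hc1, hc2⟩ : ∃ c : ℝ, 0 < c ∧
      mdl.b + mdl.d * mdl.β + mdl.d * (mdl.M + 1) ≤ γ * c ∧ (1 + 2 / c) ^ p ≤ 1 + η := by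
    have h1 : Tendsto (fun c : ℝ => (1 + 2 / c) ^ p) atTop (𝓝 ((1 + 0) ^ p)) :=
      ((tendsto_const_nhds.div_atTop tendsto_id).const_add 1).pow p
    have h2 := h1.eventually_lt_const (u := 1 + η) (by simpa using hη0)
    have h3 := (tendsto_id.const_mul_atTop hγ0).eventually_ge_atTop
      (mdl.b + mdl.d * mdl.β + mdl.d * (mdl.M + 1))
    obtain ⟨c, h4, h5, h6⟩ := ((Filter.eventually_gt_atTop (0 : ℝ)).and (h3.and h2)).exists
    exact ⟨c, h4, h5, h6.le⟩
  set κ : ℝ := (p + 1) * (1 + η) * γ with hκ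
  have hκ' : κ = (p + 1) * (γ + ε / 2) := by rw [hκ, hη]; field_simp
  have hκ1 : 1 ≤ κ := by rw [hκ']; nlinarith
  set C : ℝ := (mdl.E₀.card + 2 + c) ^ (p + 1) with hC
  have hC0 : 0 < C := by positivity
  have hmom : ∀ v n, 1 ≤ n → ∫⁻ ω, ENNReal.ofReal ((mdl.deg (ξ ω) n v + c) ^ (p + 1)) ∂P ≤
      ENNReal.ofReal (C * (n : ℝ) ^ κ) := by
    intro v n hn
    induction n, hn using Nat.le_induction with
    | base =>
      calc _ ≤ ∫⁻ _, ENNReal.ofReal C ∂P := by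
            refine lintegral_mono fun ω => ENNReal.ofReal_le_ofReal ?_
            have h1 : (mdl.deg (ξ ω) 1 v : ℝ) ≤ mdl.E₀.card + 2 := by
              exact_mod_cast mdl.deg_le (ξ ω) 1 v
            simp only [hC]
            gcongr
        _ = _ := by simp
    | succ n hn ih =>
      have hn0 : (0 : ℝ) < n := by exact_mod_cast hn
      refine (hξ.lintegral_deg_pow_succ_le v p hc0 hc1
        (hc2) hn).trans ?_
      refine (mul_le_mul_left ih _).trans ?_
      rw [← ENNReal.ofReal_mul (by positivity)]
      refine ENNReal.ofReal_le_ofReal ?_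
      have h1 := one_add_mul_self_le_rpow_one_add (s := 1 / (n : ℝ)) (p := κ)
        (by have : (0 : ℝ) ≤ 1 / n := by positivity
            linarith) hκ1
      have h2 : ((n + 1 : ℕ) : ℝ) = n * (1 + 1 / n) := by push_cast; field_simp
      rw [h2, Real.mul_rpow hn0.le (by positivity), mul_assoc]
      refine mul_le_mul_of_nonneg_left ?_ hC0.le
      refine mul_le_mul_of_nonneg_left ?_ (by positivity)
      refine le_trans (le_of_eq ?_) h1
      simp only [hκ]
      ring
  set bad : ℕ → Set Ω := fun n => {ω | 1 ≤ n ∧ (n : ℝ) ^ (γ + ε) ≤ mdl.maxDeg (ξ ω) 1 n} with hbad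
  have hPb : ∀ n, P (bad n) ≤ ENNReal.ofReal ((mdl.n₀ + 1) * C * ((n : ℝ) ^ 2)⁻¹) := by
    intro n
    by_cases hn : 1 ≤ n
    swap
    · have : bad n = ∅ := by ext; simp [hbad, hn]
      rw [this, measure_empty]; exact zero_le
    have hn0 : (0 : ℝ) < n := by exact_mod_cast hn
    have hn1 : (1 : ℝ) ≤ n := by exact_mod_cast hn
    set t : ℝ := ((n : ℝ) ^ (γ + ε)) ^ (p + 1) with ht
    have ht0 : 0 < t := by positivity
    have h1 : bad n ⊆ ⋃ v ∈ mdl.verts n, {ω | ENNReal.ofReal t ≤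
        ENNReal.ofReal ((mdl.deg (ξ ω) n v + c) ^ (p + 1))} := by
      rintro ω ⟨-, hω⟩
      have h2 : (0 : ℝ) < mdl.maxDeg (ξ ω) 1 n :=
        lt_of_lt_of_le (by positivity) hω
      have h3 := (le_kthLargest_iff (S := mdl.verts n) (f := mdl.deg (ξ ω) n) le_rfl
        (by exact_mod_cast h2 : 1 ≤ mdl.maxDeg (ξ ω) 1 n)).1 le_rfl
      obtain ⟨v, hv⟩ := Finset.card_pos.1 h3
      rw [Finset.mem_filter] at hv
      refine Set.mem_biUnion hv.1 (ENNReal.ofReal_le_ofReal ?_)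
      refine pow_le_pow_left₀ (by positivity) ?_ _
      have h4 : (mdl.maxDeg (ξ ω) 1 n : ℝ) ≤ mdl.deg (ξ ω) n v := by exact_mod_cast hv.2
      linarith
    have h2 : ∀ v, P {ω | ENNReal.ofReal t ≤
        ENNReal.ofReal ((mdl.deg (ξ ω) n v + c) ^ (p + 1))} ≤
          ENNReal.ofReal (C * ((n : ℝ) ^ 3)⁻¹) := by
      intro v
      have hm : Measurable fun ω => ENNReal.ofReal ((mdl.deg (ξ ω) n v + c) ^ (p + 1)) :=
        ((((mdl.measurable_deg ξ n v).mono (hξ.filt_le n) le_rfl).add_const c).pow_const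
          _).ennreal_ofReal
      refine (meas_ge_le_lintegral_div hm.aemeasurable (by simpa using ht0)
        ENNReal.ofReal_ne_top).trans ?_
      refine (ENNReal.div_le_div_right (hmom v n hn) _).trans ?_
      rw [← ENNReal.ofReal_div_of_pos ht0]
      refine ENNReal.ofReal_le_ofReal ?_
      rw [mul_div_assoc]
      refine mul_le_mul_of_nonneg_left ?_ hC0.le
      have h3 : (n : ℝ) ^ κ / t = (n : ℝ) ^ (κ - (γ + ε) * (p + 1 : ℕ)) := by
        rw [Real.rpow_sub hn0, Real.rpow_mul hn0.le (γ + ε), Real.rpow_natCast]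
      have h4 : ((n : ℝ) ^ 3)⁻¹ = (n : ℝ) ^ (-3 : ℝ) := by
        rw [Real.rpow_neg hn0.le]; norm_cast
      rw [h3, h4]
      refine Real.rpow_le_rpow_of_exponent_le hn1 ?_
      rw [hκ']
      push_cast
      nlinarith
    calc P (bad n) ≤ ∑ v ∈ mdl.verts n, ENNReal.ofReal (C * ((n : ℝ) ^ 3)⁻¹) :=
          (measure_mono h1).trans ((measure_biUnion_finset_le _ _).trans
            (Finset.sum_le_sum fun v _ => h2 v))
      _ = ENNReal.ofReal (((mdl.n₀ + n : ℕ) : ℝ) * (C * ((n : ℝ) ^ 3)⁻¹)) := by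
          rw [Finset.sum_const, nsmul_eq_mul, Model.verts, Finset.card_range,
            ENNReal.ofReal_mul (Nat.cast_nonneg _),
            ENNReal.ofReal_natCast]
      _ ≤ _ := by
          refine ENNReal.ofReal_le_ofReal ?_
          have h3 : ((mdl.n₀ + n : ℕ) : ℝ) ≤ (mdl.n₀ + 1) * n := by
            push_cast
            have := le_mul_of_one_le_right (Nat.cast_nonneg (α := ℝ) mdl.n₀) hn1
            linarith
          calc _ ≤ ((mdl.n₀ : ℝ) + 1) * n * (C * ((n : ℝ) ^ 3)⁻¹) := by gcongr
            _ = _ := by field_simp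
  have hsum : ∑' n, P (bad n) ≠ ⊤ :=
    ne_top_of_le_ne_top ((Real.summable_nat_pow_inv.2 (by norm_num)).mul_left
      ((mdl.n₀ + 1) * C)).tsum_ofReal_ne_top (ENNReal.tsum_le_tsum hPb)
  filter_upwards [ae_eventually_notMem hsum] with ω hω
  filter_upwards [hω, Filter.eventually_ge_atTop 1] with n hn hn1
  exact not_le.1 fun h => hn ⟨hn1, h⟩

end IsNoise

/-! ### Comparison with the limiting dynamics -/

section Comparison

/-- A discrete Gronwall inequality for normalized sequences: an integral inequality for `A` with
drift `A j / j + r j` bounds the change of `A n / n`. -/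
lemma div_le_of_le_add_sum {A r : ℕ → ℝ} {e : ℝ} {s n : ℕ} (hs : 1 ≤ s) (hsn : s ≤ n)
    (h : ∀ i, s ≤ i → i ≤ n → A i ≤ A s + ∑ j ∈ Finset.Ico s i, (A j / j + r j) + e) :
    A n / n ≤ A s / s + ∑ j ∈ Finset.Ico s n, r j / (j + 1) + e / s := by
  set B : ℕ → ℝ := fun i => A s + ∑ j ∈ Finset.Ico s i, (A j / j + r j) + e with hB
  have key : ∀ i, s ≤ i → i ≤ n →
      B i / i ≤ A s / s + ∑ j ∈ Finset.Ico s i, r j / (j + 1) + e / s := by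
    intro i hi
    induction i, hi using Nat.le_induction with
    | base => intro _; simp [hB, add_div]
    | succ i hi ih =>
      intro hin
      have hi0 : (0 : ℝ) < i := by exact_mod_cast hs.trans hi
      have h1 : B (i + 1) = B i + (A i / i + r i) := by
        simp only [hB]
        rw [Finset.sum_Ico_succ_top hi]; ring
      have h2 : A i / i ≤ B i / i := div_le_div_of_nonneg_right (h i hi (by omega)) hi0.le
      have h3 : B (i + 1) / ((i + 1 : ℕ) : ℝ) ≤ B i / i + r i / (i + 1) := by
        push_cast
        calc B (i + 1) / ((i : ℝ) + 1) ≤ (B i + (B i / i + r i)) / ((i : ℝ) + 1) := by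
              rw [h1]; gcongr
          _ = _ := by field_simp; ring
      have h4 := ih (by omega)
      rw [Finset.sum_Ico_succ_top hi]
      linarith
  exact (div_le_div_of_nonneg_right (h n hsn le_rfl) (Nat.cast_nonneg n)).trans (key n hsn le_rfl)

/-- The lower counterpart of `div_le_of_le_add_sum`. -/
lemma le_div_of_add_sum_le {A r : ℕ → ℝ} {e : ℝ} {s n : ℕ} (hs : 1 ≤ s) (hsn : s ≤ n)
    (h : ∀ i, s ≤ i → i ≤ n → A s + ∑ j ∈ Finset.Ico s i, (A j / j + r j) - e ≤ A i) :
    A s / s + ∑ j ∈ Finset.Ico s n, r j / (j + 1) - e / s ≤ A n / n := by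
  have h1 := div_le_of_le_add_sum (A := fun i => -A i) (r := fun i => -r i) (e := e) hs hsn
    fun i hi hin => by
      have h2 := h i hi hin
      have h3 : ∑ j ∈ Finset.Ico s i, (-A j / j + -r j) =
          -∑ j ∈ Finset.Ico s i, (A j / j + r j) := by
        rw [← Finset.sum_neg_distrib]
        exact Finset.sum_congr rfl fun j _ => by ring
      rw [h3]; linarith
  simp only [neg_div, Finset.sum_neg_distrib] at h1
  linarith

/-- A sequence that is unbounded along `p` has arbitrarily late records `n` such that `p` holds at a
later time at which the value is no larger. -/
lemma exists_record {z : ℕ → ℝ} {p : ℕ → Prop} (h : ∀ b, ∃ m, p m ∧ b < z m) (N : ℕ) :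
    ∃ n m, N ≤ n ∧ n ≤ m ∧ p m ∧ z m ≤ z n ∧ ∀ i ≤ n, z i ≤ z n := by
  obtain ⟨n', -, hn'⟩ := (Finset.range (N + 1)).exists_max_image z ⟨0, by simp⟩
  obtain ⟨m, hpm, hm⟩ := h (z n')
  obtain ⟨n, hn, hmax⟩ := (Finset.range (m + 1)).exists_max_image z ⟨m, by simp⟩
  have hnm : n ≤ m := Nat.lt_succ_iff.1 (Finset.mem_range.1 hn)
  refine ⟨n, m, ?_, hnm, hpm, hmax m (by simp), fun i hi => hmax i (by simp; omega)⟩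
  by_contra hN
  have h1 := hn' n (by simp; omega)
  have h2 := hmax m (by simp)
  linarith

/-- A time `s` between `l * n` and `n`, at a distance from `n` that is a fraction of `n`. -/
lemma exists_window {l : ℝ} (hl : 1 / 2 ≤ l) (hl1 : l < 1) {n : ℕ} (hn : 2 / (1 - l) ≤ n) :
    ∃ s : ℕ, 1 ≤ s ∧ s ≤ n ∧ l * n ≤ s ∧ (1 - l) / 2 * n ≤ (n : ℝ) - s := by
  have h0 : 0 < 1 - l := by linarith
  have h2 : 2 ≤ (1 - l) * n := by
    rwa [div_le_iff₀ h0, mul_comm] at hn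
  have hn0 : (0 : ℝ) < n := by
    rcases Nat.eq_zero_or_pos n with h | h
    · rw [h, Nat.cast_zero, mul_zero] at h2; linarith
    · exact_mod_cast h
  have h3 : (⌈l * n⌉₊ : ℝ) < l * n + 1 := Nat.ceil_lt_add_one (by positivity)
  refine ⟨⌈l * n⌉₊, Nat.ceil_pos.2 (by positivity), ?_, Nat.le_ceil _, by linarith⟩
  have : (⌈l * n⌉₊ : ℝ) < n + 1 := by nlinarith
  exact Nat.lt_succ_iff.1 (by exact_mod_cast this)

lemma sum_inv_succ_ge {s n : ℕ} (hsn : s ≤ n) :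
    ((n : ℝ) - s) / n ≤ ∑ j ∈ Finset.Ico s n, 1 / ((j : ℝ) + 1) := by
  have h : ∀ j ∈ Finset.Ico s n, 1 / (n : ℝ) ≤ 1 / ((j : ℝ) + 1) := fun j hj => by
    have h1 : ((j + 1 : ℕ) : ℝ) ≤ n := by exact_mod_cast (Finset.mem_Ico.1 hj).2
    push_cast at h1
    exact one_div_le_one_div_of_le (by positivity) h1
  have h1 := Finset.card_nsmul_le_sum _ _ _ h
  rw [Nat.card_Ico, nsmul_eq_mul, Nat.cast_sub hsn] at h1
  rwa [div_eq_mul_one_div]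

lemma sum_inv_succ_le {s n : ℕ} (hs : 1 ≤ s) (hsn : s ≤ n) :
    ∑ j ∈ Finset.Ico s n, 1 / ((j : ℝ) + 1) ≤ ((n : ℝ) - s) / s := by
  have hs0 : (0 : ℝ) < s := by exact_mod_cast hs
  have h : ∀ j ∈ Finset.Ico s n, 1 / ((j : ℝ) + 1) ≤ 1 / (s : ℝ) := fun j hj => by
    have h1 : (s : ℝ) ≤ j := by exact_mod_cast (Finset.mem_Ico.1 hj).1
    exact one_div_le_one_div_of_le hs0 (by linarith)
  have h1 := Finset.sum_le_card_nsmul _ _ _ h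
  rw [Nat.card_Ico, nsmul_eq_mul, Nat.cast_sub hsn] at h1
  rwa [div_eq_mul_one_div]

variable {M : ℕ → ℝ}

/-- If a sequence with increments in `[0, 2]` drifts down whenever `M n / n` is at least `L'`, then
`M n / n` is eventually at most `L`, for `L > L'`. -/
lemma eventually_div_le (hM0 : ∀ n, 0 ≤ M n) (hstep : ∀ n, M (n + 1) ≤ M n + 2) {L' L ρ : ℝ}
    (hL : L' < L) (hρ : 0 < ρ)
    (h : ∀ ε > 0, ∃ N, ∀ s n, N ≤ s → s ≤ n → (∀ j ∈ Finset.Ico s n, L' ≤ M j / j) →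
      M n ≤ M s + ∑ j ∈ Finset.Ico s n, (M j / j - ρ) + ε * n) :
    ∀ᶠ n : ℕ in atTop, M n / n ≤ L := by
  by_contra hcon
  rw [Filter.not_eventually] at hcon
  set η : ℝ := min (1 / 2) ((L - L') / 2) with hη
  have hη0 : 0 < η := lt_min (by norm_num) (by linarith)
  have hη2 : η ≤ 1 / 2 := min_le_left _ _
  have hηL : 2 * η ≤ L - L' := by linarith [min_le_right (1 / 2) ((L - L') / 2)]
  set κ : ℝ := ρ * η / 8 with hκ
  have hκ0 : 0 < κ := by positivity
  obtain ⟨N, hN⟩ := h (ρ * η / 16) (by positivity)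
  -- records of `M n / n + κ log n` are times at which `M n / n` is large, and almost maximal
  have hunb : ∀ b, ∃ m, (L < M m / m) ∧ b < M m / m + κ * Real.log m := by
    intro b
    have h1 : Tendsto (fun m : ℕ => κ * Real.log m) atTop atTop :=
      (Real.tendsto_log_atTop.comp tendsto_natCast_atTop_atTop).const_mul_atTop hκ0
    obtain ⟨m, hm1, hm2⟩ := (hcon.and_eventually (h1.eventually_gt_atTop (b - L))).exists
    exact ⟨m, not_le.1 hm1, by linarith [not_le.1 hm1]⟩
  obtain ⟨n, m, hn, hnm, hm, hzm, hrec⟩ := exists_record hunb (max (2 * N + 1) ⌈2 / η⌉₊)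
  have hnN : 2 * N + 1 ≤ n := (le_max_left _ _).trans hn
  have hnη : 2 / η ≤ n := (Nat.le_ceil _).trans (by exact_mod_cast (le_max_right _ _).trans hn)
  have hn0 : (0 : ℝ) < n := by exact_mod_cast (show 0 < n by omega)
  obtain ⟨s, hs1, hsn, hs2, hs3⟩ := exists_window (l := 1 - η) (by linarith) (by linarith)
    (n := n) (by simpa using hnη)
  have hs0 : (0 : ℝ) < s := by exact_mod_cast hs1
  have hsN : N ≤ s := by
    have h1 : (n : ℝ) / 2 ≤ s := by nlinarith
    have h2 : ((2 * N + 1 : ℕ) : ℝ) ≤ n := by exact_mod_cast hnN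
    push_cast at h2
    have h3 : (N : ℝ) ≤ s := by linarith
    exact_mod_cast h3
  have hyn : L < M n / n := by
    have h1 : Real.log n ≤ Real.log m := Real.log_le_log hn0 (by exact_mod_cast hnm)
    have h2 := mul_le_mul_of_nonneg_left h1 hκ0.le
    linarith
  have hlog : Real.log n - Real.log s ≤ 1 := by
    rw [← Real.log_div hn0.ne' hs0.ne']
    have h1 : (n : ℝ) / s ≤ 2 := by
      rw [div_le_iff₀ hs0]; nlinarith
    have h2 := Real.log_le_sub_one_of_pos (show (0 : ℝ) < n / s by positivity)
    linarith
  have hys : M s / s ≤ M n / n + κ := by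
    have h1 := hrec s hsn
    have h2 := mul_le_mul_of_nonneg_left hlog hκ0.le
    linarith
  have hwin : ∀ i, s ≤ i → i ≤ n → L' ≤ M i / i := by
    intro i hi hin
    have hi0 : (0 : ℝ) < i := hs0.trans_le (by exact_mod_cast hi)
    have h1 : ∀ k, M (i + k) ≤ M i + 2 * k := by
      intro k
      induction k with
      | zero => simp
      | succ k ih => have := hstep (i + k); push_cast; rw [← add_assoc]; linarith
    have h2 := h1 (n - i)
    rw [Nat.add_sub_cancel' hin, Nat.cast_sub hin] at h2
    have h3 : (s : ℝ) ≤ i := by exact_mod_cast hi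
    have h4 : M i / n ≤ M i / i := by
      have : (i : ℝ) ≤ n := by exact_mod_cast hin
      exact div_le_div_of_nonneg_left (hM0 i) hi0 this
    have h5 : M n / n - 2 * η ≤ M i / n := by
      rw [div_sub' hn0.ne']
      refine div_le_div_of_nonneg_right ?_ hn0.le
      linarith
    linarith
  -- over the window from `s` to `n`, `M / n` drops by more than the record property permits
  have habel := div_le_of_le_add_sum (A := M) (r := fun _ => -ρ) (e := ρ * η / 16 * n) hs1 hsn
    fun i hi hin => by
      have h1 := hN s i hsN hi fun j hj => hwin j (Finset.mem_Ico.1 hj).1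
        ((Finset.mem_Ico.1 hj).2.le.trans hin)
      have h2 : ρ * η / 16 * (i : ℝ) ≤ ρ * η / 16 * n := by gcongr
      simp only [← sub_eq_add_neg]
      linarith
  have h1 : ∑ j ∈ Finset.Ico s n, -ρ / ((j : ℝ) + 1) ≤ -(ρ * (η / 2)) := by
    have h2 : ∑ j ∈ Finset.Ico s n, -ρ / ((j : ℝ) + 1) =
        -(ρ * ∑ j ∈ Finset.Ico s n, 1 / ((j : ℝ) + 1)) := by
      rw [Finset.mul_sum, ← Finset.sum_neg_distrib]
      exact Finset.sum_congr rfl fun j _ => by ring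
    rw [h2, neg_le_neg_iff]
    refine mul_le_mul_of_nonneg_left (le_trans ?_ (sum_inv_succ_ge hsn)) hρ.le
    rw [le_div_iff₀ hn0]
    linarith
  have h2 : ρ * η / 16 * n / s ≤ ρ * η / 8 := by
    rw [div_le_iff₀ hs0]
    have : (n : ℝ) ≤ 2 * s := by nlinarith
    have h3 : 0 < ρ * η := by positivity
    nlinarith
  have h3 : 0 < ρ * η := by positivity
  linarith

/-- The error terms are negligible compared to the square of `M n / n`. -/
lemma eventually_error_le (hM : ∀ᶠ n : ℕ in atTop, (n : ℝ) ^ (9 / 10 : ℝ) ≤ M n) (K : ℝ) :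
    ∀ᶠ n : ℕ in atTop, K * ((n : ℝ) ^ (2 / 3 : ℝ) / n) ≤ (M n / n) ^ 2 := by
  have h1 : Tendsto (fun n : ℕ => (n : ℝ) ^ (2 / 15 : ℝ)) atTop atTop :=
    (tendsto_rpow_atTop (by norm_num)).comp tendsto_natCast_atTop_atTop
  filter_upwards [hM, h1.eventually_ge_atTop K, Filter.eventually_ge_atTop 1] with n hn hK hn1
  have hn0 : (0 : ℝ) < n := by exact_mod_cast hn1
  have h2 : (n : ℝ) ^ (2 / 15 : ℝ) * ((n : ℝ) ^ (2 / 3 : ℝ) / n) =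
      ((n : ℝ) ^ (9 / 10 : ℝ) / n) ^ 2 := by
    have h3 : (n : ℝ) ^ (9 / 10 : ℝ) / n = (n : ℝ) ^ (-1 / 10 : ℝ) := by
      rw [← Real.rpow_sub_one hn0.ne']; norm_num
    rw [h3, ← Real.rpow_sub_one hn0.ne', ← Real.rpow_add hn0, ← Real.rpow_natCast,
      ← Real.rpow_mul hn0.le]
    norm_num
  calc K * ((n : ℝ) ^ (2 / 3 : ℝ) / n) ≤ (n : ℝ) ^ (2 / 15 : ℝ) * ((n : ℝ) ^ (2 / 3 : ℝ) / n) := by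
        gcongr
    _ = ((n : ℝ) ^ (9 / 10 : ℝ) / n) ^ 2 := h2
    _ ≤ _ := by gcongr

lemma eventually_pos (hM : ∀ᶠ n : ℕ in atTop, (n : ℝ) ^ (9 / 10 : ℝ) ≤ M n) :
    ∀ᶠ n : ℕ in atTop, 0 < M n / n := by
  filter_upwards [hM, Filter.eventually_ge_atTop 1] with n hn hn1
  have hn0 : (0 : ℝ) < n := by exact_mod_cast hn1
  have : 0 < (n : ℝ) ^ (9 / 10 : ℝ) := by positivity
  exact div_pos (this.trans_le hn) hn0

/-- If a monotone sequence that is not too small drifts up whenever `M n / n` is at most `c`, then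
`M n / n` is eventually at least `c'`, for `c' < c`. -/
lemma eventually_le_div (hmono : Monotone M)
    (hM : ∀ᶠ n : ℕ in atTop, (n : ℝ) ^ (9 / 10 : ℝ) ≤ M n) {c' c ρ : ℝ} (hc' : 0 < c')
    (hc : c' < c) (hρ : 0 < ρ)
    (h : ∃ N, ∀ s n, N ≤ s → s ≤ n → (∀ j ∈ Finset.Ico s n, M j / j ≤ c) →
      M s + ∑ j ∈ Finset.Ico s n, (1 + ρ) * (M j / j) - (n : ℝ) ^ (2 / 3 : ℝ) ≤ M n) :
    ∀ᶠ n : ℕ in atTop, c' ≤ M n / n := by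
  by_contra hcon
  rw [Filter.not_eventually] at hcon
  have hc0 : 0 < c := hc'.trans hc
  set l : ℝ := max (1 / 2) (c' / c) with hl
  have hl1 : l < 1 := max_lt (by norm_num) ((div_lt_one hc0).2 hc)
  have hl2 : 1 / 2 ≤ l := le_max_left _ _
  have hlc : c' ≤ c * l := by
    have := le_max_right (1 / 2) (c' / c)
    rwa [div_le_iff₀ hc0, mul_comm] at this
  set η : ℝ := 1 - l with hη
  have hη0 : 0 < η := by linarith
  set κ : ℝ := (ρ * η / 4) / (1 + ρ * η / 2) with hκ
  have hκ0 : 0 < κ := by positivity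
  have hκ1 : (1 - κ) * (1 + ρ * η / 2) = 1 + ρ * η / 4 := by
    rw [hκ]; field_simp; ring
  have hκ2 : κ < 1 := by
    rw [hκ, div_lt_one (by positivity)]
    have : 0 < ρ * η := by positivity
    linarith
  obtain ⟨N, hN⟩ := h
  obtain ⟨N₁, hN₁⟩ := Filter.eventually_atTop.1
    ((eventually_pos hM).and ((eventually_error_le hM (16 * c' / (ρ * η) )).and
      (Filter.eventually_ge_atTop 1)))
  -- records of `κ log n - log (M n / n)` are times at which `M n / n` is small, and hardly smaller
  -- than at the preceding times
  have hunb : ∀ b, ∃ m, (N₁ ≤ m ∧ M m / m < c') ∧ b < κ * Real.log m - Real.log (M m / m) := by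
    intro b
    have h1 : Tendsto (fun m : ℕ => κ * Real.log m) atTop atTop :=
      (Real.tendsto_log_atTop.comp tendsto_natCast_atTop_atTop).const_mul_atTop hκ0
    obtain ⟨m, hm1, hm2, hm3⟩ := (hcon.and_eventually ((h1.eventually_gt_atTop
      (b + Real.log c')).and (Filter.eventually_ge_atTop N₁))).exists
    have hm1' := not_le.1 hm1
    refine ⟨m, ⟨hm3, hm1'⟩, ?_⟩
    have := Real.log_le_log (hN₁ m hm3).1 hm1'.le
    linarith
  obtain ⟨n, m, hn, hnm, ⟨hmN, hm⟩, hzm, hrec⟩ := exists_record hunb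
    (max (2 * (N + N₁) + 1) ⌈2 / η⌉₊)
  have hnN : 2 * (N + N₁) + 1 ≤ n := (le_max_left _ _).trans hn
  have hnη : 2 / η ≤ n := (Nat.le_ceil _).trans (by exact_mod_cast (le_max_right _ _).trans hn)
  have hn0 : (0 : ℝ) < n := by exact_mod_cast (show 0 < n by omega)
  obtain ⟨s, hs1, hsn, hs2, hs3⟩ := exists_window hl2 hl1 hnη
  have hs0 : (0 : ℝ) < s := by exact_mod_cast hs1
  have hns : (n : ℝ) ≤ 2 * s := by nlinarith
  have hsN : N + N₁ ≤ s := by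
    have h2 : ((2 * (N + N₁) + 1 : ℕ) : ℝ) ≤ n := by exact_mod_cast hnN
    have h3 : ((N + N₁ : ℕ) : ℝ) ≤ s := by push_cast at h2 ⊢; linarith
    exact_mod_cast h3
  obtain ⟨hyn0, hyne, -⟩ := hN₁ n (by omega)
  have hyn : M n / n < c' := by
    have h1 : Real.log n ≤ Real.log m := Real.log_le_log hn0 (by exact_mod_cast hnm)
    have h2 := mul_le_mul_of_nonneg_left h1 hκ0.le
    have h3 : Real.log (M n / n) ≤ Real.log (M m / m) := by linarith
    exact ((Real.log_le_log_iff hyn0 (hN₁ m hmN).1).1 h3).trans_lt hm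
  have hlow : ∀ i, s ≤ i → i ≤ n → (1 - κ) * (M n / n) ≤ M i / i := by
    intro i hi hin
    have hi0 : (0 : ℝ) < i := hs0.trans_le (by exact_mod_cast hi)
    have hyi := (hN₁ i (by omega)).1
    have h1 := hrec i hin
    have h2 : Real.log n - Real.log i ≤ 1 := by
      rw [← Real.log_div hn0.ne' hi0.ne']
      have h1 : (n : ℝ) / i ≤ 2 := by
        rw [div_le_iff₀ hi0]
        have : (s : ℝ) ≤ i := by exact_mod_cast hi
        linarith
      have h2 := Real.log_le_sub_one_of_pos (show (0 : ℝ) < n / i by positivity)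
      linarith
    have h3 := mul_le_mul_of_nonneg_left h2 hκ0.le
    have h4 : Real.log (M n / n) - κ ≤ Real.log (M i / i) := by linarith
    have h5 := Real.add_one_le_exp (-κ)
    calc (1 - κ) * (M n / n) ≤ Real.exp (-κ) * (M n / n) := by gcongr; linarith
      _ = Real.exp (Real.log (M n / n) - κ) := by
          rw [sub_eq_add_neg, Real.exp_add, Real.exp_log hyn0, mul_comm]
      _ ≤ Real.exp (Real.log (M i / i)) := Real.exp_le_exp.2 h4
      _ = _ := Real.exp_log hyi
  have hup : ∀ i, s ≤ i → i ≤ n → M i / i ≤ c := by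
    intro i hi hin
    have hsi : (s : ℝ) ≤ i := by exact_mod_cast hi
    have hi0 : (0 : ℝ) < i := hs0.trans_le hsi
    rw [div_le_iff₀ hi0]
    rw [div_lt_iff₀ hn0] at hyn
    have h1 := hmono hin
    calc M i ≤ c' * n := h1.trans hyn.le
      _ ≤ c * l * n := by gcongr
      _ = c * (l * n) := by ring
      _ ≤ c * i := by gcongr; linarith
  -- over the window from `s` to `n`, `M / n` rises by more than the record property permits
  have habel := le_div_of_add_sum_le (A := M) (r := fun j => ρ * (M j / j))
    (e := (n : ℝ) ^ (2 / 3 : ℝ)) hs1 hsn fun i hi hin => by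
      have h1 := hN s i (by omega) hi fun j hj => hup j (Finset.mem_Ico.1 hj).1
        ((Finset.mem_Ico.1 hj).2.le.trans hin)
      have h2 : (i : ℝ) ^ (2 / 3 : ℝ) ≤ (n : ℝ) ^ (2 / 3 : ℝ) := by gcongr
      have h3 : ∀ j : ℕ, M j / j + ρ * (M j / j) = (1 + ρ) * (M j / j) := fun j => by ring
      simp only [h3]
      linarith
  have h1 : ρ * ((1 - κ) * (M n / n)) * (η / 2) ≤
      ∑ j ∈ Finset.Ico s n, ρ * (M j / j) / ((j : ℝ) + 1) := by
    calc ρ * ((1 - κ) * (M n / n)) * (η / 2)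
        ≤ ρ * ((1 - κ) * (M n / n)) * ∑ j ∈ Finset.Ico s n, 1 / ((j : ℝ) + 1) := by
          have h0 : 0 ≤ 1 - κ := by linarith
          refine mul_le_mul_of_nonneg_left (le_trans ?_ (sum_inv_succ_ge hsn)) (by positivity)
          rw [le_div_iff₀ hn0]
          linarith
      _ ≤ _ := by
          rw [Finset.mul_sum]
          refine Finset.sum_le_sum fun j hj => ?_
          have hj' := Finset.mem_Ico.1 hj
          rw [mul_one_div]
          have := hlow j hj'.1 hj'.2.le
          gcongr
  have h2 : (n : ℝ) ^ (2 / 3 : ℝ) / s ≤ 2 * ((n : ℝ) ^ (2 / 3 : ℝ) / n) := by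
    rw [← mul_div_assoc, div_le_div_iff₀ hs0 hn0]
    have : 0 < (n : ℝ) ^ (2 / 3 : ℝ) := by positivity
    nlinarith
  have h3 := hlow s le_rfl hsn
  have h4 : 16 * c' / (ρ * η) * ((n : ℝ) ^ (2 / 3 : ℝ) / n) ≤ c' * (M n / n) := by
    refine hyne.trans ?_
    rw [sq]
    exact mul_le_mul_of_nonneg_right hyn.le hyn0.le
  have h5 : 16 * ((n : ℝ) ^ (2 / 3 : ℝ) / n) ≤ ρ * η * (M n / n) := by
    have h6 : 16 * c' / (ρ * η) * ((n : ℝ) ^ (2 / 3 : ℝ) / n) =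
      c' * (16 * ((n : ℝ) ^ (2 / 3 : ℝ) / n) / (ρ * η)) := by ring
    rw [h6] at h4
    have h7 := le_of_mul_le_mul_left h4 hc'
    rw [div_le_iff₀ (by positivity)] at h7
    linarith
  have h6 : (1 - κ) * (M n / n) + ρ * ((1 - κ) * (M n / n)) * (η / 2) =
      (1 + ρ * η / 4) * (M n / n) := by rw [← hκ1]; ring
  have h7 : 0 < ρ * η * (M n / n) := by positivity
  nlinarith

end Comparison

/-! ### Sequences with a quadratic drift -/

section Critical

variable {M : ℕ → ℝ}

/-- The partial sums of the harmonic series. -/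
noncomputable def harm (n : ℕ) : ℝ := ∑ j ∈ Finset.range n, 1 / ((j : ℝ) + 1)

lemma harm_sub {s n : ℕ} (hsn : s ≤ n) :
    harm n - harm s = ∑ j ∈ Finset.Ico s n, 1 / ((j : ℝ) + 1) :=
  (Finset.sum_Ico_eq_sub _ hsn).symm

lemma tendsto_harm : Tendsto harm atTop atTop := Real.tendsto_sum_range_one_div_nat_succ_atTop

lemma tendsto_harm_div_log : Tendsto (fun n : ℕ => harm n / Real.log n) atTop (𝓝 1) := by
  have h0 : Tendsto (fun n : ℕ => Real.log n) atTop atTop :=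
    Real.tendsto_log_atTop.comp tendsto_natCast_atTop_atTop
  have h1 := (Real.tendsto_harmonic_sub_log.div_atTop h0).const_add 1
  rw [add_zero] at h1
  refine h1.congr' ?_
  filter_upwards [h0.eventually_gt_atTop 0] with n hn
  have h2 : ((harmonic n : ℚ) : ℝ) = harm n := by
    simp [harmonic, harm]
  rw [h2]
  field_simp
  ring

/-- For `l = 1 / 2` the harmonic sum over the window is of order one. -/
lemma exists_half_window {n : ℕ} (hn : 4 ≤ n) : ∃ s : ℕ, 1 ≤ s ∧ s ≤ n ∧ (n : ℝ) ≤ 2 * s ∧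
    1 / 4 ≤ harm n - harm s ∧ harm n - harm s ≤ 1 := by
  have hn' : (4 : ℝ) ≤ n := by exact_mod_cast hn
  obtain ⟨s, hs1, hsn, hs2, hs3⟩ := exists_window (l := 1 / 2) le_rfl (by norm_num) (n := n)
    (by rw [show (2 : ℝ) / (1 - 1 / 2) = 4 by norm_num]; exact hn')
  have hs0 : (0 : ℝ) < s := by exact_mod_cast hs1
  refine ⟨s, hs1, hsn, by linarith, ?_, ?_⟩
  · rw [harm_sub hsn]
    refine le_trans ?_ (sum_inv_succ_ge hsn)
    rw [le_div_iff₀ (by linarith)]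
    linarith
  · rw [harm_sub hsn]
    refine (sum_inv_succ_le hs1 hsn).trans ?_
    rw [div_le_one hs0]
    linarith

lemma rpow_div_le_of_le_two_mul {n i : ℕ} (hi : 1 ≤ i) (hin : i ≤ n) (h : (n : ℝ) ≤ 2 * i) :
    (n : ℝ) ^ (2 / 3 : ℝ) / i ≤ 2 * ((n : ℝ) ^ (2 / 3 : ℝ) / n) := by
  have hi0 : (0 : ℝ) < i := by exact_mod_cast hi
  have hn0 : (0 : ℝ) < n := by exact_mod_cast hi.trans hin
  rw [← mul_div_assoc, div_le_div_iff₀ hi0 hn0]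
  have : 0 < (n : ℝ) ^ (2 / 3 : ℝ) := by positivity
  nlinarith

set_option maxHeartbeats 400000 in
/-- Critical case, upper bound: if the normalized drift is at most `-C₁ y ^ 2`, where
`y = M n / n → 0`, then `1 / y` grows at least like `C₀ log n`, for `C₀ < C₁`. -/
lemma eventually_mul_harm_le (hM : ∀ᶠ n : ℕ in atTop, (n : ℝ) ^ (9 / 10 : ℝ) ≤ M n)
    (hlim : Tendsto (fun n : ℕ => M n / n) atTop (𝓝 0)) {C₀ C₁ : ℝ} (hC₀ : 0 < C₀) (hC : C₀ < C₁)
    (h : ∃ N, ∀ s n, N ≤ s → s ≤ n →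
      M n ≤ M s + ∑ j ∈ Finset.Ico s n, (M j / j - C₁ * (M j / j) ^ 2) + (n : ℝ) ^ (2 / 3 : ℝ)) :
    ∀ᶠ n : ℕ in atTop, C₀ * harm n ≤ 1 / (M n / n) := by
  by_contra hcon
  rw [Filter.not_eventually] at hcon
  obtain ⟨N, hN⟩ := h
  set C : ℝ := (C₀ + C₁) / 2 with hCdef
  have hCC : C < C₁ := by linarith
  have hC0 : 0 < C := by linarith
  have hC1 : 0 < C₁ := by linarith
  set θ : ℝ := (C₁ - C) / (4 * C₁) with hθ
  have hθ0 : 0 < θ := div_pos (by linarith) (by linarith)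
  have hθ1 : θ * (4 * C₁) = C₁ - C := by rw [hθ]; field_simp
  have hθ2 : θ < 1 := by nlinarith
  obtain ⟨N₁, hN₁⟩ := Filter.eventually_atTop.1 ((eventually_pos hM).and
    ((eventually_error_le hM (2 / θ + 64 / (C₁ - C))).and
    (hlim.eventually_lt_const (show (0 : ℝ) < min 1 (θ / (2 * C)) by positivity))))
  -- between times `s` and `n`, where `n` is a record, `1 / y` gains at most `C (harm n - harm s)`,
  -- while the drift forces a gain of about `C₁ (harm n - harm s)`
  have hunb : ∀ b, ∃ m, True ∧ b < C * harm m - 1 / (M m / m) := by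
    intro b
    have h1 : Tendsto (fun m : ℕ => (C - C₀) * harm m) atTop atTop :=
      tendsto_harm.const_mul_atTop (by linarith)
    obtain ⟨m, hm1, hm2⟩ := (hcon.and_eventually (h1.eventually_gt_atTop b)).exists
    exact ⟨m, trivial, by linarith [not_le.1 hm1]⟩
  obtain ⟨n, -, hn, -, -, -, hrec⟩ := exists_record hunb (2 * (N + N₁) + 4)
  have hn0 : (0 : ℝ) < n := by exact_mod_cast (show 0 < n by omega)
  obtain ⟨s, hs1, hsn, hs2, hA1, hA2⟩ := exists_half_window (show 4 ≤ n by omega)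
  have hs0 : (0 : ℝ) < s := by exact_mod_cast hs1
  have hsN : N + N₁ ≤ s := by
    have h2 : n ≤ 2 * s := by exact_mod_cast hs2
    omega
  set y : ℕ → ℝ := fun i => M i / i with hy
  set e : ℝ := (n : ℝ) ^ (2 / 3 : ℝ) / n with he
  have he0 : 0 < e := by positivity
  obtain ⟨hy0, hye, hyθ⟩ := hN₁ n (by omega)
  have hy1 : y n < 1 := hyθ.trans_le (min_le_left _ _)
  have hy2 : y n * (2 * C) < θ := by
    have := hyθ.trans_le (min_le_right _ _)
    rwa [lt_div_iff₀ (by positivity)] at this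
  have habel : ∀ i, s ≤ i → i ≤ n →
      y n ≤ y i + ∑ j ∈ Finset.Ico i n, -(C₁ * y j ^ 2) / ((j : ℝ) + 1) + 2 * e := by
    intro i hi hin
    have hsi : (s : ℝ) ≤ i := by exact_mod_cast hi
    have h1 := div_le_of_le_add_sum (A := M) (r := fun j => -(C₁ * y j ^ 2))
      (e := (n : ℝ) ^ (2 / 3 : ℝ)) (hs1.trans hi) hin fun k hk hkn => by
        have h1 := hN i k (by omega) hk
        have h2 : (k : ℝ) ^ (2 / 3 : ℝ) ≤ (n : ℝ) ^ (2 / 3 : ℝ) := by gcongr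
        simp only [← sub_eq_add_neg]
        linarith
    have h2 := rpow_div_le_of_le_two_mul (hs1.trans hi) hin (by linarith)
    linarith
  have hye1 : 2 * e ≤ θ * y n := by
    have h1 : 2 / θ * e ≤ y n := by
      calc 2 / θ * e ≤ (2 / θ + 64 / (C₁ - C)) * e := by
            have : 0 ≤ 64 / (C₁ - C) := div_nonneg (by norm_num) (by linarith)
            gcongr; linarith
        _ ≤ y n ^ 2 := hye
        _ ≤ y n := by rw [sq]; exact mul_le_of_le_one_left hy0.le hy1.le
    rw [div_mul_eq_mul_div, div_le_iff₀ hθ0] at h1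
    linarith
  have hye2 : 64 * e ≤ (C₁ - C) * y n ^ 2 := by
    have h1 : 64 / (C₁ - C) * e ≤ y n ^ 2 := by
      refine le_trans ?_ hye
      have : 0 ≤ 2 / θ := by positivity
      gcongr; linarith
    rw [div_mul_eq_mul_div, div_le_iff₀ (by linarith)] at h1
    linarith
  have hlow : ∀ i, s ≤ i → i ≤ n → (1 - θ) * y n ≤ y i := by
    intro i hi hin
    have h1 := habel i hi hin
    have h2 : ∑ j ∈ Finset.Ico i n, -(C₁ * y j ^ 2) / ((j : ℝ) + 1) ≤ 0 :=
      Finset.sum_nonpos fun j _ => div_nonpos_of_nonpos_of_nonneg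
        (neg_nonpos.2 (by positivity)) (by positivity)
    linarith
  have hys0 : 0 < y s := (hN₁ s (by omega)).1
  have hrec' : y s - y n ≤ C * (harm n - harm s) * (y n * y s) := by
    have h1 := hrec s hsn
    have h2 : 1 / y n - 1 / y s ≤ C * (harm n - harm s) := by
      simp only [hy]; linarith
    have h3 : 1 / y n - 1 / y s = (y s - y n) / (y n * y s) := by
      have hy0' : y n ≠ 0 := hy0.ne'
      field_simp
    rwa [h3, div_le_iff₀ (mul_pos hy0 hys0)] at h2
  have hyys : 0 < y n * y s := mul_pos hy0 hys0
  have hup : y s ≤ (1 + θ) * y n := by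
    have h1 : y s - y n ≤ C * (y n * y s) := by
      refine hrec'.trans ?_
      have : C * (harm n - harm s) ≤ C := by nlinarith
      exact mul_le_mul_of_nonneg_right this hyys.le
    have h2 : C * (y n * y s) ≤ θ / 2 * y s := by nlinarith
    nlinarith
  have h1 : C₁ * ((1 - θ) * y n) ^ 2 * (harm n - harm s) ≤
      -∑ j ∈ Finset.Ico s n, -(C₁ * y j ^ 2) / ((j : ℝ) + 1) := by
    rw [harm_sub hsn, Finset.mul_sum, ← Finset.sum_neg_distrib]
    refine Finset.sum_le_sum fun j hj => ?_
    have hj' := Finset.mem_Ico.1 hj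
    have h2 := hlow j hj'.1 hj'.2.le
    have h3 : 0 ≤ (1 - θ) * y n := mul_nonneg (by linarith) hy0.le
    rw [neg_div, neg_neg, mul_one_div]
    gcongr
  have h2 := habel s le_rfl hsn
  set A : ℝ := harm n - harm s with hA
  have h3 : C * A * (y n * y s) ≤ C * A * (1 + θ) * y n ^ 2 := by
    have h4 : y n * y s ≤ y n * ((1 + θ) * y n) := mul_le_mul_of_nonneg_left hup hy0.le
    have h5 : 0 ≤ C * A := mul_nonneg hC0.le (by linarith)
    calc C * A * (y n * y s) ≤ C * A * (y n * ((1 + θ) * y n)) :=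
          mul_le_mul_of_nonneg_left h4 h5
      _ = _ := by ring
  have h4 : (C₁ - C) / 4 ≤ C₁ * (1 - θ) ^ 2 - C * (1 + θ) := by nlinarith
  have h5 : (C₁ - C) / 4 * (A * y n ^ 2) ≤ (C₁ * (1 - θ) ^ 2 - C * (1 + θ)) * (A * y n ^ 2) :=
    mul_le_mul_of_nonneg_right h4 (by positivity)
  have h6 : (C₁ * (1 - θ) ^ 2 - C * (1 + θ)) * (A * y n ^ 2) ≤ 2 * e := by
    have : C₁ * ((1 - θ) * y n) ^ 2 * A = C₁ * (1 - θ) ^ 2 * (A * y n ^ 2) := by ring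
    linarith
  have h7 : (C₁ - C) / 4 * (1 / 4 * y n ^ 2) ≤ (C₁ - C) / 4 * (A * y n ^ 2) := by
    have : 0 ≤ C₁ - C := by linarith
    gcongr
  linarith

/-- Critical case, lower bound: if the normalized drift of a monotone sequence is at least
`-C₁ y ^ 2`, then `1 / y` grows at most like `C₀ log n`, for `C₀ > C₁`. -/
lemma eventually_le_mul_harm (hmono : Monotone M)
    (hM : ∀ᶠ n : ℕ in atTop, (n : ℝ) ^ (9 / 10 : ℝ) ≤ M n)
    (hlim : Tendsto (fun n : ℕ => M n / n) atTop (𝓝 0)) {C₀ C₁ : ℝ} (hC1 : 0 < C₁) (hC : C₁ < C₀)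
    (h : ∃ N, ∀ s n, N ≤ s → s ≤ n →
      M s + ∑ j ∈ Finset.Ico s n, (M j / j - C₁ * (M j / j) ^ 2) - (n : ℝ) ^ (2 / 3 : ℝ) ≤ M n) :
    ∀ᶠ n : ℕ in atTop, 1 / (M n / n) ≤ C₀ * harm n := by
  by_contra hcon
  rw [Filter.not_eventually] at hcon
  obtain ⟨N, hN⟩ := h
  set C : ℝ := (C₀ + C₁) / 2 with hCdef
  have hCC : C₁ < C := by linarith
  have hC0 : 0 < C := by linarith
  obtain ⟨θ, hθ0, hθ1, hθ⟩ : ∃ θ : ℝ, 0 < θ ∧ θ ≤ 1 ∧ C₁ * (1 + θ) ^ 2 ≤ (C + C₁) / 2 := by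
    refine ⟨min 1 ((C - C₁) / (6 * C₁)), lt_min one_pos (div_pos (by linarith) (by linarith)),
      min_le_left _ _, ?_⟩
    set θ := min 1 ((C - C₁) / (6 * C₁)) with hθ
    have h1 : θ ≤ 1 := min_le_left _ _
    have h2 : θ * (6 * C₁) ≤ C - C₁ := by
      have := min_le_right 1 ((C - C₁) / (6 * C₁))
      rwa [le_div_iff₀ (by positivity)] at this
    have h0 : 0 < θ := lt_min one_pos (div_pos (by linarith) (by linarith))
    nlinarith [mul_pos h0 hC1]
  obtain ⟨N₁, hN₁⟩ := Filter.eventually_atTop.1 ((eventually_pos hM).and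
    ((eventually_error_le hM (4 / θ + 32 / (C - C₁))).and
    (hlim.eventually_lt_const (show (0 : ℝ) < min 1 (θ / (8 * C₁)) by positivity))))
  -- between times `s` and `n`, where `n` is a record, `1 / y` gains at least `C (harm n - harm s)`,
  -- while the drift allows a gain of about `C₁ (harm n - harm s)` only
  have hunb : ∀ b, ∃ m, True ∧ b < 1 / (M m / m) - C * harm m := by
    intro b
    have h1 : Tendsto (fun m : ℕ => (C₀ - C) * harm m) atTop atTop :=
      tendsto_harm.const_mul_atTop (by linarith)
    obtain ⟨m, hm1, hm2⟩ := (hcon.and_eventually (h1.eventually_gt_atTop b)).exists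
    exact ⟨m, trivial, by linarith [not_le.1 hm1]⟩
  obtain ⟨n, -, hn, -, -, -, hrec⟩ := exists_record hunb (2 * (N + N₁) + 4)
  have hn0 : (0 : ℝ) < n := by exact_mod_cast (show 0 < n by omega)
  obtain ⟨s, hs1, hsn, hs2, hA1, hA2⟩ := exists_half_window (show 4 ≤ n by omega)
  have hs0 : (0 : ℝ) < s := by exact_mod_cast hs1
  have hsN : N + N₁ ≤ s := by
    have h2 : n ≤ 2 * s := by exact_mod_cast hs2
    omega
  set y : ℕ → ℝ := fun i => M i / i with hy
  set e : ℝ := (n : ℝ) ^ (2 / 3 : ℝ) / n with he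
  have he0 : 0 < e := by positivity
  obtain ⟨hy0, hye, hyθ⟩ := hN₁ n (by omega)
  have hy1 : y n < 1 := hyθ.trans_le (min_le_left _ _)
  have hy2 : y n * (8 * C₁) < θ := by
    have := hyθ.trans_le (min_le_right _ _)
    rwa [lt_div_iff₀ (by positivity)] at this
  have habel : ∀ i, s ≤ i → i ≤ n →
      y i - ∑ j ∈ Finset.Ico i n, C₁ * y j ^ 2 / ((j : ℝ) + 1) - 2 * e ≤ y n := by
    intro i hi hin
    have hsi : (s : ℝ) ≤ i := by exact_mod_cast hi
    have h1 := le_div_of_add_sum_le (A := M) (r := fun j => -(C₁ * y j ^ 2))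
      (e := (n : ℝ) ^ (2 / 3 : ℝ)) (hs1.trans hi) hin fun k hk hkn => by
        have h1 := hN i k (by omega) hk
        have h2 : (k : ℝ) ^ (2 / 3 : ℝ) ≤ (n : ℝ) ^ (2 / 3 : ℝ) := by gcongr
        simp only [← sub_eq_add_neg]
        linarith
    have h2 := rpow_div_le_of_le_two_mul (hs1.trans hi) hin (by linarith)
    simp only [neg_div, Finset.sum_neg_distrib] at h1
    linarith
  have hye1 : 4 * e ≤ θ * y n := by
    have h1 : 4 / θ * e ≤ y n := by
      calc 4 / θ * e ≤ (4 / θ + 32 / (C - C₁)) * e := by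
            have : 0 ≤ 32 / (C - C₁) := div_nonneg (by norm_num) (by linarith)
            gcongr; linarith
        _ ≤ y n ^ 2 := hye
        _ ≤ y n := by rw [sq]; exact mul_le_of_le_one_left hy0.le hy1.le
    rw [div_mul_eq_mul_div, div_le_iff₀ hθ0] at h1
    linarith
  have hye2 : 32 * e ≤ (C - C₁) * y n ^ 2 := by
    have h1 : 32 / (C - C₁) * e ≤ y n ^ 2 := by
      refine le_trans ?_ hye
      have : 0 ≤ 4 / θ := by positivity
      gcongr; linarith
    rw [div_mul_eq_mul_div, div_le_iff₀ (by linarith)] at h1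
    linarith
  have hysum : ∀ {b : ℝ} {i : ℕ}, s ≤ i → i ≤ n → (∀ j, i ≤ j → j ≤ n → y j ≤ b) →
      ∑ j ∈ Finset.Ico i n, C₁ * y j ^ 2 / ((j : ℝ) + 1) ≤ C₁ * b ^ 2 * (harm n - harm i) := by
    intro b i hi hin hb
    rw [harm_sub hin, Finset.mul_sum]
    refine Finset.sum_le_sum fun j hj => ?_
    have hj' := Finset.mem_Ico.1 hj
    have h2 := hb j hj'.1 hj'.2.le
    have h3 : 0 ≤ y j := (hN₁ j (by omega)).1.le
    rw [mul_one_div]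
    gcongr
  have htwo : ∀ i, s ≤ i → i ≤ n → y i ≤ 2 * y n := by
    intro i hi hin
    have hsi : (s : ℝ) ≤ i := by exact_mod_cast hi
    have hi0 : (0 : ℝ) < i := hs0.trans_le hsi
    have h1 := hmono hin
    simp only [hy]
    rw [div_le_iff₀ hi0]
    have h2 : y n * n = M n := by simp only [hy]; field_simp
    have h3 : y n * n ≤ y n * (2 * i) := mul_le_mul_of_nonneg_left (by linarith) hy0.le
    calc M i ≤ y n * (2 * i) := by linarith
      _ = _ := by ring
  have hup : ∀ i, s ≤ i → i ≤ n → y i ≤ (1 + θ) * y n := by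
    intro i hi hin
    have h1 := habel i hi hin
    have h2 := hysum hi hin fun j hj hjn => htwo j (hi.trans hj) hjn
    have h3 : harm n - harm i ≤ 1 := by
      refine le_trans ?_ hA2
      have : harm s ≤ harm i := by
        have h4 := harm_sub hi
        have h5 : 0 ≤ ∑ j ∈ Finset.Ico s i, 1 / ((j : ℝ) + 1) :=
          Finset.sum_nonneg fun j _ => by positivity
        linarith
      linarith
    have h4 : C₁ * (2 * y n) ^ 2 * (harm n - harm i) ≤ C₁ * (2 * y n) ^ 2 * 1 := by gcongr
    have h5 : C₁ * (2 * y n) ^ 2 ≤ θ / 2 * y n := by nlinarith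
    linarith
  have hys0 : 0 < y s := (hN₁ s (by omega)).1
  set A : ℝ := harm n - harm s with hA
  have hrec' : C * A * (y n * y s) ≤ y s - y n := by
    have h1 := hrec s hsn
    have h2 : C * A ≤ 1 / y n - 1 / y s := by
      simp only [hy, hA]; linarith
    have h3 : 1 / y n - 1 / y s = (y s - y n) / (y n * y s) := by
      have hy0' : y n ≠ 0 := hy0.ne'
      field_simp
    rwa [h3, le_div_iff₀ (mul_pos hy0 hys0)] at h2
  have hyys : 0 < y n * y s := mul_pos hy0 hys0
  have hsn' : y n ≤ y s := by
    have : 0 ≤ C * A * (y n * y s) := by positivity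
    linarith
  have h1 := hysum le_rfl hsn hup
  have h2 := habel s le_rfl hsn
  have h3 : C * A * y n ^ 2 ≤ C * A * (y n * y s) := by
    rw [sq]; gcongr
  have h5 : C₁ * ((1 + θ) * y n) ^ 2 * A ≤ (C + C₁) / 2 * (A * y n ^ 2) := by
    calc C₁ * ((1 + θ) * y n) ^ 2 * A = C₁ * (1 + θ) ^ 2 * (A * y n ^ 2) := by ring
      _ ≤ _ := by gcongr
  have h7 : (C - C₁) / 2 * (1 / 4 * y n ^ 2) ≤ (C - C₁) / 2 * (A * y n ^ 2) := by
    have : 0 ≤ C - C₁ := by linarith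
    gcongr
  nlinarith

end Critical

/-! ### The drifts in the limit -/

namespace Model

variable (mdl : Model) (ξ : Noise)

/-- Each step adds at most `2` to a degree and `a, α < 1 / 2`, so the truncations at `1` in the
probabilities of both steps are eventually void. -/
lemma eventually_mul_maxDeg_add_le {i : ℕ} (hi : 1 ≤ i) {p q : ℝ} (hp0 : 0 < p) (hp : p < 1 / 2) :
    ∀ᶠ n : ℕ in atTop, p * mdl.maxDeg ξ i n + q ≤ n := by
  filter_upwards [tendsto_natCast_atTop_atTop.eventually_ge_atTop
    ((p * mdl.E₀.card + q) / (1 - 2 * p))] with n hn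
  rw [div_le_iff₀ (by linarith)] at hn
  have h1 : (mdl.maxDeg ξ i n : ℝ) ≤ mdl.E₀.card + 2 * n := by
    exact_mod_cast mdl.maxDeg_le ξ hi n
  have h2 := mul_le_mul_of_nonneg_left h1 hp0.le
  linarith

variable {ξ} in
lemma tendsto_topHit {i : ℕ} (hi : 1 ≤ i) {x : ℝ}
    (h : Tendsto (fun n : ℕ => (mdl.maxDeg ξ i n : ℝ) / n) atTop (𝓝 x)) :
    Tendsto (fun n => mdl.topHit ξ n i) atTop (𝓝 (mdl.h x)) := by
  have h1 : Tendsto (fun n : ℕ => (mdl.maxDeg ξ i n : ℝ) / n + mdl.β / (mdl.α * n)) atTop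
      (𝓝 (x + 0)) :=
    h.add (tendsto_const_nhds.div_atTop (tendsto_natCast_atTop_atTop.const_mul_atTop mdl.α_pos))
  rw [add_zero] at h1
  refine ((mdl.continuous_h.tendsto x).comp h1).congr' ?_
  filter_upwards [mdl.eventually_mul_maxDeg_add_le ξ hi mdl.α_pos mdl.α_lt (q := mdl.β),
    Filter.eventually_ge_atTop 1] with n hn hn1
  exact (mdl.hitProb_eq hn1 hn).symm

variable {ξ} in
lemma tendsto_Qt_topHit {k : ℕ} {x : ℕ → ℝ}
    (h : ∀ i ∈ Finset.Ico 1 k, Tendsto (fun n : ℕ => (mdl.maxDeg ξ i n : ℝ) / n) atTop (𝓝 (x i))) :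
    Tendsto (fun n => mdl.Qt k (mdl.topHit ξ n)) atTop (𝓝 (mdl.Q k x)) := by
  rw [Q_eq_Qt]
  exact mdl.tendsto_Qt fun j hj => mdl.tendsto_topHit (Finset.mem_Ico.1 hj).1 (h j hj)

/-- The lower drift in terms of the limiting dynamics `x' = x * rate q x`, for the current value
of `q`. -/
lemma le_driftLow {k n : ℕ} (hn : 1 ≤ n) (hS : mdl.Separated ξ k n)
    (ha : mdl.a * mdl.maxDeg ξ k n + mdl.b ≤ n) (hα : mdl.α * mdl.maxDeg ξ k n + mdl.β ≤ n)
    {q : ℝ} (hq : q = mdl.Qt k (mdl.topHit ξ n) - (1 + (k - 1 : ℕ) * mdl.d * (mdl.M + 1)) / n)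
    (hq0 : 0 ≤ q) :
    (mdl.maxDeg ξ k n : ℝ) / n * (1 + mdl.rate q ((mdl.maxDeg ξ k n : ℝ) / n)) ≤
      mdl.driftLow ξ k n := by
  have hn0 : (0 : ℝ) < n := by exact_mod_cast hn
  have hb := mdl.b_pos
  set y : ℝ := (mdl.maxDeg ξ k n : ℝ) / n with hy
  rw [driftLow, if_pos hS, ← hq, min_eq_right ((div_le_one hn0).2 ha)]
  have h1 : mdl.a * y ≤ (mdl.a * mdl.maxDeg ξ k n + mdl.b) / n := by
    rw [hy, ← mul_div_assoc]; gcongr; linarith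
  have h2 : mdl.h y * q ≤ mdl.topHit ξ n k * q :=
    mul_le_mul_of_nonneg_right (mdl.h_le_hitProb hn hα) hq0
  have h3 : y * (1 + mdl.rate q y) = mdl.a * y + mdl.h y * q := by
    rw [rate, h_eq]; ring
  linarith

/-- The upper drift in terms of the limiting dynamics. -/
lemma driftUp_le {k n : ℕ} (hk : 1 ≤ k) (hn : 1 ≤ n)
    (hα : mdl.α * mdl.maxDeg ξ k n + mdl.β ≤ n) :
    mdl.driftUp ξ k n ≤ (mdl.maxDeg ξ k n : ℝ) / n * (1 + mdl.rate
      (mdl.Qt k (mdl.topHit ξ n)) ((mdl.maxDeg ξ k n : ℝ) / n)) +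
      ∑ i ∈ Finset.Ico 1 k, (mdl.a * ((mdl.maxDeg ξ i n : ℝ) / n) +
        mdl.topHit ξ n i * mdl.Qt i (mdl.topHit ξ n)) +
      (k * mdl.b + k * mdl.d * (mdl.M + 1) + mdl.d * mdl.β) / n := by
  have hn0 : (0 : ℝ) < n := by exact_mod_cast hn
  set y : ℝ := (mdl.maxDeg ξ k n : ℝ) / n with hy
  have hq0 := mdl.Qt_nonneg (i := k) fun j _ => mdl.topHit_mem ξ n j
  have hq1 := mdl.Qt_le_one (i := k) fun j _ => mdl.topHit_mem ξ n j
  set q : ℝ := mdl.Qt k (mdl.topHit ξ n) with hq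
  have hsplit : Finset.Icc 1 k = insert k (Finset.Ico 1 k) := by
    ext i; simp; omega
  have hknot : k ∉ Finset.Ico 1 k := by simp
  have h1 : mdl.topHit ξ n k * q ≤ mdl.h y * q + mdl.d * mdl.β / n := by
    have h2 := mul_le_mul_of_nonneg_right (mdl.hitProb_le_h hn hα) hq0
    have h3 : 0 ≤ mdl.d * mdl.β / (n : ℝ) := by
      have := mdl.β_pos
      positivity
    have h4 : mdl.d * mdl.β / (n : ℝ) * q ≤ mdl.d * mdl.β / (n : ℝ) := mul_le_of_le_one_right h3 hq1
    rw [add_mul] at h2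
    exact h2.trans (by linarith)
  have h3 : y * (1 + mdl.rate q y) = mdl.a * y + mdl.h y * q := by
    rw [rate, h_eq]; ring
  have h4 : (mdl.a * mdl.topSum ξ k n + k * mdl.b) / n = mdl.a * y +
      ∑ i ∈ Finset.Ico 1 k, mdl.a * ((mdl.maxDeg ξ i n : ℝ) / n) + k * mdl.b / n := by
    rw [topSum, hsplit, Finset.sum_insert hknot, ← Finset.mul_sum, ← Finset.sum_div]
    push_cast
    rw [hy]
    ring
  rw [driftUp, h4, hsplit, Finset.sum_insert hknot, h3, Finset.sum_add_distrib, ← hq]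
  have h5 : (k * mdl.b + k * mdl.d * (mdl.M + 1) + mdl.d * mdl.β) / (n : ℝ) = k * mdl.b / n +
    k * mdl.d * ((mdl.M + 1) / n) + mdl.d * mdl.β / n := by ring
  rw [h5]
  linarith

variable {ξ} {k : ℕ} {x : ℕ → ℝ}

/-- By `f i x = 0`, the first `k - 1` vertices contribute `∑ x i` to the upper drift in the limit.
-/
lemma eventually_driftUp_le (hk : 1 ≤ k)
    (h : ∀ i ∈ Finset.Ico 1 k, Tendsto (fun n : ℕ => (mdl.maxDeg ξ i n : ℝ) / n) atTop (𝓝 (x i)))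
    (hf : ∀ i ∈ Finset.Ico 1 k, mdl.f i x = 0) {η : ℝ} (hη : 0 < η) :
    ∀ᶠ n : ℕ in atTop, mdl.driftUp ξ k n ≤ (mdl.maxDeg ξ k n : ℝ) / n * (1 + mdl.rate
      (mdl.Q k x) ((mdl.maxDeg ξ k n : ℝ) / n)) + ∑ i ∈ Finset.Ico 1 k, x i + η := by
  have h1 : Tendsto (fun n : ℕ => ∑ i ∈ Finset.Ico 1 k, (mdl.a * ((mdl.maxDeg ξ i n : ℝ) / n) +
        mdl.topHit ξ n i * mdl.Qt i (mdl.topHit ξ n)) +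
      (k * mdl.b + k * mdl.d * (mdl.M + 1) + mdl.d * mdl.β) / (n : ℝ) +
      |mdl.Qt k (mdl.topHit ξ n) - mdl.Q k x|) atTop
      (𝓝 (∑ i ∈ Finset.Ico 1 k, x i + 0 + |mdl.Q k x - mdl.Q k x|)) := by
    refine (Tendsto.add ?_ (tendsto_const_nhds.div_atTop tendsto_natCast_atTop_atTop)).add
      ((mdl.tendsto_Qt_topHit h).sub_const _).abs
    refine tendsto_finsetSum _ fun i hi => ?_
    have hi' := Finset.mem_Ico.1 hi
    have h2 : mdl.a * x i + mdl.h (x i) * mdl.Q i x = x i := by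
      have := hf i hi
      rw [f] at this; linarith
    rw [← h2]
    exact ((h i hi).const_mul _).add ((mdl.tendsto_topHit hi'.1 (h i hi)).mul
      (mdl.tendsto_Qt_topHit fun j hj => h j (Finset.mem_Ico.2
        ⟨(Finset.mem_Ico.1 hj).1, (Finset.mem_Ico.1 hj).2.trans hi'.2⟩)))
  rw [sub_self, abs_zero, add_zero, add_zero] at h1
  filter_upwards [h1.eventually_lt_const (lt_add_of_pos_right _ hη),
    mdl.eventually_mul_maxDeg_add_le ξ hk mdl.α_pos mdl.α_lt (q := mdl.β),
    Filter.eventually_ge_atTop 1] with n h2 h3 hn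
  have hn0 : (0 : ℝ) < n := by exact_mod_cast hn
  refine (mdl.driftUp_le ξ hk hn h3).trans ?_
  set y : ℝ := (mdl.maxDeg ξ k n : ℝ) / n with hy
  have hy0 : 0 ≤ y := by positivity
  have hy1 : mdl.α * y ≤ 1 := by
    rw [hy, ← mul_div_assoc, div_le_one hn0]
    linarith [mdl.β_pos]
  set q : ℝ := mdl.Qt k (mdl.topHit ξ n) with hq
  have h4 : y * (1 + mdl.rate q y) = y * (1 + mdl.rate (mdl.Q k x) y) +
      mdl.h y * (q - mdl.Q k x) := by
    rw [rate, rate, h_eq]; ring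
  have h5 : mdl.h y * (q - mdl.Q k x) ≤ |q - mdl.Q k x| :=
    (mul_le_mul_of_nonneg_left (le_abs_self _) (mdl.h_nonneg hy0 hy1)).trans
      (mul_le_of_le_one_left (abs_nonneg _) (mdl.h_le_one hy1))
  linarith

/-- As long as `maxDeg k n / n` stays below `c`, which is less than the limit for the vertex before,
the lower drift is the one of the limiting dynamics, up to `η`. -/
lemma eventually_le_driftLow (hk : 1 ≤ k)
    (h : ∀ i ∈ Finset.Ico 1 k, Tendsto (fun n : ℕ => (mdl.maxDeg ξ i n : ℝ) / n) atTop (𝓝 (x i)))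
    (hM : Tendsto (fun n => mdl.maxDeg ξ k n) atTop atTop) {c : ℝ} (hc0 : 0 ≤ c)
    (hc : mdl.α * c ≤ 1) (hsep : k = 1 ∨ c < x (k - 1)) (hQ : 0 < mdl.Q k x) {η : ℝ} (hη : 0 < η) :
    ∀ᶠ n : ℕ in atTop, (mdl.maxDeg ξ k n : ℝ) / n ≤ c →
      (1 + mdl.rate (mdl.Q k x) c - η) * ((mdl.maxDeg ξ k n : ℝ) / n) ≤ mdl.driftLow ξ k n := by
  have hα := mdl.α_pos
  have hd : (0 : ℝ) < mdl.d := by exact_mod_cast mdl.d_pos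
  have hlim : Tendsto (fun n : ℕ => mdl.Qt k (mdl.topHit ξ n) -
      (1 + (k - 1 : ℕ) * mdl.d * (mdl.M + 1)) / (n : ℝ)) atTop (𝓝 (mdl.Q k x - 0)) :=
    (mdl.tendsto_Qt_topHit h).sub
      (tendsto_const_nhds.div_atTop tendsto_natCast_atTop_atTop)
  rw [sub_zero] at hlim
  have hsep' : ∀ᶠ n : ℕ in atTop, (mdl.maxDeg ξ k n : ℝ) / n ≤ c →
      k = 1 ∨ mdl.maxDeg ξ k n + 2 ≤ mdl.maxDeg ξ (k - 1) n := by
    rcases hsep with hk1 | hsep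
    · exact Filter.Eventually.of_forall fun n _ => Or.inl hk1
    · by_cases hk1 : k = 1
      · exact Filter.Eventually.of_forall fun n _ => Or.inl hk1
      have h1 : Tendsto (fun n : ℕ => (mdl.maxDeg ξ (k - 1) n : ℝ) / n - 2 / n) atTop
          (𝓝 (x (k - 1) - 0)) :=
        (h (k - 1) (Finset.mem_Ico.2 (by omega))).sub
          (tendsto_const_nhds.div_atTop tendsto_natCast_atTop_atTop)
      rw [sub_zero] at h1
      filter_upwards [h1.eventually_const_lt hsep, Filter.eventually_ge_atTop 1] with n hn hn1 hy
      have hn0 : (0 : ℝ) < n := by exact_mod_cast hn1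
      right
      have h2 : (mdl.maxDeg ξ k n : ℝ) / n < ((mdl.maxDeg ξ (k - 1) n : ℝ) - 2) / n := by
        rw [sub_div]; linarith
      rw [div_lt_div_iff_of_pos_right hn0] at h2
      have h3 : ((mdl.maxDeg ξ k n + 2 : ℕ) : ℝ) ≤ mdl.maxDeg ξ (k - 1) n := by
        push_cast; linarith
      exact_mod_cast h3
  filter_upwards [hsep', hM.eventually_ge_atTop 1, hlim.eventually_const_lt hQ,
    hlim.eventually_const_lt (show mdl.Q k x - η / (mdl.α * mdl.d) < mdl.Q k x from
      sub_lt_self _ (by positivity)),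
    mdl.eventually_mul_maxDeg_add_le ξ hk mdl.α_pos mdl.α_lt (q := mdl.β),
    mdl.eventually_mul_maxDeg_add_le ξ hk mdl.a_pos mdl.a_lt (q := mdl.b),
    Filter.eventually_ge_atTop 1] with n h1 h2 h3 h4 h5 h6 hn hy
  refine le_trans ?_ (mdl.le_driftLow ξ hn ⟨h2, h1 hy⟩ h6 h5 rfl h3.le)
  set y : ℝ := (mdl.maxDeg ξ k n : ℝ) / n with hydef
  have hy0 : 0 ≤ y := by positivity
  set q : ℝ := mdl.Qt k (mdl.topHit ξ n) - (1 + (k - 1 : ℕ) * mdl.d * (mdl.M + 1)) / (n : ℝ) with hq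
  rw [mul_comm]
  refine mul_le_mul_of_nonneg_left ?_ hy0
  have h7 := mdl.rate_anti h3.le hy hc
  have h8 : mdl.rate (mdl.Q k x) c - η ≤ mdl.rate q c := by
    have h9 := mdl.hgeom_le hc0 hc
    have h10 := mdl.one_le_hgeom hc
    have h11 : mdl.α * (mdl.Q k x - q) * mdl.hgeom c ≤ η := by
      have h12 : mdl.α * (mdl.Q k x - q) * mdl.hgeom c ≤
          mdl.α * (η / (mdl.α * mdl.d)) * mdl.hgeom c := by
        have : mdl.Q k x - q ≤ η / (mdl.α * mdl.d) := by linarith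
        gcongr
      refine h12.trans ?_
      calc mdl.α * (η / (mdl.α * mdl.d)) * mdl.hgeom c ≤ mdl.α * (η / (mdl.α * mdl.d)) * mdl.d := by
            gcongr
        _ = η := by field_simp
    rw [rate, rate]
    linarith
  linarith

/-- The lower drift is large enough for polynomial growth with every exponent below the growth
rate of the limiting dynamics. -/
lemma eventually_startup (hk : 1 ≤ k)
    (h : ∀ i ∈ Finset.Ico 1 k, Tendsto (fun n : ℕ => (mdl.maxDeg ξ i n : ℝ) / n) atTop (𝓝 (x i)))
    (hM : Tendsto (fun n => mdl.maxDeg ξ k n) atTop atTop) {c : ℝ} (hc0 : 0 ≤ c)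
    (hc : mdl.α * c ≤ 1) (hsep : k = 1 ∨ c < x (k - 1)) (hQ : 0 < mdl.Q k x) {γ : ℝ}
    (hγ : γ < 1 + mdl.rate (mdl.Q k x) c) :
    ∀ᶠ n : ℕ in atTop, 1 ≤ (mdl.maxDeg ξ k n : ℝ) ∧ ((mdl.maxDeg ξ k n : ℝ) ≤ c * n →
      γ * (mdl.maxDeg ξ k n + 2) / n ≤ mdl.driftLow ξ k n) := by
  set η : ℝ := (1 + mdl.rate (mdl.Q k x) c - γ) / 2 with hη
  have hη0 : 0 < η := by linarith
  have hM' : Tendsto (fun n => (mdl.maxDeg ξ k n : ℝ)) atTop atTop :=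
    tendsto_natCast_atTop_atTop.comp hM
  filter_upwards [mdl.eventually_le_driftLow hk h hM hc0 hc hsep hQ hη0,
    hM'.eventually_ge_atTop (max 1 (2 * γ / η)), Filter.eventually_ge_atTop 1] with n h1 h2 hn
  have hn0 : (0 : ℝ) < n := by exact_mod_cast hn
  refine ⟨(le_max_left _ _).trans h2, fun h3 => ?_⟩
  refine le_trans ?_ (h1 ((div_le_iff₀ hn0).2 h3))
  have h4 := (le_max_right _ _).trans h2
  rw [div_le_iff₀ hη0] at h4
  rw [← mul_div_assoc]
  refine div_le_div_of_nonneg_right ?_ hn0.le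
  have h5 : 1 + mdl.rate (mdl.Q k x) c - η = γ + η := by rw [hη]; ring
  rw [h5]
  linarith

lemma eventually_rpow_le_mul {ε : ℝ} (hε : 0 < ε) :
    ∀ᶠ n : ℕ in atTop, (n : ℝ) ^ (2 / 3 : ℝ) ≤ ε * n := by
  have h1 : Tendsto (fun n : ℕ => (n : ℝ) ^ (-(1 / 3) : ℝ)) atTop (𝓝 0) :=
    (tendsto_rpow_neg_atTop (by norm_num)).comp tendsto_natCast_atTop_atTop
  filter_upwards [h1.eventually_le_const hε, Filter.eventually_ge_atTop 1] with n hn hn1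
  have hn0 : (0 : ℝ) < n := by exact_mod_cast hn1
  have h2 : (n : ℝ) ^ (2 / 3 : ℝ) = (n : ℝ) ^ (-(1 / 3) : ℝ) * n := by
    rw [← Real.rpow_add_one hn0.ne']; norm_num
  rw [h2]
  gcongr

/-- If `L'` is above the zero of the limiting dynamics, then `maxDeg k n / n` is eventually at most
`L`, for every `L > L'`. -/
lemma eventually_maxDeg_div_le (hk : 1 ≤ k)
    (h : ∀ i ∈ Finset.Ico 1 k, Tendsto (fun n : ℕ => (mdl.maxDeg ξ i n : ℝ) / n) atTop (𝓝 (x i)))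
    (hf : ∀ i ∈ Finset.Ico 1 k, mdl.f i x = 0) (hQ : 0 ≤ mdl.Q k x)
    (hA : ∀ᶠ n : ℕ in atTop, ∀ s, 1 ≤ s → s ≤ n →
      (mdl.topSum ξ k n : ℝ) ≤ mdl.topSum ξ k s +
        ∑ j ∈ Finset.Ico s n, mdl.driftUp ξ k j + (n : ℝ) ^ (2 / 3 : ℝ))
    {L' L : ℝ} (hL0 : 0 < L') (hL : L' < L) (hr : mdl.rate (mdl.Q k x) L' < 0) :
    ∀ᶠ n : ℕ in atTop, (mdl.maxDeg ξ k n : ℝ) / n ≤ L := by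
  set ρ : ℝ := -(L' * mdl.rate (mdl.Q k x) L') / 2 with hρ
  have hρ0 : 0 < ρ := by
    have := mul_neg_of_pos_of_neg hL0 hr
    linarith
  set X : ℝ := ∑ i ∈ Finset.Ico 1 k, x i with hX
  have hsum : ∀ n, (mdl.topSum ξ k n : ℝ) =
      mdl.maxDeg ξ k n + ∑ i ∈ Finset.Ico 1 k, (mdl.maxDeg ξ i n : ℝ) := by
    intro n
    have hsplit : Finset.Icc 1 k = insert k (Finset.Ico 1 k) := by
      ext i; simp; omega
    rw [topSum, hsplit, Finset.sum_insert (by simp)]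
    push_cast
    rfl
  have hS : Tendsto (fun n : ℕ => (∑ i ∈ Finset.Ico 1 k, (mdl.maxDeg ξ i n : ℝ)) / n) atTop
      (𝓝 X) := by
    simp only [Finset.sum_div]
    exact tendsto_finsetSum _ h
  refine eventually_div_le (M := fun n => (mdl.maxDeg ξ k n : ℝ)) (fun n => Nat.cast_nonneg _)
    (fun n => by exact_mod_cast mdl.maxDeg_succ_le ξ hk n) hL hρ0 fun ε hε => ?_
  have hε3 : 0 < ε / 3 := by positivity
  obtain ⟨N, hN⟩ := Filter.eventually_atTop.1 (hA.and ((mdl.eventually_driftUp_le hk h hf hρ0).and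
    ((mdl.eventually_mul_maxDeg_add_le ξ hk mdl.α_pos mdl.α_lt (q := mdl.β)).and
    ((eventually_rpow_le_mul hε3).and ((hS.eventually_lt_const (lt_add_of_pos_right X hε3)).and
    (hS.eventually_const_lt (sub_lt_self X hε3)))))))
  refine ⟨max 1 N, fun s n hs hsn hy => ?_⟩
  have hs1 : 1 ≤ s := (le_max_left _ _).trans hs
  have hsN : N ≤ s := (le_max_right _ _).trans hs
  have hs0 : (0 : ℝ) < s := by exact_mod_cast hs1
  have hn0 : (0 : ℝ) < n := by exact_mod_cast hs1.trans hsn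
  obtain ⟨hA', -, -, hn1, -, hn2⟩ := hN n (hsN.trans hsn)
  obtain ⟨-, -, -, -, hs2, -⟩ := hN s hsN
  have h1 := hA' s hs1 hsn
  rw [hsum, hsum] at h1
  have h2 : ∑ j ∈ Finset.Ico s n, mdl.driftUp ξ k j ≤
      ∑ j ∈ Finset.Ico s n, ((mdl.maxDeg ξ k j : ℝ) / j - ρ) + ((n : ℝ) - s) * X := by
    have h3 : ((n : ℝ) - s) * X = ∑ j ∈ Finset.Ico s n, X := by
      rw [Finset.sum_const, Nat.card_Ico, nsmul_eq_mul, Nat.cast_sub hsn]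
    rw [h3, ← Finset.sum_add_distrib]
    refine Finset.sum_le_sum fun j hj => ?_
    have hj' := Finset.mem_Ico.1 hj
    obtain ⟨-, h4, h5, -⟩ := hN j (hsN.trans hj'.1)
    have hj0 : (0 : ℝ) < j := hs0.trans_le (by exact_mod_cast hj'.1)
    have h6 := hy j hj
    set y : ℝ := (mdl.maxDeg ξ k j : ℝ) / j with hydef
    have hy1 : mdl.α * y ≤ 1 := by
      rw [hydef, ← mul_div_assoc, div_le_one hj0]
      linarith [mdl.β_pos]
    have h7 := mdl.rate_anti hQ h6 hy1
    -- `rate` is negative and decreasing beyond `L'`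
    have h8 : y * mdl.rate (mdl.Q k x) y ≤ L' * mdl.rate (mdl.Q k x) L' := by nlinarith
    have h9 : L' * mdl.rate (mdl.Q k x) L' = -(2 * ρ) := by rw [hρ]; ring
    linarith
  have h3 : (∑ i ∈ Finset.Ico 1 k, (mdl.maxDeg ξ i s : ℝ)) ≤ (X + ε / 3) * s := by
    rw [div_lt_iff₀ hs0] at hs2; exact hs2.le
  have h4 : (X - ε / 3) * n ≤ ∑ i ∈ Finset.Ico 1 k, (mdl.maxDeg ξ i n : ℝ) := by
    rw [lt_div_iff₀ hn0] at hn2; exact hn2.le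
  have h5 : ε / 3 * s ≤ ε / 3 * n := by
    have : (s : ℝ) ≤ n := by exact_mod_cast hsn
    gcongr
  linarith

/-- If `c` is below the zero of the limiting dynamics, then `maxDeg k n / n` is eventually at least
`c'`, for every `c' < c`. -/
lemma eventually_le_maxDeg_div (hk : 1 ≤ k)
    (h : ∀ i ∈ Finset.Ico 1 k, Tendsto (fun n : ℕ => (mdl.maxDeg ξ i n : ℝ) / n) atTop (𝓝 (x i)))
    (hM : Tendsto (fun n => mdl.maxDeg ξ k n) atTop atTop)
    (hpow : ∀ᶠ n : ℕ in atTop, (n : ℝ) ^ (9 / 10 : ℝ) ≤ mdl.maxDeg ξ k n)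
    (hB : ∀ᶠ n : ℕ in atTop, ∀ s, 1 ≤ s → s ≤ n →
      (mdl.maxDeg ξ k s : ℝ) + ∑ j ∈ Finset.Ico s n, mdl.driftLow ξ k j -
        (n : ℝ) ^ (2 / 3 : ℝ) ≤ mdl.maxDeg ξ k n)
    {c' c : ℝ} (hc0 : 0 < c') (hcc : c' < c) (hc : mdl.α * c ≤ 1) (hsep : k = 1 ∨ c < x (k - 1))
    (hQ : 0 < mdl.Q k x) (hr : 0 < mdl.rate (mdl.Q k x) c) :
    ∀ᶠ n : ℕ in atTop, c' ≤ (mdl.maxDeg ξ k n : ℝ) / n := by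
  refine eventually_le_div (M := fun n => (mdl.maxDeg ξ k n : ℝ))
    (fun s n hsn => Nat.cast_le.2 (mdl.maxDeg_mono ξ hk hsn)) hpow hc0 hcc (half_pos hr) ?_
  obtain ⟨N, hN⟩ := Filter.eventually_atTop.1 (hB.and
    (mdl.eventually_le_driftLow hk h hM (hc0.trans hcc).le hc hsep hQ (half_pos hr)))
  refine ⟨max 1 N, fun s n hs hsn hy => ?_⟩
  have hs1 : 1 ≤ s := (le_max_left _ _).trans hs
  have hsN : N ≤ s := (le_max_right _ _).trans hs
  have h1 := (hN n (hsN.trans hsn)).1 s hs1 hsn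
  have h2 : ∑ j ∈ Finset.Ico s n, (1 + mdl.rate (mdl.Q k x) c / 2) * ((mdl.maxDeg ξ k j : ℝ) / j) ≤
      ∑ j ∈ Finset.Ico s n, mdl.driftLow ξ k j := by
    refine Finset.sum_le_sum fun j hj => ?_
    have h3 := (hN j (hsN.trans (Finset.mem_Ico.1 hj).1)).2 (hy j hj)
    have h4 : 1 + mdl.rate (mdl.Q k x) c - mdl.rate (mdl.Q k x) c / 2 =
      1 + mdl.rate (mdl.Q k x) c / 2 := by ring
    rwa [h4] at h3
  linarith

end Model

/-! ### Proof of the three regimes -/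

namespace Model

variable (mdl : Model)

lemma alpha_mul_le_one {x : ℝ} (hx : x ≤ 2) : mdl.α * x ≤ 1 := by
  have h1 := mul_le_mul_of_nonneg_left hx mdl.α_pos.le
  have := mdl.α_lt
  linarith

lemma Q_one (x : ℕ → ℝ) : mdl.Q 1 x = 1 := by rw [Q_eq_Qt, Qt_one]

lemma rate_one_zero : mdl.rate 1 0 = mdl.a + mdl.d * mdl.α - 1 := by
  rw [rate, hgeom_zero]; ring

lemma exists_lt_rate {r : ℝ} (hr : r < mdl.a + mdl.d * mdl.α - 1) :
    ∃ c : ℝ, 0 < c ∧ c ≤ 2 ∧ r < mdl.rate 1 c := by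
  rw [← rate_one_zero] at hr
  have h1 : ∀ᶠ c in 𝓝[>] (0 : ℝ), r < mdl.rate 1 c :=
    (((mdl.continuous_rate 1).tendsto 0).mono_left nhdsWithin_le_nhds).eventually_const_lt hr
  obtain ⟨c, h2, h3⟩ := (h1.and (Ioc_mem_nhdsGT (show (0 : ℝ) < 2 by norm_num))).exists
  exact ⟨c, h3.1, h3.2, h2⟩

/-- Since `a, α < 1 / 2`, only `d ≥ 2` can be critical or supercritical. Then `hgeom` is strictly
decreasing. -/
lemma two_le_d (h : 1 ≤ mdl.a + mdl.d * mdl.α) : 2 ≤ mdl.d := by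
  by_contra hd
  have h1 : mdl.d = 1 := by have := mdl.d_pos; omega
  rw [h1, Nat.cast_one, one_mul] at h
  linarith [mdl.a_lt, mdl.α_lt]

/-- In the supercritical case the limiting dynamics of the highest degree has a positive
zero. -/
lemma exists_isPosSol_one (h : 1 < mdl.a + mdl.d * mdl.α) : ∃ x : ℕ → ℝ, mdl.IsPosSol 1 x := by
  have h0 : 0 < mdl.rate 1 0 := by rw [rate_one_zero]; linarith
  have h2 : 2 * mdl.rate 1 2 < 0 := by
    have h3 : 2 * mdl.rate 1 2 = mdl.a * 2 + mdl.h 2 - 2 := by rw [rate, h_eq]; ring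
    have := mdl.h_le_one (mdl.alpha_mul_le_one le_rfl)
    have := mdl.a_lt
    linarith
  obtain ⟨c, ⟨hc0, hc2⟩, hc⟩ := intermediate_value_Icc' (show (0 : ℝ) ≤ 2 by norm_num)
    (mdl.continuous_rate 1).continuousOn
    (show (0 : ℝ) ∈ Set.Icc (mdl.rate 1 2) (mdl.rate 1 0) from ⟨by linarith, h0.le⟩)
  refine ⟨fun _ => c, fun i hi => ?_⟩
  have hi1 : i = 1 := by have := Finset.mem_Icc.1 hi; omega
  refine ⟨lt_of_le_of_ne hc0 fun h => ?_, hc2, ?_⟩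
  · have h' : 0 = c := h
    rw [← h'] at hc
    linarith
  · rw [f_eq, hi1, Q_one, hc, mul_zero]

variable {mdl} {K : ℕ} {x : ℕ → ℝ}

lemma IsPosSol.rate_eq_zero (hx : mdl.IsPosSol K x) {i : ℕ} (hi : i ∈ Finset.Icc 1 K) :
    mdl.rate (mdl.Q i x) (x i) = 0 := by
  obtain ⟨h0, -, h2⟩ := hx i hi
  rw [f_eq] at h2
  exact (mul_eq_zero.1 h2).resolve_left h0.ne'

lemma IsPosSol.Q_pos (hx : mdl.IsPosSol K x) {i : ℕ} (hi : i ∈ Finset.Icc 1 K) :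
    0 < mdl.Q i x := by
  have h1 := hx.rate_eq_zero hi
  have h2 := mdl.one_le_hgeom (mdl.alpha_mul_le_one (hx i hi).2.1)
  have h3 := mdl.α_pos
  have h4 := mdl.a_lt
  by_contra hQ
  have h5 : mdl.α * mdl.Q i x * mdl.hgeom (x i) ≤ 0 :=
    mul_nonpos_of_nonpos_of_nonneg (mul_nonpos_of_nonneg_of_nonpos h3.le (not_lt.1 hQ))
      (by linarith)
  rw [rate] at h1
  linarith

/-- The coordinates of a positive solution are nonincreasing. -/
lemma IsPosSol.succ_le (hx : mdl.IsPosSol K x) (hd : 2 ≤ mdl.d) {i : ℕ} (hi : 1 ≤ i)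
    (hiK : i + 1 ≤ K) : x (i + 1) ≤ x i := by
  have hi1 : i ∈ Finset.Icc 1 K := Finset.mem_Icc.2 (by omega)
  have hi2 : i + 1 ∈ Finset.Icc 1 K := Finset.mem_Icc.2 (by omega)
  by_contra hcon
  have h1 := hx.rate_eq_zero hi1
  have h2 := hx.rate_eq_zero hi2
  have h3 := mdl.rate_strictAnti hd (hx.Q_pos hi2) (not_le.1 hcon)
    (mdl.alpha_mul_le_one (hx _ hi2).2.1)
  have h4 : mdl.Q (i + 1) x ≤ mdl.Q i x := by
    rw [Q_eq_Qt, Q_eq_Qt]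
    refine mdl.Qt_succ_le hi fun j hj => ?_
    have hj' := Finset.mem_Ico.1 hj
    obtain ⟨h5, h6, -⟩ := hx j (Finset.mem_Icc.2 (by omega))
    exact ⟨mdl.h_nonneg h5.le (mdl.alpha_mul_le_one h6), mdl.h_le_one (mdl.alpha_mul_le_one h6)⟩
  have h5 : mdl.rate (mdl.Q (i + 1) x) (x i) ≤ mdl.rate (mdl.Q i x) (x i) := by
    have h6 := mdl.one_le_hgeom (mdl.alpha_mul_le_one (hx _ hi1).2.1)
    have h7 := mdl.α_pos
    rw [rate, rate]
    gcongr
  linarith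

variable (mdl)

lemma sum_range_cast (d : ℕ) : ∑ i ∈ Finset.range d, (i : ℝ) = d * (d - 1) / 2 := by
  induction d with
  | zero => simp
  | succ d ih => rw [Finset.sum_range_succ, ih]; push_cast; ring

lemma le_hgeom {y : ℝ} (hy : mdl.α * y ≤ 1) :
    mdl.d - mdl.α * y * (mdl.d * (mdl.d - 1) / 2) ≤ mdl.hgeom y := by
  have h : ∀ i ∈ Finset.range mdl.d, 1 - mdl.α * y * i ≤ (1 - mdl.α * y) ^ i := fun i _ => by
    have := one_add_mul_le_pow (a := -(mdl.α * y)) (by linarith) i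
    rw [← sub_eq_add_neg] at this
    linarith
  have h1 := Finset.sum_le_sum h
  rw [Finset.sum_sub_distrib, ← Finset.mul_sum, sum_range_cast] at h1
  simpa [hgeom] using h1

/-- Together with `le_hgeom`: the second order expansion of `hgeom` at `0`, from which the constant
in the critical case arises. -/
lemma hgeom_le_quadratic {y : ℝ} (hy0 : 0 ≤ y) (hy : mdl.α * y ≤ 1) :
    mdl.hgeom y ≤ mdl.d - mdl.α * y * (mdl.d * (mdl.d - 1) / 2) + mdl.d ^ 3 * (mdl.α * y) ^ 2 := by
  set t : ℝ := mdl.α * y with ht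
  have ht0 : 0 ≤ t := mul_nonneg mdl.α_pos.le hy0
  have hpow : ∀ i : ℕ, (1 - t) ^ i ≤ 1 - t * i + (i : ℝ) ^ 2 * t ^ 2 := by
    intro i
    induction i with
    | zero => simp
    | succ i ih =>
      have h1 := mul_le_mul_of_nonneg_right ih (show 0 ≤ 1 - t by linarith)
      rw [← pow_succ] at h1
      refine h1.trans ?_
      have h2 : 0 ≤ (i : ℝ) ^ 2 * t ^ 3 := by positivity
      have h3 : 0 ≤ ((i : ℝ) + 1) * t ^ 2 := by positivity
      push_cast
      nlinarith
  have h : ∀ i ∈ Finset.range mdl.d, (1 - t) ^ i ≤ 1 - t * i + (mdl.d : ℝ) ^ 2 * t ^ 2 := by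
    intro i hi
    refine (hpow i).trans ?_
    have : (i : ℝ) ≤ mdl.d := by exact_mod_cast (Finset.mem_range.1 hi).le
    gcongr
  have h1 := Finset.sum_le_sum h
  rw [Finset.sum_add_distrib, Finset.sum_sub_distrib, ← Finset.mul_sum, sum_range_cast,
    Finset.sum_const, Finset.sum_const, Finset.card_range, nsmul_eq_mul, nsmul_eq_mul,
    mul_one] at h1
  refine h1.trans (le_of_eq ?_)
  ring

variable {mdl} {ξ : Noise}

/-- Convergence of `maxDeg k n / n`, for a realization for which the `k`-th highest degree and the
sum of the `k` highest degrees follow their drifts. -/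
lemma IsPosSol.tendsto_maxDeg_div (hx : mdl.IsPosSol K x) (hd : 2 ≤ mdl.d) {k : ℕ}
    (hkK : k ∈ Finset.Icc 1 K)
    (h : ∀ i ∈ Finset.Ico 1 k, Tendsto (fun n : ℕ => (mdl.maxDeg ξ i n : ℝ) / n) atTop (𝓝 (x i)))
    (hM : Tendsto (fun n => mdl.maxDeg ξ k n) atTop atTop)
    (hA : ∀ᶠ n : ℕ in atTop, ∀ s, 1 ≤ s → s ≤ n →
      (mdl.topSum ξ k n : ℝ) ≤ mdl.topSum ξ k s +
        ∑ j ∈ Finset.Ico s n, mdl.driftUp ξ k j + (n : ℝ) ^ (2 / 3 : ℝ))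
    (hB : ∀ᶠ n : ℕ in atTop, ∀ s, 1 ≤ s → s ≤ n →
      (mdl.maxDeg ξ k s : ℝ) + ∑ j ∈ Finset.Ico s n, mdl.driftLow ξ k j -
        (n : ℝ) ^ (2 / 3 : ℝ) ≤ mdl.maxDeg ξ k n)
    (hstart : (∀ᶠ n : ℕ in atTop, 1 ≤ (mdl.maxDeg ξ k n : ℝ) ∧
      ((mdl.maxDeg ξ k n : ℝ) ≤ x k / 2 * n →
        (19 / 20) * (mdl.maxDeg ξ k n + 2) / n ≤ mdl.driftLow ξ k n)) →
      ∀ᶠ n : ℕ in atTop, (n : ℝ) ^ (9 / 10 : ℝ) ≤ mdl.maxDeg ξ k n) :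
    Tendsto (fun n : ℕ => (mdl.maxDeg ξ k n : ℝ) / n) atTop (𝓝 (x k)) := by
  have hk := (Finset.mem_Icc.1 hkK).1
  obtain ⟨hx0, hx2, -⟩ := hx k hkK
  have hQ := hx.Q_pos hkK
  have hr := hx.rate_eq_zero hkK
  have hα := mdl.α_pos
  have hαx := mdl.alpha_mul_le_one hx2
  have hsep : ∀ c, c < x k → k = 1 ∨ c < x (k - 1) := by
    intro c hc
    rcases Nat.lt_or_ge 1 k with h1 | h1
    · right
      have h2 := hx.succ_le hd (i := k - 1) (by omega)
        (by have := (Finset.mem_Icc.1 hkK).2; omega)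
      rw [Nat.sub_add_cancel hk] at h2
      exact hc.trans_le h2
    · left; omega
  have hαc : ∀ c, c < x k → mdl.α * c ≤ 1 := fun c hc => mdl.alpha_mul_le_one (hc.le.trans hx2)
  have hpow := hstart <| mdl.eventually_startup hk h hM (c := x k / 2) (by positivity)
    (hαc _ (by linarith)) (hsep _ (by linarith)) hQ (by
      have := mdl.rate_anti (x := x k / 2) hQ.le (by linarith) hαx
      linarith)
  refine tendsto_order.2 ⟨fun l hl => ?_, fun u hu => ?_⟩
  · set c' : ℝ := (max l 0 + x k) / 2 with hc'
    have hlx : max l 0 < x k := max_lt hl hx0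
    have hl0 : 0 ≤ max l 0 := le_max_right _ _
    set c : ℝ := (c' + x k) / 2 with hc
    have hcx : c < x k := by linarith
    have h1 := mdl.rate_strictAnti hd hQ hcx hαx
    filter_upwards [mdl.eventually_le_maxDeg_div hk h hM hpow hB (c' := c') (c := c)
      (by linarith) (by linarith) (hαc c hcx) (hsep c hcx) hQ (by linarith)] with n hn
    have := le_max_left l 0
    linarith
  · set L' : ℝ := min ((x k + u) / 2) (1 / mdl.α) with hL'
    have hxα : x k < 1 / mdl.α := by
      rw [lt_div_iff₀ hα]
      have := mdl.α_lt
      nlinarith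
    have hxL : x k < L' := lt_min (by linarith) hxα
    have hL1 : mdl.α * L' ≤ 1 := by
      have := min_le_right ((x k + u) / 2) (1 / mdl.α)
      rw [le_div_iff₀ hα] at this
      linarith
    have h1 := mdl.rate_strictAnti hd hQ hxL hL1
    have h2 : L' < u := (min_le_left _ _).trans_lt (by linarith)
    have hf : ∀ i ∈ Finset.Ico 1 k, mdl.f i x = 0 := fun i hi => by
      have hi' := Finset.mem_Ico.1 hi
      exact (hx i (Finset.mem_Icc.2 ⟨hi'.1, by
        have := (Finset.mem_Icc.1 hkK).2; omega⟩)).2.2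
    filter_upwards [mdl.eventually_maxDeg_div_le hk h hf hQ.le hA (L' := L') (L := (L' + u) / 2)
      (by linarith) (by linarith) (by linarith)] with n hn
    linarith

/-- The critical case, for a realization for which the highest degree follows its drift. -/
lemma tendsto_maxDeg_mul_log_div (hcrit : mdl.a + mdl.d * mdl.α = 1)
    (hA : ∀ᶠ n : ℕ in atTop, ∀ s, 1 ≤ s → s ≤ n →
      (mdl.topSum ξ 1 n : ℝ) ≤ mdl.topSum ξ 1 s +
        ∑ j ∈ Finset.Ico s n, mdl.driftUp ξ 1 j + (n : ℝ) ^ (2 / 3 : ℝ))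
    (hB : ∀ᶠ n : ℕ in atTop, ∀ s, 1 ≤ s → s ≤ n →
      (mdl.maxDeg ξ 1 s : ℝ) + ∑ j ∈ Finset.Ico s n, mdl.driftLow ξ 1 j -
        (n : ℝ) ^ (2 / 3 : ℝ) ≤ mdl.maxDeg ξ 1 n)
    (hpow : ∀ᶠ n : ℕ in atTop, (n : ℝ) ^ (9 / 10 : ℝ) ≤ mdl.maxDeg ξ 1 n) :
    Tendsto (fun n : ℕ => (mdl.maxDeg ξ 1 n : ℝ) * Real.log n / n) atTop
      (𝓝 (2 / (mdl.d * (mdl.d - 1) * mdl.α ^ 2))) := by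
  have hα := mdl.α_pos
  have hd := mdl.two_le_d hcrit.ge
  have hd' : (2 : ℝ) ≤ mdl.d := by exact_mod_cast hd
  set y : ℕ → ℝ := fun n => (mdl.maxDeg ξ 1 n : ℝ) / n with hy
  set c : ℝ := mdl.d * (mdl.d - 1) * mdl.α ^ 2 / 2 with hc
  have hc0 : 0 < c := by
    have : (0 : ℝ) < mdl.d - 1 := by linarith
    positivity
  have hy0 : ∀ n, 0 ≤ y n := fun n => by positivity
  have hlim : Tendsto y atTop (𝓝 0) := by
    refine tendsto_order.2 ⟨fun l hl => Filter.Eventually.of_forall fun n => hl.trans_le (hy0 n),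
      fun u hu => ?_⟩
    set L' : ℝ := min (u / 4) 2 with hL'
    have hL0 : 0 < L' := lt_min (by linarith) (by norm_num)
    have h1 := mdl.rate_strictAnti hd one_pos hL0 (mdl.alpha_mul_le_one (min_le_right _ _))
    rw [rate_one_zero, hcrit, sub_self] at h1
    have h2 : L' ≤ u / 4 := min_le_left _ _
    filter_upwards [mdl.eventually_maxDeg_div_le (x := fun _ => 0) le_rfl (by simp) (by simp)
      (by rw [Q_one]; norm_num) hA hL0 (L := u / 2) (by linarith) (by rwa [Q_one])] with n hn
    exact lt_of_le_of_lt hn (by linarith)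
  -- the rate near zero
  have hrate_le : ∀ {t : ℝ}, 0 ≤ t → mdl.α * t ≤ 1 →
      mdl.rate 1 t ≤ -(c * t) + mdl.α ^ 3 * mdl.d ^ 3 * t ^ 2 := by
    intro t ht0 ht
    have h1 := mul_le_mul_of_nonneg_left (mdl.hgeom_le_quadratic ht0 ht) hα.le
    rw [rate, hc]
    linarith
  have hle_rate : ∀ {t : ℝ}, mdl.α * t ≤ 1 → -(c * t) ≤ mdl.rate 1 t := by
    intro t ht
    have h1 := mul_le_mul_of_nonneg_left (mdl.le_hgeom ht) hα.le
    rw [rate, hc]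
    linarith
  have herr : ∀ K : ℝ, 0 ≤ K → ∀ᶠ n : ℕ in atTop, K / n ≤ y n ^ 2 := by
    intro K hK
    filter_upwards [eventually_error_le hpow K, Filter.eventually_ge_atTop 1] with n hn hn1
    refine le_trans ?_ hn
    have h1 : (1 : ℝ) ≤ (n : ℝ) ^ (2 / 3 : ℝ) :=
      Real.one_le_rpow (by exact_mod_cast hn1) (by norm_num)
    rw [← mul_div_assoc]
    gcongr
    exact le_mul_of_one_le_right hK h1
  have hsmall : ∀ᶠ n : ℕ in atTop, y n < 1 := hlim.eventually_lt_const one_pos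
  have hαy : ∀ {n}, y n < 1 → mdl.α * y n ≤ 1 := fun h =>
    mdl.alpha_mul_le_one (h.le.trans (by norm_num))
  have hupper : ∀ C₀, 0 < C₀ → C₀ < c → ∀ᶠ n : ℕ in atTop, C₀ * harm n ≤ 1 / y n := by
    intro C₀ hC₀ hC
    set C₁ : ℝ := (C₀ + c) / 2 with hC₁
    refine eventually_mul_harm_le (M := fun n => (mdl.maxDeg ξ 1 n : ℝ)) hpow hlim hC₀
      (C₁ := C₁) (by linarith) ?_
    set D : ℝ := (1 : ℕ) * mdl.b + (1 : ℕ) * mdl.d * (mdl.M + 1) + mdl.d * mdl.β with hD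
    have hD0 : 0 ≤ D := by
      have := mdl.b_pos
      have := mdl.β_pos
      positivity
    have hτ : 0 < (c - C₁) / 2 := by linarith
    obtain ⟨N, hN⟩ := Filter.eventually_atTop.1 (hA.and (hsmall.and
      ((herr (D / ((c - C₁) / 2)) (div_nonneg hD0 hτ.le)).and
      ((hlim.eventually_lt_const (show 0 < (c - C₁) / 2 / (mdl.α ^ 3 * mdl.d ^ 3) by
        positivity)).and
      (mdl.eventually_mul_maxDeg_add_le ξ le_rfl mdl.α_pos mdl.α_lt (q := mdl.β))))))
    refine ⟨max 1 N, fun s n hs hsn => ?_⟩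
    have hs1 : 1 ≤ s := (le_max_left _ _).trans hs
    have hsN : N ≤ s := (le_max_right _ _).trans hs
    have h1 := (hN n (hsN.trans hsn)).1 s hs1 hsn
    simp only [topSum, Finset.Icc_self, Finset.sum_singleton] at h1
    refine h1.trans ?_
    gcongr with j hj
    have hj' := Finset.mem_Ico.1 hj
    obtain ⟨-, h2, h3, h4, h5⟩ := hN j (hsN.trans hj'.1)
    have h6 := mdl.driftUp_le ξ le_rfl (hs1.trans hj'.1) h5
    rw [Finset.Ico_self, Finset.sum_empty, add_zero, Qt_one, ← hD] at h6
    refine h6.trans ?_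
    change y j * (1 + mdl.rate 1 (y j)) + D / j ≤ y j - C₁ * y j ^ 2
    have h7 := mul_le_mul_of_nonneg_left (hrate_le (hy0 j) (hαy h2)) (hy0 j)
    have h8 : D / j ≤ (c - C₁) / 2 * y j ^ 2 := by
      have h9 : D / ((c - C₁) / 2) / j = D / j / ((c - C₁) / 2) := by ring
      rw [h9, div_le_iff₀ hτ] at h3
      linarith
    have h9 : y j * (mdl.α ^ 3 * mdl.d ^ 3 * y j ^ 2) ≤ (c - C₁) / 2 * y j ^ 2 := by
      rw [lt_div_iff₀ (by positivity)] at h4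
      have := mul_le_mul_of_nonneg_right h4.le (sq_nonneg (y j))
      linarith
    nlinarith
  have hlower : ∀ C₀, c < C₀ → ∀ᶠ n : ℕ in atTop, 1 / y n ≤ C₀ * harm n := by
    intro C₀ hC
    set C₁ : ℝ := (C₀ + c) / 2 with hC₁
    refine eventually_le_mul_harm (M := fun n => (mdl.maxDeg ξ 1 n : ℝ))
      (fun s n hsn => Nat.cast_le.2 (mdl.maxDeg_mono ξ le_rfl hsn)) hpow hlim (C₁ := C₁)
      (by linarith) (by linarith) ?_
    have hτ : 0 < C₁ - c := by linarith
    obtain ⟨N, hN⟩ := Filter.eventually_atTop.1 (hB.and (hsmall.and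
      ((herr (mdl.α * mdl.d / (C₁ - c)) (by positivity)).and
      ((mdl.eventually_mul_maxDeg_add_le ξ le_rfl mdl.a_pos mdl.a_lt (q := mdl.b)).and
      ((mdl.eventually_mul_maxDeg_add_le ξ le_rfl mdl.α_pos mdl.α_lt (q := mdl.β)).and
      (eventually_pos hpow))))))
    refine ⟨max 1 N, fun s n hs hsn => ?_⟩
    have hs1 : 1 ≤ s := (le_max_left _ _).trans hs
    have hsN : N ≤ s := (le_max_right _ _).trans hs
    have h1 := (hN n (hsN.trans hsn)).1 s hs1 hsn
    refine le_trans ?_ h1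
    gcongr with j hj
    have hj' := Finset.mem_Ico.1 hj
    obtain ⟨-, h2, h3, h4, h5, h6⟩ := hN j (hsN.trans hj'.1)
    have hj1 : 1 ≤ j := hs1.trans hj'.1
    have hj1' : (1 : ℝ) ≤ j := by exact_mod_cast hj1
    have hj0 : (0 : ℝ) < j := by linarith
    have hM1 : 1 ≤ mdl.maxDeg ξ 1 j := by
      have h7 : (0 : ℝ) < mdl.maxDeg ξ 1 j := by
        rwa [div_pos_iff_of_pos_right hj0] at h6
      exact_mod_cast h7
    have hq0 : (0 : ℝ) ≤ 1 - 1 / j := by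
      rw [sub_nonneg, div_le_one hj0]; exact hj1'
    have h7 := mdl.le_driftLow ξ hj1 ⟨hM1, Or.inl rfl⟩ h4 h5 (q := 1 - 1 / j)
      (by rw [Qt_one]; simp) hq0
    refine le_trans ?_ h7
    change y j - C₁ * y j ^ 2 ≤ y j * (1 + mdl.rate (1 - 1 / j) (y j))
    have h8 : mdl.rate 1 (y j) - mdl.α * mdl.d / j ≤ mdl.rate (1 - 1 / j) (y j) := by
      have h9 := mdl.hgeom_le (hy0 j) (hαy h2)
      have h10 : mdl.α * (1 / j) * mdl.hgeom (y j) ≤ mdl.α * (1 / j) * mdl.d := by gcongr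
      have h11 : mdl.α * mdl.d / j = mdl.α * (1 / j) * mdl.d := by ring
      rw [rate, rate, h11]
      linarith
    have h9 := hle_rate (hαy h2)
    have h10 : mdl.α * mdl.d / j ≤ (C₁ - c) * y j := by
      have h11 : mdl.α * mdl.d / (C₁ - c) / j = mdl.α * mdl.d / j / (C₁ - c) := by ring
      rw [h11, div_le_iff₀ hτ] at h3
      have h12 : y j ^ 2 ≤ y j := by
        rw [sq]; exact mul_le_of_le_one_left (hy0 j) h2.le
      nlinarith
    have h11 : -(C₁ * y j) ≤ mdl.rate (1 - 1 / j) (y j) := by linarith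
    have h12 := mul_le_mul_of_nonneg_left h11 (hy0 j)
    linarith
  have hpos := eventually_pos hpow
  have hinv : Tendsto (fun n => 1 / y n / harm n) atTop (𝓝 c) := by
    refine tendsto_order.2 ⟨fun l hl => ?_, fun u hu => ?_⟩
    · filter_upwards [hupper ((max l 0 + c) / 2) (by
        have := le_max_right l 0
        linarith) (by
        have := max_lt hl hc0
        linarith), tendsto_harm.eventually_gt_atTop 0] with n hn hn0
      rw [← le_div_iff₀ hn0] at hn
      have h1 := le_max_left l 0
      linarith
    · filter_upwards [hlower ((u + c) / 2) (by linarith),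
        tendsto_harm.eventually_gt_atTop 0] with n hn hn0
      rw [← div_le_iff₀ hn0] at hn
      linarith
  have hfin := (hinv.inv₀ hc0.ne').mul (tendsto_harm_div_log.inv₀ one_ne_zero)
  have hval : c⁻¹ * (1 : ℝ)⁻¹ = 2 / (mdl.d * (mdl.d - 1) * mdl.α ^ 2) := by
    rw [hc, inv_one, mul_one, inv_div]
  rw [hval] at hfin
  refine hfin.congr' ?_
  filter_upwards [hpos, tendsto_harm.eventually_gt_atTop 0] with n hn hn0
  have h1 : y n ≠ 0 := hn.ne'
  have h2 : (mdl.maxDeg ξ 1 n : ℝ) * Real.log n / n = y n * Real.log n := by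
    simp only [hy]; ring
  rw [h2]
  field_simp

end Model

namespace IsNoise

variable {Ω : Type*} {mΩ : MeasurableSpace Ω} {P : Measure Ω} [IsProbabilityMeasure P]
  {mdl : Model} {ξ : Ω → Noise} (hξ : IsNoise mdl P ξ)

include hξ

/-- Polynomial lower bound for the highest degree. -/
lemma ae_eventually_rpow_le_maxDeg {γ : ℝ} (hγ0 : 0 < γ) (hγ1 : γ < 1)
    (hγ : γ < mdl.a + mdl.d * mdl.α) :
    ∀ᵐ ω ∂P, ∀ᶠ n : ℕ in atTop, (n : ℝ) ^ γ ≤ mdl.maxDeg (ξ ω) 1 n := by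
  set g : ℝ := min 1 (mdl.a + mdl.d * mdl.α) with hg
  have hgγ : γ < g := lt_min hγ1 hγ
  have hg1 : g ≤ 1 := min_le_left _ _
  have hg2 : g ≤ mdl.a + mdl.d * mdl.α := min_le_right _ _
  obtain ⟨c, hc0, hc2, hc⟩ := mdl.exists_lt_rate (r := (γ + g) / 2 - 1) (by linarith)
  filter_upwards [hξ.ae_rpow_le_maxDeg le_rfl hγ0 (γ := (γ + g) / 2) (by linarith)
    (by linarith) hc0, hξ.ae_tendsto_maxDeg le_rfl] with ω h1 h2
  exact h1 (mdl.eventually_startup (x := fun _ => 0) le_rfl (by simp) h2 hc0.le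
    (mdl.alpha_mul_le_one hc2) (Or.inl rfl) (by rw [mdl.Q_one]; exact one_pos)
    (by rw [mdl.Q_one]; linarith))

/-- Induction on the rank: once the first `k` highest degrees converge, the dynamics of the next one
is autonomous in the limit. -/
lemma ae_tendsto_of_isPosSol (hd : 2 ≤ mdl.d) {K : ℕ} {x : ℕ → ℝ} (hx : mdl.IsPosSol K x)
    {k : ℕ} (hk : k ≤ K) : ∀ᵐ ω ∂P, ∀ i ∈ Finset.Ico 1 (k + 1),
      Tendsto (fun n : ℕ => (mdl.maxDeg (ξ ω) i n : ℝ) / n) atTop (𝓝 (x i)) := by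
  induction k with
  | zero => simp
  | succ k ih =>
    have hkK : k + 1 ∈ Finset.Icc 1 K := Finset.mem_Icc.2 ⟨by omega, hk⟩
    have hx0 := (hx _ hkK).1
    filter_upwards [ih (by omega), hξ.ae_tendsto_maxDeg (k := k + 1) (by omega),
      hξ.ae_topSum_le (k + 1), hξ.ae_le_maxDeg (k := k + 1) (by omega),
      hξ.ae_rpow_le_maxDeg (k := k + 1) (by omega) (γ' := 9 / 10) (γ := 19 / 20)
        (δ := x (k + 1) / 2) (by norm_num) (by norm_num) (by norm_num) (by positivity)]
      with ω h1 h2 h3 h4 h5 i hi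
    rcases Nat.lt_succ_iff_lt_or_eq.1 (Finset.mem_Ico.1 hi).2 with hi' | rfl
    · exact h1 i (Finset.mem_Ico.2 ⟨(Finset.mem_Ico.1 hi).1, hi'⟩)
    · exact hx.tendsto_maxDeg_div hd hkK h1 h2 h3 h4 h5

end IsNoise

end SpatialPA

theorem theorem1 {Ω : Type*} [MeasurableSpace Ω] (P : Measure Ω) [IsProbabilityMeasure P]
    (mdl : SpatialPA.Model) (ξ : Ω → SpatialPA.Noise) (hξ : SpatialPA.IsNoise mdl P ξ) :
    (mdl.a + mdl.d * mdl.α < 1 → ∀ ε : ℝ, 0 < ε →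
      Tendsto (fun N : ℕ => P {ω | ∀ n : ℕ, N < n →
          (n : ℝ) ^ (mdl.a + mdl.d * mdl.α - ε) < (mdl.maxDeg (ξ ω) 1 n : ℝ) ∧
          (mdl.maxDeg (ξ ω) 1 n : ℝ) < (n : ℝ) ^ (mdl.a + mdl.d * mdl.α + ε)})
        atTop (𝓝 1)) ∧
    (mdl.a + mdl.d * mdl.α = 1 →
      ∀ᵐ ω ∂P, Tendsto (fun n : ℕ => (mdl.maxDeg (ξ ω) 1 n : ℝ) * Real.log n / n)
        atTop (𝓝 (2 / (mdl.d * (mdl.d - 1) * mdl.α ^ 2)))) ∧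
    (1 < mdl.a + mdl.d * mdl.α →
      (∃ x : ℕ → ℝ, mdl.IsPosSol 1 x) ∧
      ∀ (K : ℕ) (x : ℕ → ℝ), mdl.IsPosSol K x → ∀ k ∈ Finset.Icc 1 K,
        ∀ᵐ ω ∂P, Tendsto (fun n : ℕ => (mdl.maxDeg (ξ ω) k n : ℝ) / n) atTop (𝓝 (x k))) := by
  refine ⟨fun hsub ε hε => ?_, fun hcrit => ?_, fun hsup =>
    ⟨mdl.exists_isPosSol_one hsup, fun K x hx k hk => ?_⟩⟩
  · set g : ℝ := mdl.a + mdl.d * mdl.α with hg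
    have hg0 : 0 < g := by
      have := mdl.a_pos
      have := mdl.α_pos
      positivity
    set γ : ℝ := max (g - ε / 2) (g / 2) with hγ
    have hγg : γ < g := max_lt (by linarith) (by linarith)
    have hγ0 : 0 < γ := lt_max_of_lt_right (by linarith)
    have hγε : g - ε < γ := lt_max_of_lt_left (by linarith)
    set S : ℕ → Set Ω := fun N => {ω | ∀ n : ℕ, N < n →
      (n : ℝ) ^ (g - ε) < (mdl.maxDeg (ξ ω) 1 n : ℝ) ∧
      (mdl.maxDeg (ξ ω) 1 n : ℝ) < (n : ℝ) ^ (g + ε)} with hS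
    have hmono : Monotone S := fun N N' h ω hω n hn => hω n (h.trans_lt hn)
    have h1 : P (⋃ N, S N) = 1 := by
      rw [← measure_univ (μ := P)]
      refine measure_congr (eventuallyEq_univ.2 ?_)
      filter_upwards [hξ.ae_eventually_rpow_le_maxDeg hγ0 (hγg.trans hsub) hγg,
        hξ.ae_eventually_maxDeg_lt hε] with ω h2 h3
      obtain ⟨N, hN⟩ := Filter.eventually_atTop.1 (h2.and h3)
      refine Set.mem_iUnion.2 ⟨max 1 N, fun n hn => ?_⟩
      obtain ⟨h4, h5⟩ := hN n ((le_max_right _ _).trans hn.le)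
      have hn1 : (1 : ℝ) < n := by exact_mod_cast (le_max_left 1 N).trans_lt hn
      exact ⟨(Real.rpow_lt_rpow_of_exponent_lt hn1 hγε).trans_le h4, h5⟩
    rw [← h1]
    exact tendsto_measure_iUnion_atTop hmono
  · filter_upwards [hξ.ae_topSum_le 1, hξ.ae_le_maxDeg le_rfl,
      hξ.ae_eventually_rpow_le_maxDeg (γ := 9 / 10) (by norm_num) (by norm_num)
        (by rw [hcrit]; norm_num)] with ω h1 h2 h3
    exact SpatialPA.Model.tendsto_maxDeg_mul_log_div hcrit h1 h2 h3
  · have hk' := Finset.mem_Icc.1 hk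
    filter_upwards [hξ.ae_tendsto_of_isPosSol (mdl.two_le_d hsup.le) hx hk'.2] with ω hω
    exact hω k (Finset.mem_Ico.2 ⟨hk'.1, by omega⟩)
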